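/- **Languages.** Types are $t,u ::= \mathsf{int}\mid\mathsf{real}\mid\mathsf{unit}\mid t*u\mid t+u$, with $\mathsf{bool}=\mathsf{unit}+\mathsf{unit}$ ($\mathsf{true}$ is $\mathsf{inl}\,()$); a type is discrete if it does not contain $\mathsf{real}$. Write $\mathbf V_t$ for the set of values of type $t$. *Fun* is the first-order simply typed language with expressions $$M,N ::= x\mid c\mid (M,N)\mid \mathsf{fst}\,M\mid\mathsf{snd}\,M\mid\mathsf{inl}\,M\mid\mathsf{inr}\,M\mid \mathsf{match}\ M\ \mathsf{with}\ \mathsf{inl}\,x_1\to N_1\mid\mathsf{inr}\,x_2\to N_2\mid\mathsf{let}\ x=M\ \mathsf{in}\ N\mid f(M)\mid \mathsf{random}(D(M))\mid\mathsf{fail}_t ,$$ where $c$ is an integer, a real number or $()$, $f$ ranges over total measurable operations (arithmetic, comparison and logical operations and any further ones; $r/0=0$ and $\log r=0$ for $r\le 0$), and $D$ over primitive distributions: Bernoulli(bias), Poisson(rate), Gaussian(mean, standard deviation), Beta($a,b$), Gamma(shape, scale), and any further ones. For each argument $v$, $\mu_{D(v)}$ is a sub-probability measure (the zero measure when $v$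 is out of range) with a density $\mathrm{pdf}_{D(v)}(z)\ge 0$ with respect to stock measure, jointly measurable in $(v,z)$. $M$ is *pure* if it contains neither $\mathsf{random}$ nor $\mathsf{fail}$. The target language consists of the pure expressions, with operations including $\mathrm{pdf}_D$ and the bracket $[v=w]\in\{0,1\}$ at discrete types, and the stock integral $\int\lambda(x_1,\dots,x_n).E$ for $E:\mathsf{real}$. The operations $\mathsf{isL},\mathsf{isR}:t+u\to\mathsf{real}$ (indicators of the two summands) and $\mathsf{fromL}:t+u\to t$, $\mathsf{fromR}:t+u\to u$ (projections with a default value on the other summand) do not occur in source programs. **Semantics.** The stock measure is counting measure on $\mathsf{int}$ and $\mathsf{unit}$, Lebesgue measure on $\mathsf{real}$, and the Lebesgue-completed product and disjoint sum on $t*u$ and $t+u$. For a valuation $\sigma$, $\mathcal P[\![M]\!]\sigma$ is the measure that $M$ denotes in the sub-probability monad, with $\mathsf{return}\,V=\delta_V$, $(\mu\mathbin{>\!\!>\!\!=}f)(A)=\int f(x)(A)\,d\mu(x)$, $\mathcal P[\![\mathsf{random}(D(M))]\!]\sigma=\mathcal P[\![M]\!]\sigma\mathbin{>\!\!>\!\!=}\lambda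 v.\mu_{D(v)}$ and $\mathcal P[\![\mathsf{fail}]\!]\sigma=0$, and call-by-value sequencing otherwise. A target expression $E$ denotes a value $[\![E]\!]\sigma$ in the obvious way, where a stock integral denotes the Lebesgue integral with respect to stock measure, and $0$ if that integral is not well-defined as a real number. **Compiler.** A probability context $\Upsilon$ is a list of random variables $x$ and of deterministic variables $x=E$ with $E$ pure, over the preceding variables and the parameters. $\mathrm{rands}(\Upsilon)$ lists its random variables, and $\sigma_\Upsilon$ is the idempotent substitution that eliminates its deterministic variables. For $X\subseteq\mathrm{rands}(\Upsilon)$ and $\mathrm{rands}(\Upsilon)\setminus X=y_1,\dots,y_n$ let $\mathrm{marg}_{\Upsilon;E}(X)=\int\lambda(y_1,\dots,y_n).E\sigma_\Upsilon$. Call $M$ *constant* (under $\Upsilon$) if it is pure and no variable of $\mathrm{rands}(\Upsilon)$ is free in $M\sigma_\Upsilon$. The judgment $\Upsilon;E\vdash\mathrm{dens}(M)\Rightarrow\lambda z.F$, for $M$ and $E:\mathsf{real}$ over the parameters and $\Upsilon$, and $F:\mathsf{real}$ over the parameters and $z$, is defined inductively by the following rules, bound variables being fresh. Below $\mathrm{dens}(M)\Rightarrow\lambda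 z.F$ without a prefix is in $\Upsilon;E$. - $\mathrm{dens}(x)\Rightarrow\lambda z.F$ if $(x=E')\in\Upsilon$ and $\mathrm{dens}(E')\Rightarrow\lambda z.F$. - $\mathrm{dens}(x)\Rightarrow\lambda x.\mathrm{marg}(\{x\})$ if $x\in\mathrm{rands}(\Upsilon)$. - $\mathrm{dens}(V)\Rightarrow\lambda z.\mathrm{marg}(\emptyset)\cdot[z=V]$ for a closed value $V$ of discrete type. - $\mathrm{dens}(\mathsf{fail})\Rightarrow\lambda z.0$. - $\mathrm{dens}(\mathsf{random}(D(M)))\Rightarrow\lambda z.\mathrm{marg}(\emptyset)\cdot\mathrm{pdf}_{D(M\sigma_\Upsilon)}(z)$ if $M$ is constant; and $\Rightarrow\lambda z.\int\lambda w.F\cdot\mathrm{pdf}_{D(w)}(z)$ if $M$ is not constant and $\mathrm{dens}(M)\Rightarrow\lambda w.F$. - $\mathrm{dens}((x_1,\dots,x_k))\Rightarrow\lambda z.\mathsf{let}\ x_1,\dots,x_k=z\ \mathsf{in}\ \mathrm{marg}(\{x_1,\dots,x_k\})$ for $k\ge2$ distinct random variables. - If $\mathrm{dens}(M)\Rightarrow\lambda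 w.F$ then $\mathrm{dens}(\mathsf{fst}\,M)\Rightarrow\lambda z_1.\int\lambda z_2.\mathsf{let}\ w=(z_1,z_2)\ \mathsf{in}\ F$, and $\mathrm{dens}(\mathsf{snd}\,M)\Rightarrow\lambda z_2.\int\lambda z_1.\mathsf{let}\ w=(z_1,z_2)\ \mathsf{in}\ F$. - $\mathrm{dens}(\mathsf{let}\ x=M\ \mathsf{in}\ N)\Rightarrow\lambda z.F$ if $M$ is pure and $\Upsilon,x=M;E\vdash\mathrm{dens}(N)\Rightarrow\lambda z.F$; or if $M$ is not pure, $\varepsilon;1\vdash\mathrm{dens}(M)\Rightarrow\lambda x.F_1$ and $\Upsilon,x;E\cdot F_1\vdash\mathrm{dens}(N)\Rightarrow\lambda z.F$. - If $\mathrm{dens}(M)\Rightarrow\lambda z.F$ then $\mathrm{dens}(\mathsf{inl}\,M)\Rightarrow\lambda w.\mathsf{match}\ w\ \mathsf{with}\ \mathsf{inl}\,z\to F\mid\mathsf{inr}\,\_\to0$, and symmetrically for $\mathsf{inr}$. - $\mathrm{dens}(\mathsf{match}\ M\ \mathsf{with}\ \mathsf{inl}\,x_1\to N_1\mid\mathsf{inr}\,x_2\to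 N_2)\Rightarrow\lambda z.F_1+F_2$ in two cases. (a) $M$ is pure, $\Upsilon,x_1=\mathsf{fromL}(M);E\cdot\mathsf{isL}(M)\vdash\mathrm{dens}(N_1)\Rightarrow\lambda z.F_1$ and $\Upsilon,x_2=\mathsf{fromR}(M);E\cdot\mathsf{isR}(M)\vdash\mathrm{dens}(N_2)\Rightarrow\lambda z.F_2$. (b) $M$ is not pure, $\varepsilon;1\vdash\mathrm{dens}(M)\Rightarrow\lambda w.F$, $\Upsilon,x_1;E\cdot(\mathsf{let}\ w=\mathsf{inl}\,x_1\ \mathsf{in}\ F)\vdash\mathrm{dens}(N_1)\Rightarrow\lambda z.F_1$ and $\Upsilon,x_2;E\cdot(\mathsf{let}\ w=\mathsf{inr}\,x_2\ \mathsf{in}\ F)\vdash\mathrm{dens}(N_2)\Rightarrow\lambda z.F_2$. - $\mathrm{dens}(\mathsf{fromL}(M))\Rightarrow\lambda z.\mathsf{let}\ w=\mathsf{inl}\,z\ \mathsf{in}\ F$ if $(x=\mathsf{fromL}(M))\in\Upsilon$ for some $x$ and $\mathrm{dens}(M)\Rightarrow\lambda w.F$; symmetrically for $\mathsf{fromR}$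 and $\mathsf{inr}$. - $\mathrm{dens}(f(M))\Rightarrow\lambda w.\int\lambda(x_1,\dots,x_n).\mathrm{marg}(\{x_1,\dots,x_n\})\cdot[w=f(M\sigma_\Upsilon)]$ if $M$ is pure, $f$ is neither $\mathsf{fromL}$ nor $\mathsf{fromR}$ and has discrete result type, and $x_1,\dots,x_n$ are the random variables of $\Upsilon$ that are free in $M\sigma_\Upsilon$. - If $\mathrm{dens}(M)\Rightarrow\lambda w.F$ with $M:\mathsf{real}$, then $\mathrm{dens}(1/M)\Rightarrow\lambda z.(\mathsf{let}\ w=1/z\ \mathsf{in}\ F)\cdot(1/z^2)$; $\mathrm{dens}(\exp M)\Rightarrow\lambda z.\mathsf{if}\ z>0\ \mathsf{then}\ (\mathsf{let}\ w=\log z\ \mathsf{in}\ F)\cdot(1/z)\ \mathsf{else}\ 0$; $\mathrm{dens}(\log M)\Rightarrow\lambda z.(\mathsf{let}\ w=\exp z\ \mathsf{in}\ F)\cdot\exp z$, provided that $[\![\mathsf{let}\ w=r\ \mathsf{in}\ F]\!]\sigma=0$ for all $\sigma$ and all $r<0$; $\mathrm{dens}(c\cdot M)\Rightarrow\lambda z.(\mathsf{let}\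 w=z/c\ \mathsf{in}\ F)\cdot(1/|c|)$ for a constant $c\ne0$; $\mathrm{dens}(M+N)\Rightarrow\lambda z.\mathsf{let}\ w=z-N\sigma_\Upsilon\ \mathsf{in}\ F$ if $N$ is constant under $\Upsilon$. - $\mathrm{dens}(M+N)\Rightarrow\lambda z.\int\lambda w_1.\mathsf{let}\ w=(w_1,z-w_1)\ \mathsf{in}\ F$ for real $M,N$ if $N$ is not constant and $\mathrm{dens}((M,N))\Rightarrow\lambda w.F$. **Theorem (Soundness).** Let $M$ be a closed source program of Fun with $\varepsilon\vdash M:t$, and suppose that $\varepsilon;1\vdash\mathrm{dens}(M)\Rightarrow\lambda z.F$. Then $\mathcal P[\![M]\!]\varepsilon$ is a sub-probability measure, $[\![\lambda z.F]\!]\varepsilon:\mathbf V_t\to\mathbb R$ is measurable and non-negative, and for every Lebesgue-measurable set $A\subseteq\mathbf V_t$ (measurable for the completed stock measure on $t$) $$(\mathcal P[\![M]\!]\varepsilon)(A)=\int_A[\![\lambda z.F]\!]\varepsilon ,$$ the integral being taken with respect to the stock measure on $t$. That is, $[\![\lambda z.F]\!]\varepsilon$ is a PDF of the distribution of $M$.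 -/

import Mathlib

open MeasureTheory ProbabilityTheory

namespace DensityCompiler

/-! ## Types, values and stock measures -/

/-- Types of Fun and of the target language. -/
inductive Ty : Type
  | int | real | unit
  | prod (t u : Ty)
  | sum (t u : Ty)

/-- Booleans are `unit + unit`; `true` is the left injection. -/
@[reducible] def Ty.bool : Ty := .sum .unit .unit

/-- A type is discrete if it does not contain `real`. -/
def Ty.Discrete : Ty → Prop
  | .int => True
  | .real => False
  | .unit => True
  | .prod t u => t.Discrete ∧ u.Discrete
  | .sum t u => t.Discrete ∧ u.Discrete

/-- The set of closed values of a type. -/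
@[reducible] def Val : Ty → Type
  | .int => ℤ
  | .real => ℝ
  | .unit => Unit
  | .prod t u => Val t × Val u
  | .sum t u => Val t ⊕ Val u

/-- The Borel σ-algebra on values (everything is measurable at the discrete types). -/
@[reducible] instance Val.instMeasurableSpace : (t : Ty) → MeasurableSpace (Val t)
  | .int => (inferInstance : MeasurableSpace ℤ)
  | .real => (inferInstance : MeasurableSpace ℝ)
  | .unit => (inferInstance : MeasurableSpace Unit)
  | .prod t u => @Prod.instMeasurableSpace _ _ (instMeasurableSpace t) (instMeasurableSpace u)
  | .sum t u => @Sum.instMeasurableSpace _ _ (instMeasurableSpace t) (instMeasurableSpace u)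

/-- The default value of each type. -/
def Val.default : (t : Ty) → Val t
  | .int => (0 : ℤ)
  | .real => (0 : ℝ)
  | .unit => ()
  | .prod t u => (Val.default t, Val.default u)
  | .sum t _ => Sum.inl (Val.default t)

/-- The stock measure of each type, on Borel sets. As Mathlib measures extend to all sets as outer
measures, its Lebesgue completion is the restriction to the sets that are
`NullMeasurableSet` for it. -/
noncomputable def stock : (t : Ty) → Measure (Val t)
  | .int => (Measure.count : Measure ℤ)
  | .real => (volume : Measure ℝ)
  | .unit => (Measure.count : Measure Unit)
  | .prod t u => (stock t).prod (stock u)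
  | .sum t u => (stock t).map Sum.inl + (stock u).map Sum.inr

/-! ## Primitive operations and distributions -/

/-- The further primitive operations and primitive distributions of the language, besides the
built-in ones below. Operations are total deterministic (measurable) functions. A distribution
assigns to each argument a sub-probability measure (`0` where drawing a value fails) that has a
(jointly measurable) density with respect to the stock measure. -/
structure Signature where
  OpName : Type
  dom : OpName → Ty
  cod : OpName → Ty
  eval : (o : OpName) → Val (dom o) → Val (cod o)
  measurable_eval : ∀ o, Measurable (eval o)
  DistName : Type
  arg : DistName → Ty
  res : DistName → Ty
  law : (d : DistName) → Val (arg d) → Measure (Val (res d))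
  law_univ_le_one : ∀ d v, law d v Set.univ ≤ 1
  pdf : (d : DistName) → Val (arg d) → Val (res d) → ℝ
  measurable_pdf : ∀ d, Measurable fun p : Val (arg d) × Val (res d) => pdf d p.1 p.2
  pdf_nonneg : ∀ d v x, 0 ≤ pdf d v x
  law_eq : ∀ d v, law d v = (stock (res d)).withDensity fun x => ENNReal.ofReal (pdf d v x)

/-- Primitive distributions: `Dist S a t` are those with arguments of type `a` and
results of type `t`. -/
inductive Dist (S : Signature) : Ty → Ty → Type
  | bernoulli : Dist S .real .bool
  | poisson : Dist S .real .int
  | gaussian : Dist S (.prod .real .real) .real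
  | beta : Dist S (.prod .real .real) .real
  | gamma : Dist S (.prod .real .real) .real
  | ext (d : S.DistName) : Dist S (S.arg d) (S.res d)

open Classical in
/-- The measure `μ_{D(v)}`. Parameters: Bernoulli (bias), Poisson (rate), Gaussian (mean, standard
deviation), Beta (a, b), Gamma (shape, scale). Outside the parameter range drawing fails. -/
noncomputable def Dist.law {S : Signature} : {a t : Ty} → Dist S a t → Val a → Measure (Val t)
  | _, _, .bernoulli => fun p : ℝ =>
      if 0 ≤ p ∧ p ≤ 1 then
        ENNReal.ofReal p • (Measure.dirac (Sum.inl ()) : Measure (Unit ⊕ Unit)) +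
          ENNReal.ofReal (1 - p) • (Measure.dirac (Sum.inr ()) : Measure (Unit ⊕ Unit))
      else 0
  | _, _, .poisson => fun r : ℝ =>
      if 0 ≤ r then (poissonMeasure r.toNNReal).map (fun n : ℕ => (n : ℤ)) else 0
  | _, _, .gaussian => fun v : ℝ × ℝ =>
      if 0 < v.2 then gaussianReal v.1 (v.2 ^ 2).toNNReal else 0
  | _, _, .beta => fun v : ℝ × ℝ => if 0 < v.1 ∧ 0 < v.2 then betaMeasure v.1 v.2 else 0
  | _, _, .gamma => fun v : ℝ × ℝ => if 0 < v.1 ∧ 0 < v.2 then gammaMeasure v.1 (1 / v.2) else 0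
  | _, _, .ext d => S.law d

open Classical in
/-- The density `pdf_{D(v)}`, which is `0` outside the parameter range. -/
noncomputable def Dist.pdf {S : Signature} : {a t : Ty} → Dist S a t → Val a → Val t → ℝ
  | _, _, .bernoulli => fun (p : ℝ) (b : Unit ⊕ Unit) =>
      if 0 ≤ p ∧ p ≤ 1 then Sum.elim (fun _ => p) (fun _ => 1 - p) b else 0
  | _, _, .poisson => fun (r : ℝ) (n : ℤ) =>
      if 0 ≤ r ∧ 0 ≤ n then Real.exp (-r) * r ^ n.toNat / (n.toNat.factorial : ℝ) else 0
  | _, _, .gaussian => fun (v : ℝ × ℝ) (x : ℝ) =>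
      if 0 < v.2 then gaussianPDFReal v.1 (v.2 ^ 2).toNNReal x else 0
  | _, _, .beta => fun (v : ℝ × ℝ) (x : ℝ) =>
      if 0 < v.1 ∧ 0 < v.2 then betaPDFReal v.1 v.2 x else 0
  | _, _, .gamma => fun (v : ℝ × ℝ) (x : ℝ) =>
      if 0 < v.1 ∧ 0 < v.2 then gammaPDFReal v.1 (1 / v.2) x else 0
  | _, _, .ext d => S.pdf d

/-- Primitive operations: `Op S t u` are those from `t` to `u`. An operation of several arguments
takes a tuple. -/
inductive Op (S : Signature) : Ty → Ty → Type
  | realAdd : Op S (.prod .real .real) .real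
  | realSub : Op S (.prod .real .real) .real
  | realMul : Op S (.prod .real .real) .real
  /-- Division, with `r / 0 = 0`. -/
  | realDiv : Op S (.prod .real .real) .real
  | exp : Op S .real .real
  /-- Logarithm, with value `0` at the non-positive reals. -/
  | log : Op S .real .real
  | abs : Op S .real .real
  | realLt : Op S (.prod .real .real) .bool
  | intAdd : Op S (.prod .int .int) .int
  | intSub : Op S (.prod .int .int) .int
  | intMul : Op S (.prod .int .int) .int
  | intLt : Op S (.prod .int .int) .bool
  | not : Op S .bool .bool
  | and : Op S (.prod .bool .bool) .bool
  | or : Op S (.prod .bool .bool) .bool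
  | eq (t : Ty) (h : t.Discrete) : Op S (.prod t t) .bool
  | ext (o : S.OpName) : Op S (S.dom o) (S.cod o)
  /-- The four operations `isL`, `isR`, `fromL`, `fromR` must not occur in source programs. -/
  | isL (t u : Ty) : Op S (.sum t u) .real
  | isR (t u : Ty) : Op S (.sum t u) .real
  | fromL (t u : Ty) : Op S (.sum t u) t
  | fromR (t u : Ty) : Op S (.sum t u) u
  /-- The Iverson bracket `[v = w]`. -/
  | iverson (t : Ty) (h : t.Discrete) : Op S (.prod t t) .real
  /-- The density of a primitive distribution, as a function of its arguments and the point. -/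
  | pdf {a t : Ty} (d : Dist S a t) : Op S (.prod a t) .real

open Classical in
/-- A truth value as a value of type `bool`. -/
noncomputable def Val.ofProp (p : Prop) : Val .bool := if p then Sum.inl () else Sum.inr ()

/-- The truth of a value of type `bool`. -/
def Val.IsTrue (b : Val .bool) : Prop := b = Sum.inl ()

open Classical in
/-- The function denoted by an operation. -/
noncomputable def Op.eval {S : Signature} : {t u : Ty} → Op S t u → Val t → Val u
  | _, _, .realAdd => fun v : ℝ × ℝ => v.1 + v.2
  | _, _, .realSub => fun v : ℝ × ℝ => v.1 - v.2
  | _, _, .realMul => fun v : ℝ × ℝ => v.1 * v.2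
  | _, _, .realDiv => fun v : ℝ × ℝ => v.1 / v.2
  | _, _, .exp => fun x : ℝ => Real.exp x
  | _, _, .log => fun x : ℝ => if 0 < x then Real.log x else 0
  | _, _, .abs => fun x : ℝ => |x|
  | _, _, .realLt => fun v : ℝ × ℝ => Val.ofProp (v.1 < v.2)
  | _, _, .intAdd => fun v : ℤ × ℤ => v.1 + v.2
  | _, _, .intSub => fun v : ℤ × ℤ => v.1 - v.2
  | _, _, .intMul => fun v : ℤ × ℤ => v.1 * v.2
  | _, _, .intLt => fun v : ℤ × ℤ => Val.ofProp (v.1 < v.2)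
  | _, _, .not => fun b => Val.ofProp (¬ Val.IsTrue b)
  | _, _, .and => fun v => Val.ofProp (Val.IsTrue v.1 ∧ Val.IsTrue v.2)
  | _, _, .or => fun v => Val.ofProp (Val.IsTrue v.1 ∨ Val.IsTrue v.2)
  | _, _, .eq _ _ => fun v => Val.ofProp (v.1 = v.2)
  | _, _, .ext o => S.eval o
  | _, _, .isL _ _ => fun v => Sum.elim (fun _ => (1 : ℝ)) (fun _ => (0 : ℝ)) v
  | _, _, .isR _ _ => fun v => Sum.elim (fun _ => (0 : ℝ)) (fun _ => (1 : ℝ)) v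
  | _, _, .fromL t _ => fun v => Sum.elim (fun x => x) (fun _ => Val.default t) v
  | _, _, .fromR _ u => fun v => Sum.elim (fun _ => Val.default u) (fun y => y) v
  | _, _, .iverson _ _ => fun v => if v.1 = v.2 then (1 : ℝ) else (0 : ℝ)
  | _, _, .pdf d => fun v => d.pdf v.1 v.2

/-- The operations that are introduced only by the compiler and do not occur in source programs. -/
def Op.Internal {S : Signature} {t u : Ty} : Op S t u → Prop
  | .isL _ _ => True
  | .isR _ _ => True
  | .fromL _ _ => True
  | .fromR _ _ => True
  | _ => False

/-- The operation is `fromL` or `fromR`. -/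
def Op.IsFrom {S : Signature} {t u : Ty} : Op S t u → Prop
  | .fromL _ _ => True
  | .fromR _ _ => True
  | _ => False

/-! ## Expressions

Expressions are intrinsically typed, with variables as de Bruijn indices (so that expressions are
identified up to renaming of bound variables). The head of a context is the variable bound last. -/

/-- Type environments. -/
abbrev Ctx := List Ty

/-- Variables of type `t` in a type environment. -/
inductive Var : Ctx → Ty → Type
  | zero {Γ : Ctx} {t : Ty} : Var (t :: Γ) t
  | succ {Γ : Ctx} {t u : Ty} (x : Var Γ t) : Var (u :: Γ) t

/-- Fun expressions (`src`), target expressions (`tgt`), and the expressions common to both,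
namely the pure Fun expressions (`pure`). -/
inductive Kind : Type
  | pure | src | tgt

/-- `Tm S k Γ t`: expressions `M` of kind `k` with `Γ ⊢ M : t`. -/
inductive Tm (S : Signature) (k : Kind) : Ctx → Ty → Type
  | var {Γ : Ctx} {t : Ty} (x : Var Γ t) : Tm S k Γ t
  | unit {Γ : Ctx} : Tm S k Γ .unit
  | int {Γ : Ctx} (n : ℤ) : Tm S k Γ .int
  | real {Γ : Ctx} (r : ℝ) : Tm S k Γ .real
  | pair {Γ : Ctx} {t u : Ty} (M : Tm S k Γ t) (N : Tm S k Γ u) : Tm S k Γ (.prod t u)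
  | fst {Γ : Ctx} {t u : Ty} (M : Tm S k Γ (.prod t u)) : Tm S k Γ t
  | snd {Γ : Ctx} {t u : Ty} (M : Tm S k Γ (.prod t u)) : Tm S k Γ u
  | inl {Γ : Ctx} {t u : Ty} (M : Tm S k Γ t) : Tm S k Γ (.sum t u)
  | inr {Γ : Ctx} {t u : Ty} (M : Tm S k Γ u) : Tm S k Γ (.sum t u)
  | cases {Γ : Ctx} {t u v : Ty} (M : Tm S k Γ (.sum t u))
      (N₁ : Tm S k (t :: Γ) v) (N₂ : Tm S k (u :: Γ) v) : Tm S k Γ v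
  | letE {Γ : Ctx} {t u : Ty} (M : Tm S k Γ t) (N : Tm S k (t :: Γ) u) : Tm S k Γ u
  | op {Γ : Ctx} {t u : Ty} (f : Op S t u) (M : Tm S k Γ t) : Tm S k Γ u
  /-- `random(D(M))`, in Fun only. -/
  | random {Γ : Ctx} {a t : Ty} (hk : k = .src) (d : Dist S a t) (M : Tm S k Γ a) : Tm S k Γ t
  /-- `fail`, in Fun only. -/
  | fail {Γ : Ctx} {t : Ty} (hk : k = .src) : Tm S k Γ t
  /-- Stock integration over the variables of `Δ`, in the target language only. -/
  | integral {Γ : Ctx} (hk : k = .tgt) (Δ : Ctx) (E : Tm S k (Δ ++ Γ) .real) : Tm S k Γ .real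

variable {S : Signature} {k : Kind}

/-! ### Renaming and substitution -/

/-- Variables of `Δ` as variables of `Δ ++ Γ`. -/
def Var.inL {Γ : Ctx} : {Δ : Ctx} → {t : Ty} → Var Δ t → Var (Δ ++ Γ) t
  | _ :: _, _, .zero => .zero
  | _ :: _, _, .succ x => .succ x.inL

/-- Variables of `Γ` as variables of `Δ ++ Γ`. -/
def Var.inR {Γ : Ctx} : (Δ : Ctx) → {t : Ty} → Var Γ t → Var (Δ ++ Γ) t
  | [], _, x => x
  | _ :: Δ, _, x => .succ (Var.inR Δ x)

/-- Renamings. -/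
abbrev Ren (Γ Γ' : Ctx) := (t : Ty) → Var Γ t → Var Γ' t

/-- Weakening by one variable. -/
def Ren.succ {Γ : Ctx} {u : Ty} : Ren Γ (u :: Γ) := fun _ x => .succ x

def Ren.lift {Γ Γ' : Ctx} (ρ : Ren Γ Γ') {u : Ty} : Ren (u :: Γ) (u :: Γ')
  | _, .zero => .zero
  | _, .succ x => .succ (ρ _ x)

def Ren.liftAll {Γ Γ' : Ctx} (ρ : Ren Γ Γ') : (Δ : Ctx) → Ren (Δ ++ Γ) (Δ ++ Γ')
  | [] => ρ
  | _ :: Δ => Ren.lift (Ren.liftAll ρ Δ)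

/-- Renaming of the variables of `X ++ Γ`, given separately on `X` and `Γ`. -/
def Ren.join {Γ Θ : Ctx} : {X : Ctx} → Ren X Θ → Ren Γ Θ → Ren (X ++ Γ) Θ
  | [], _, g => g
  | t :: X, f, g => fun u (x : Var (t :: (X ++ Γ)) u) =>
      match x with
      | .zero => f _ .zero
      | .succ x => Ren.join (X := X) (fun _ y => f _ (.succ y)) g _ x

def Tm.rename {Γ Γ' : Ctx} {t : Ty} (M : Tm S k Γ t) (ρ : Ren Γ Γ') : Tm S k Γ' t :=
  match M with
  | .var x => .var (ρ _ x)
  | .unit => .unit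
  | .int n => .int n
  | .real r => .real r
  | .pair M N => .pair (M.rename ρ) (N.rename ρ)
  | .fst M => .fst (M.rename ρ)
  | .snd M => .snd (M.rename ρ)
  | .inl M => .inl (M.rename ρ)
  | .inr M => .inr (M.rename ρ)
  | .cases M N₁ N₂ => .cases (M.rename ρ) (N₁.rename (Ren.lift ρ)) (N₂.rename (Ren.lift ρ))
  | .letE M N => .letE (M.rename ρ) (N.rename (Ren.lift ρ))
  | .op f M => .op f (M.rename ρ)
  | .random hk d M => .random hk d (M.rename ρ)
  | .fail hk => .fail hk
  | .integral hk Δ E => .integral hk Δ (E.rename (Ren.liftAll ρ Δ))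

/-- Weakening by one variable. -/
def Tm.wk {Γ : Ctx} {t u : Ty} (M : Tm S k Γ t) : Tm S k (u :: Γ) t := M.rename Ren.succ

/-- Weakening by one variable below the variable bound last. -/
def Tm.wk₁ {Γ : Ctx} {s t u : Ty} (M : Tm S k (s :: Γ) t) : Tm S k (s :: u :: Γ) t :=
  M.rename (Ren.lift Ren.succ)

/-- Simultaneous substitutions. -/
abbrev Sub (S : Signature) (k : Kind) (Γ Γ' : Ctx) := (t : Ty) → Var Γ t → Tm S k Γ' t

def Sub.lift {Γ Γ' : Ctx} (σ : Sub S k Γ Γ') {u : Ty} : Sub S k (u :: Γ) (u :: Γ')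
  | _, .zero => .var .zero
  | _, .succ x => (σ _ x).wk

def Sub.liftAll {Γ Γ' : Ctx} (σ : Sub S k Γ Γ') : (Δ : Ctx) → Sub S k (Δ ++ Γ) (Δ ++ Γ')
  | [] => σ
  | _ :: Δ => Sub.lift (Sub.liftAll σ Δ)

def Tm.subst {Γ Γ' : Ctx} {t : Ty} (M : Tm S k Γ t) (σ : Sub S k Γ Γ') : Tm S k Γ' t :=
  match M with
  | .var x => σ _ x
  | .unit => .unit
  | .int n => .int n
  | .real r => .real r
  | .pair M N => .pair (M.subst σ) (N.subst σ)
  | .fst M => .fst (M.subst σ)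
  | .snd M => .snd (M.subst σ)
  | .inl M => .inl (M.subst σ)
  | .inr M => .inr (M.subst σ)
  | .cases M N₁ N₂ => .cases (M.subst σ) (N₁.subst (Sub.lift σ)) (N₂.subst (Sub.lift σ))
  | .letE M N => .letE (M.subst σ) (N.subst (Sub.lift σ))
  | .op f M => .op f (M.subst σ)
  | .random hk d M => .random hk d (M.subst σ)
  | .fail hk => .fail hk
  | .integral hk Δ E => .integral hk Δ (E.subst (Sub.liftAll σ Δ))

/-- The variable `v` occurs free in the expression. -/
def Tm.Occurs {Γ : Ctx} {t : Ty} (M : Tm S k Γ t) {s : Ty} (v : Var Γ s) : Prop :=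
  match M with
  | .var (t := t) x => (⟨t, x⟩ : Σ u, Var _ u) = ⟨s, v⟩
  | .unit => False
  | .int _ => False
  | .real _ => False
  | .pair M N => M.Occurs v ∨ N.Occurs v
  | .fst M => M.Occurs v
  | .snd M => M.Occurs v
  | .inl M => M.Occurs v
  | .inr M => M.Occurs v
  | .cases M N₁ N₂ => M.Occurs v ∨ N₁.Occurs v.succ ∨ N₂.Occurs v.succ
  | .letE M N => M.Occurs v ∨ N.Occurs v.succ
  | .op _ M => M.Occurs v
  | .random _ _ M => M.Occurs v
  | .fail _ => False
  | .integral _ Δ E => E.Occurs (Var.inR Δ v)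

/-- A pure Fun expression, read as a Fun expression or as a target expression. -/
def Tm.embed {Γ : Ctx} {t : Ty} (M : Tm S .pure Γ t) : Tm S k Γ t :=
  match M with
  | .var x => .var x
  | .unit => .unit
  | .int n => .int n
  | .real r => .real r
  | .pair M N => .pair M.embed N.embed
  | .fst M => .fst M.embed
  | .snd M => .snd M.embed
  | .inl M => .inl M.embed
  | .inr M => .inr M.embed
  | .cases M N₁ N₂ => .cases M.embed N₁.embed N₂.embed
  | .letE M N => .letE M.embed N.embed
  | .op f M => .op f M.embed

/-- The expression contains neither `random` nor `fail`. For a Fun expression `M` this holds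
exactly if `M = P.embed` for some `P : Tm S .pure Γ t`. -/
def Tm.IsPure {Γ : Ctx} {t : Ty} (M : Tm S .src Γ t) : Prop :=
  match M with
  | .var _ => True
  | .unit => True
  | .int _ => True
  | .real _ => True
  | .pair M N => M.IsPure ∧ N.IsPure
  | .fst M => M.IsPure
  | .snd M => M.IsPure
  | .inl M => M.IsPure
  | .inr M => M.IsPure
  | .cases M N₁ N₂ => M.IsPure ∧ N₁.IsPure ∧ N₂.IsPure
  | .letE M N => M.IsPure ∧ N.IsPure
  | .op _ M => M.IsPure
  | .random _ _ _ => False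
  | .fail _ => False

/-- Source programs: Fun expressions without the operations reserved to the compiler. -/
def Tm.IsSource {Γ : Ctx} {t : Ty} (M : Tm S .src Γ t) : Prop :=
  match M with
  | .var _ => True
  | .unit => True
  | .int _ => True
  | .real _ => True
  | .pair M N => M.IsSource ∧ N.IsSource
  | .fst M => M.IsSource
  | .snd M => M.IsSource
  | .inl M => M.IsSource
  | .inr M => M.IsSource
  | .cases M N₁ N₂ => M.IsSource ∧ N₁.IsSource ∧ N₂.IsSource
  | .letE M N => M.IsSource ∧ N.IsSource
  | .op f M => ¬ f.Internal ∧ M.IsSource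
  | .random _ _ M => M.IsSource
  | .fail _ => True

/-! ## Semantics -/

/-- Valuations: closed value substitutions for a type environment. -/
@[reducible] def Env : Ctx → Type
  | [] => Unit
  | t :: Γ => Val t × Env Γ

@[reducible] instance Env.instMeasurableSpace : (Γ : Ctx) → MeasurableSpace (Env Γ)
  | [] => (inferInstance : MeasurableSpace Unit)
  | t :: Γ => @Prod.instMeasurableSpace _ _ (Val.instMeasurableSpace t) (instMeasurableSpace Γ)

def Env.get : {Γ : Ctx} → {t : Ty} → Env Γ → Var Γ t → Val t
  | _ :: _, _, σ, .zero => σ.1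
  | _ :: Γ, _, σ, .succ x => Env.get (Γ := Γ) σ.2 x

def Env.append {Γ : Ctx} : {Δ : Ctx} → Env Δ → Env Γ → Env (Δ ++ Γ)
  | [], _, σ => σ
  | _ :: Δ, η, σ => (η.1, Env.append (Δ := Δ) η.2 σ)

/-- The stock measure on the values of a tuple of variables. -/
noncomputable def stockEnv : (Δ : Ctx) → Measure (Env Δ)
  | [] => (Measure.dirac () : Measure Unit)
  | t :: Δ => (stock t).prod (stockEnv Δ)

/-- Monadic semantics of Fun in the sub-probability monad: `Measure.bind`, `Measure.dirac` and `0`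
are the monad's bind, return and zero. -/
noncomputable def Tm.meas {Γ : Ctx} {t : Ty} (M : Tm S .src Γ t) (σ : Env Γ) : Measure (Val t) :=
  match M with
  | .var x => Measure.dirac (σ.get x)
  | .unit => Measure.dirac ()
  | .int n => Measure.dirac n
  | .real r => Measure.dirac r
  | .pair M N => (M.meas σ).bind fun z => (N.meas σ).bind fun w => Measure.dirac (z, w)
  | .fst M => (M.meas σ).bind fun z => Measure.dirac z.1
  | .snd M => (M.meas σ).bind fun z => Measure.dirac z.2
  | .inl M => (M.meas σ).bind fun z => Measure.dirac (Sum.inl z)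
  | .inr M => (M.meas σ).bind fun z => Measure.dirac (Sum.inr z)
  | .cases M N₁ N₂ =>
      (M.meas σ).bind fun z => Sum.elim (fun x => N₁.meas (x, σ)) (fun y => N₂.meas (y, σ)) z
  | .letE M N => (M.meas σ).bind fun z => N.meas (z, σ)
  | .op f M => (M.meas σ).bind fun z => Measure.dirac (f.eval z)
  | .random _ d M => (M.meas σ).bind fun z => d.law z
  | .fail _ => 0

/-- Denotational semantics of the target language. Expressions of type `real` denote real numbers;
a stock integral that is not well-defined (as a real number) denotes `0`. -/
noncomputable def Tm.val {Γ : Ctx} {t : Ty} (E : Tm S .tgt Γ t) (σ : Env Γ) : Val t :=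
  match E with
  | .var x => σ.get x
  | .unit => ()
  | .int n => n
  | .real r => r
  | .pair E F => (E.val σ, F.val σ)
  | .fst E => (E.val σ).1
  | .snd E => (E.val σ).2
  | .inl E => Sum.inl (E.val σ)
  | .inr E => Sum.inr (E.val σ)
  | .cases E F₁ F₂ => Sum.elim (fun x => F₁.val (x, σ)) (fun y => F₂.val (y, σ)) (E.val σ)
  | .letE E F => F.val (E.val σ, σ)
  | .op f E => f.eval (E.val σ)
  | .integral _ Δ E =>
      let g : Env Δ → ℝ := fun η => E.val (η.append σ)
      ∫ η, g η ∂(stockEnv Δ)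

/-! ## Probability contexts -/

/-- `PCtx S Γ Δ`: well-formed probability contexts with parameters `Γ` whose variables have the
types `Δ`. A deterministic variable is defined by a pure expression over the parameters and the
preceding variables. -/
inductive PCtx (S : Signature) (Γ : Ctx) : Ctx → Type
  | empty : PCtx S Γ []
  | rnd {Δ : Ctx} (Υ : PCtx S Γ Δ) (t : Ty) : PCtx S Γ (t :: Δ)
  | det {Δ : Ctx} (Υ : PCtx S Γ Δ) {t : Ty} (P : Tm S .pure (Δ ++ Γ) t) : PCtx S Γ (t :: Δ)

/-- The (types of the) random variables of a probability context. -/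
@[reducible] def PCtx.rands {Γ : Ctx} : {Δ : Ctx} → PCtx S Γ Δ → Ctx
  | _, .empty => []
  | _, .rnd Υ t => t :: Υ.rands
  | _, .det Υ _ => Υ.rands

/-- The inclusion of the random variables and parameters into all variables. -/
def PCtx.incl {Γ : Ctx} : {Δ : Ctx} → (Υ : PCtx S Γ Δ) → Ren (Υ.rands ++ Γ) (Δ ++ Γ)
  | _, .empty => fun _ x => x
  | _, .rnd Υ _ => Ren.lift Υ.incl
  | _, .det Υ _ => fun _ x => .succ (Υ.incl _ x)

/-- The idempotent substitution `σ_Υ`, which replaces the deterministic variables by their values,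
expressed by random variables and parameters, and leaves the other variables in place. -/
def PCtx.consts {Γ : Ctx} : {Δ : Ctx} → (Υ : PCtx S Γ Δ) → Sub S .tgt (Δ ++ Γ) (Υ.rands ++ Γ)
  | _, .empty => fun _ x => .var x
  | _, .rnd Υ _ => Sub.lift Υ.consts
  | t :: Δ, .det Υ P => fun u (x : Var (t :: (Δ ++ Γ)) u) =>
      match x with
      | .zero => P.embed.subst Υ.consts
      | .succ x => Υ.consts _ x

/-- `Υ.Defines x P`: the definition `x = P` is in `Υ`. -/
inductive PCtx.Defines {Γ : Ctx} : {Δ : Ctx} → PCtx S Γ Δ → {t : Ty} → Var (Δ ++ Γ) t →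
    Tm S .pure (Δ ++ Γ) t → Prop
  | here {Δ : Ctx} {Υ : PCtx S Γ Δ} {t : Ty} {P : Tm S .pure (Δ ++ Γ) t} :
      PCtx.Defines (Δ := t :: Δ) (Υ.det P) (Var.zero (Γ := Δ ++ Γ)) P.wk
  | rnd {Δ : Ctx} {Υ : PCtx S Γ Δ} {t u : Ty} {x : Var (Δ ++ Γ) t} {P : Tm S .pure (Δ ++ Γ) t} :
      Υ.Defines x P →
      PCtx.Defines (Δ := u :: Δ) (Υ.rnd u) (Var.succ (Γ := Δ ++ Γ) x) P.wk
  | det {Δ : Ctx} {Υ : PCtx S Γ Δ} {t u : Ty} {x : Var (Δ ++ Γ) t} {P : Tm S .pure (Δ ++ Γ) t}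
      {Q : Tm S .pure (Δ ++ Γ) u} :
      Υ.Defines x P →
      PCtx.Defines (Δ := u :: Δ) (Υ.det Q) (Var.succ (Γ := Δ ++ Γ) x) P.wk

/-- `Split R X Y`: the variables of `R` are split into a subset, of types `X`, and its complement,
of types `Y`, both in the order of `R`. -/
inductive Split : Ctx → Ctx → Ctx → Type
  | nil : Split [] [] []
  | left {R X Y : Ctx} (t : Ty) (s : Split R X Y) : Split (t :: R) (t :: X) Y
  | right {R X Y : Ctx} (t : Ty) (s : Split R X Y) : Split (t :: R) X (t :: Y)

/-- The splitting with the empty subset. -/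
def Split.none : (R : Ctx) → Split R [] R
  | [] => .nil
  | t :: R => .right t (Split.none R)

/-- The inclusion of the subset (and the parameters `Γ`). -/
def Split.incl (Γ : Ctx) : {R X Y : Ctx} → Split R X Y → Ren (X ++ Γ) (R ++ Γ)
  | _, _, _, .nil => fun _ x => x
  | _, _, _, .left _ s => Ren.lift (Split.incl Γ s)
  | _, _, _, .right _ s => fun _ x => .succ (Split.incl Γ s _ x)

/-- Reordering of variables that puts the complement in front. -/
def Split.reorder (Γ : Ctx) : {R X Y : Ctx} → Split R X Y → Ren (R ++ Γ) (Y ++ (X ++ Γ))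
  | _, _, _, .nil => fun _ x => x
  | t :: R, _ :: X, Y, .left _ s => fun u (x : Var (t :: (R ++ Γ)) u) =>
      match x with
      | .zero => Var.inR Y (Var.zero (Γ := X ++ Γ))
      | .succ x => Ren.liftAll (Γ := X ++ Γ) Ren.succ Y _ (Split.reorder Γ s _ x)
  | _, _, _, .right _ s => Ren.lift (Split.reorder Γ s)

/-- The marginal density: `Υ; E ⊢ marg(X) ⇒ Υ.marg s E`, where `s` splits the random variables of
`Υ` into `X` and the variables that are integrated out. -/
def PCtx.marg {Γ Δ X Y : Ctx} (Υ : PCtx S Γ Δ) (s : Split Υ.rands X Y)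
    (E : Tm S .tgt (Δ ++ Γ) .real) : Tm S .tgt (X ++ Γ) .real :=
  .integral rfl Y ((E.subst Υ.consts).rename (Split.reorder Γ s))

/-- `M` is constant under `Υ`: it is pure and no random variable of `Υ` is free in `M σ_Υ`. -/
def PCtx.IsConst {Γ Δ : Ctx} (Υ : PCtx S Γ Δ) {t : Ty} (M : Tm S .src (Δ ++ Γ) t) : Prop :=
  ∃ P : Tm S .pure (Δ ++ Γ) t, M = P.embed ∧
    ∀ (u : Ty) (y : Var Υ.rands u), ¬ (P.embed.subst Υ.consts).Occurs (y.inL (Γ := Γ))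

/-! ## Auxiliary syntax -/

/-- A value, as a closed expression. -/
def quote {Γ : Ctx} : (t : Ty) → Val t → Tm S k Γ t
  | .int, n => .int n
  | .real, r => .real r
  | .unit, _ => .unit
  | .prod t u, v => .pair (quote t v.1) (quote u v.2)
  | .sum t u, v => Sum.elim (fun x => .inl (quote t x)) (fun y => .inr (quote u y)) v

/-- The tuple type `t * (t₁ * ⋯ )`. -/
def tupTy : Ty → List Ty → Ty
  | t, [] => t
  | t, u :: us => .prod t (tupTy u us)

/-- The tuple of the variables `ξ x`, for `x` in the nonempty list `t :: ts`. -/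
def tuple {Γ : Ctx} : (t : Ty) → (ts : List Ty) → Ren (t :: ts) Γ → Tm S k Γ (tupTy t ts)
  | _, [], ξ => .var (ξ _ .zero)
  | _, u :: us, ξ => .pair (.var (ξ _ .zero)) (tuple u us fun _ x => ξ _ (.succ x))

/-- `Γ` extended by variables of types `ts`, one after the other. -/
def bindAll : List Ty → Ctx → Ctx
  | [], Γ => Γ
  | t :: ts, Γ => bindAll ts (t :: Γ)

def Ren.liftBind {Γ Γ' : Ctx} (ρ : Ren Γ Γ') : (ts : List Ty) → Ren (bindAll ts Γ) (bindAll ts Γ')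
  | [] => ρ
  | _ :: ts => Ren.liftBind (Ren.lift ρ) ts

def Var.bindOld {Γ : Ctx} : (ts : List Ty) → {u : Ty} → Var Γ u → Var (bindAll ts Γ) u
  | [], _, x => x
  | _ :: ts, _, x => Var.bindOld ts (.succ x)

def Var.bindNew {Γ : Ctx} : {ts : List Ty} → {u : Ty} → Var ts u → Var (bindAll ts Γ) u
  | _ :: ts, _, .zero => Var.bindOld ts .zero
  | _ :: _, _, .succ x => x.bindNew

/-- `let x₁, …, xₙ = V in N`, which abbreviates
`let x₁ = fst V in let z = snd V in let x₂, …, xₙ = z in N`. -/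
def letTuple {u : Ty} : (t : Ty) → (ts : List Ty) → {Γ : Ctx} → Tm S k Γ (tupTy t ts) →
    Tm S k (bindAll (t :: ts) Γ) u → Tm S k Γ u
  | _, [], _, V, N => .letE V N
  | t, v :: vs, Γ, V, N =>
      .letE (.fst V) (.letE (.snd (Tm.wk V))
        (letTuple v vs (.var .zero)
          (Tm.rename N (Ren.liftBind (Γ := t :: Γ) Ren.succ (v :: vs)))))

namespace Tm

variable {Γ : Ctx}

def add (E F : Tm S k Γ .real) : Tm S k Γ .real := .op .realAdd (.pair E F)
def sub (E F : Tm S k Γ .real) : Tm S k Γ .real := .op .realSub (.pair E F)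
def mul (E F : Tm S k Γ .real) : Tm S k Γ .real := .op .realMul (.pair E F)
def div (E F : Tm S k Γ .real) : Tm S k Γ .real := .op .realDiv (.pair E F)

/-- `[E = F]` -/
def iverson {t : Ty} (h : t.Discrete) (E F : Tm S k Γ t) : Tm S k Γ .real :=
  .op (.iverson t h) (.pair E F)

/-- `pdf_{D(E)}(F)` -/
def pdf {a t : Ty} (d : Dist S a t) (E : Tm S k Γ a) (F : Tm S k Γ t) : Tm S k Γ .real :=
  .op (.pdf d) (.pair E F)

/-- `if E < F then G else H` -/
def ifLt {t : Ty} (E F : Tm S k Γ .real) (G H : Tm S k Γ t) : Tm S k Γ t :=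
  .cases (.op .realLt (.pair E F)) G.wk H.wk

/-- The variable bound last. -/
def v₀ {t : Ty} : Tm S k (t :: Γ) t := .var .zero

/-- The variable bound last but one. -/
def v₁ {t u : Ty} : Tm S k (u :: t :: Γ) t := .var (.succ .zero)

end Tm

/-! ## The density compiler -/

open Tm in
/-- `Dens Υ E M F` is the judgment `Υ; E ⊢ dens(M) ⇒ λz.F`, where `z` is the variable of `F` bound
last. The expressions `E` and `M` range over the parameters `Γ` and the variables `Δ` of `Υ`, the
expression `F` over the parameters and `z`. -/
inductive Dens : {Γ Δ : Ctx} → PCtx S Γ Δ → Tm S .tgt (Δ ++ Γ) .real →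
    {t : Ty} → Tm S .src (Δ ++ Γ) t → Tm S .tgt (t :: Γ) .real → Prop
  | varDet {Γ Δ : Ctx} {Υ : PCtx S Γ Δ} {E : Tm S .tgt (Δ ++ Γ) .real} {t : Ty}
      {x : Var (Δ ++ Γ) t} {P : Tm S .pure (Δ ++ Γ) t} {F : Tm S .tgt (t :: Γ) .real} :
      Υ.Defines x P → Dens Υ E P.embed F → Dens Υ E (.var x) F
  | varRnd {Γ Δ Y : Ctx} {Υ : PCtx S Γ Δ} {E : Tm S .tgt (Δ ++ Γ) .real} {t : Ty}
      (s : Split Υ.rands [t] Y) :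
      Dens Υ E (.var (Υ.incl t (s.incl Γ t (.zero (Γ := Γ))))) (Υ.marg s E)
  | constant {Γ Δ : Ctx} {Υ : PCtx S Γ Δ} {E : Tm S .tgt (Δ ++ Γ) .real} {t : Ty}
      (V : Val t) (ht : t.Discrete) :
      Dens Υ E (quote t V)
        (mul (wk (Γ := Γ) (Υ.marg (Split.none Υ.rands) E)) (iverson ht v₀ (quote t V)))
  | fail {Γ Δ : Ctx} {Υ : PCtx S Γ Δ} {E : Tm S .tgt (Δ ++ Γ) .real} {t : Ty} :
      Dens Υ E (.fail (t := t) rfl) (.real 0)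
  /-- `M'` is `M σ_Υ`, as an expression over the parameters. -/
  | randomConst {Γ Δ : Ctx} {Υ : PCtx S Γ Δ} {E : Tm S .tgt (Δ ++ Γ) .real} {a t : Ty}
      {d : Dist S a t} {M : Tm S .pure (Δ ++ Γ) a} {M' : Tm S .tgt Γ a} :
      Υ.IsConst M.embed → M'.rename (fun _ => Var.inR Υ.rands) = M.embed.subst Υ.consts →
      Dens Υ E (.random rfl d M.embed)
        (mul (wk (Γ := Γ) (Υ.marg (Split.none Υ.rands) E)) (pdf d M'.wk v₀))
  | randomRnd {Γ Δ : Ctx} {Υ : PCtx S Γ Δ} {E : Tm S .tgt (Δ ++ Γ) .real} {a t : Ty}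
      {d : Dist S a t} {M : Tm S .src (Δ ++ Γ) a} {F : Tm S .tgt (a :: Γ) .real} :
      ¬ Υ.IsConst M → Dens Υ E M F →
      Dens Υ E (.random rfl d M) (.integral rfl [a] (mul F.wk₁ (pdf d v₀ v₁)))
  /-- A tuple of at least two distinct random variables, those in `X`, listed in the order given
  by `e`. -/
  | tupleVar {Γ Δ X Y : Ctx} {Υ : PCtx S Γ Δ} {E : Tm S .tgt (Δ ++ Γ) .real} {t u : Ty}
      {us : List Ty} (s : Split Υ.rands X Y) (e : (v : Ty) → Var X v ≃ Var (t :: u :: us) v) :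
      Dens Υ E
        (tuple t (u :: us) fun v x => Υ.incl v (s.incl Γ v (((e v).symm x).inL (Γ := Γ))))
        (letTuple t (u :: us) v₀
          ((Υ.marg s E).rename
            (Ren.join (fun v x => (e v x).bindNew)
              (fun _ x => Var.bindOld (t :: u :: us) (.succ x)))))
  | fst {Γ Δ : Ctx} {Υ : PCtx S Γ Δ} {E : Tm S .tgt (Δ ++ Γ) .real} {t u : Ty}
      {M : Tm S .src (Δ ++ Γ) (.prod t u)} {F : Tm S .tgt (.prod t u :: Γ) .real} :
      Dens Υ E M F →
      Dens Υ E (.fst M) (.integral rfl [u] (.letE (.pair v₁ v₀) F.wk₁.wk₁))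
  | snd {Γ Δ : Ctx} {Υ : PCtx S Γ Δ} {E : Tm S .tgt (Δ ++ Γ) .real} {t u : Ty}
      {M : Tm S .src (Δ ++ Γ) (.prod t u)} {F : Tm S .tgt (.prod t u :: Γ) .real} :
      Dens Υ E M F →
      Dens Υ E (.snd M) (.integral rfl [t] (.letE (.pair v₀ v₁) F.wk₁.wk₁))
  | letDet {Γ Δ : Ctx} {Υ : PCtx S Γ Δ} {E : Tm S .tgt (Δ ++ Γ) .real} {t u : Ty}
      {M : Tm S .pure (Δ ++ Γ) t} {N : Tm S .src (t :: (Δ ++ Γ)) u}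
      {F : Tm S .tgt (u :: Γ) .real} :
      Dens (Δ := t :: Δ) (Υ.det M) E.wk N F →
      Dens Υ E (.letE M.embed N) F
  | letRnd {Γ Δ : Ctx} {Υ : PCtx S Γ Δ} {E : Tm S .tgt (Δ ++ Γ) .real} {t u : Ty}
      {M : Tm S .src (Δ ++ Γ) t} {N : Tm S .src (t :: (Δ ++ Γ)) u}
      {F₁ : Tm S .tgt (t :: (Δ ++ Γ)) .real} {F₂ : Tm S .tgt (u :: Γ) .real} :
      ¬ M.IsPure →
      Dens (Γ := Δ ++ Γ) (Δ := []) .empty (.real 1) M F₁ →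
      Dens (Δ := t :: Δ) (Υ.rnd t) (mul E.wk F₁) N F₂ →
      Dens Υ E (.letE M N) F₂
  | inl {Γ Δ : Ctx} {Υ : PCtx S Γ Δ} {E : Tm S .tgt (Δ ++ Γ) .real} {t u : Ty}
      {M : Tm S .src (Δ ++ Γ) t} {F : Tm S .tgt (t :: Γ) .real} :
      Dens Υ E M F →
      Dens Υ E (.inl (u := u) M) (.cases v₀ F.wk₁ (.real 0))
  | inr {Γ Δ : Ctx} {Υ : PCtx S Γ Δ} {E : Tm S .tgt (Δ ++ Γ) .real} {t u : Ty}
      {M : Tm S .src (Δ ++ Γ) u} {F : Tm S .tgt (u :: Γ) .real} :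
      Dens Υ E M F →
      Dens Υ E (.inr (t := t) M) (.cases v₀ (.real 0) F.wk₁)
  | matchDet {Γ Δ : Ctx} {Υ : PCtx S Γ Δ} {E : Tm S .tgt (Δ ++ Γ) .real} {t₁ t₂ u : Ty}
      {M : Tm S .pure (Δ ++ Γ) (.sum t₁ t₂)}
      {N₁ : Tm S .src (t₁ :: (Δ ++ Γ)) u} {N₂ : Tm S .src (t₂ :: (Δ ++ Γ)) u}
      {F₁ F₂ : Tm S .tgt (u :: Γ) .real} :
      Dens (Δ := t₁ :: Δ) (Υ.det (.op (.fromL t₁ t₂) M))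
        (wk (Γ := Δ ++ Γ) (mul E (.op (.isL t₁ t₂) M.embed))) N₁ F₁ →
      Dens (Δ := t₂ :: Δ) (Υ.det (.op (.fromR t₁ t₂) M))
        (wk (Γ := Δ ++ Γ) (mul E (.op (.isR t₁ t₂) M.embed))) N₂ F₂ →
      Dens Υ E (.cases M.embed N₁ N₂) (add F₁ F₂)
  | matchRnd {Γ Δ : Ctx} {Υ : PCtx S Γ Δ} {E : Tm S .tgt (Δ ++ Γ) .real} {t₁ t₂ u : Ty}
      {M : Tm S .src (Δ ++ Γ) (.sum t₁ t₂)}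
      {N₁ : Tm S .src (t₁ :: (Δ ++ Γ)) u} {N₂ : Tm S .src (t₂ :: (Δ ++ Γ)) u}
      {F : Tm S .tgt (.sum t₁ t₂ :: (Δ ++ Γ)) .real} {F₁ F₂ : Tm S .tgt (u :: Γ) .real} :
      ¬ M.IsPure →
      Dens (Γ := Δ ++ Γ) (Δ := []) .empty (.real 1) M F →
      Dens (Δ := t₁ :: Δ) (Υ.rnd t₁) (mul E.wk (.letE (.inl v₀) F.wk₁)) N₁ F₁ →
      Dens (Δ := t₂ :: Δ) (Υ.rnd t₂) (mul E.wk (.letE (.inr v₀) F.wk₁)) N₂ F₂ →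
      Dens Υ E (.cases M N₁ N₂) (add F₁ F₂)
  | fromL {Γ Δ : Ctx} {Υ : PCtx S Γ Δ} {E : Tm S .tgt (Δ ++ Γ) .real} {t u : Ty}
      {x : Var (Δ ++ Γ) t} {M : Tm S .pure (Δ ++ Γ) (.sum t u)}
      {F : Tm S .tgt (.sum t u :: Γ) .real} :
      Υ.Defines x (.op (.fromL t u) M) → Dens Υ E M.embed F →
      Dens Υ E (.op (.fromL t u) M.embed) (.letE (.inl v₀) F.wk₁)
  | fromR {Γ Δ : Ctx} {Υ : PCtx S Γ Δ} {E : Tm S .tgt (Δ ++ Γ) .real} {t u : Ty}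
      {x : Var (Δ ++ Γ) u} {M : Tm S .pure (Δ ++ Γ) (.sum t u)}
      {F : Tm S .tgt (.sum t u :: Γ) .real} :
      Υ.Defines x (.op (.fromR t u) M) → Dens Υ E M.embed F →
      Dens Υ E (.op (.fromR t u) M.embed) (.letE (.inr v₀) F.wk₁)
  /-- `X` is the set of the random variables that are free in `M σ_Υ`, and `M'` is `M σ_Υ` as an
  expression over `X` and the parameters. -/
  | discrete {Γ Δ X Y : Ctx} {Υ : PCtx S Γ Δ} {E : Tm S .tgt (Δ ++ Γ) .real} {t u : Ty}
      {f : Op S t u} {M : Tm S .pure (Δ ++ Γ) t} {M' : Tm S .tgt (X ++ Γ) t}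
      (hu : u.Discrete) (s : Split Υ.rands X Y) :
      ¬ f.IsFrom →
      M'.rename (s.incl Γ) = M.embed.subst Υ.consts →
      (∀ (v : Ty) (x : Var X v), M'.Occurs (x.inL (Γ := Γ))) →
      Dens Υ E (.op f M.embed)
        (.integral rfl X
          (mul ((Υ.marg s E).rename (Ren.liftAll (Γ := Γ) Ren.succ X))
            (iverson hu (.var (Var.inR X .zero))
              (.op f (M'.rename (Ren.liftAll (Γ := Γ) Ren.succ X))))))
  | inverse {Γ Δ : Ctx} {Υ : PCtx S Γ Δ} {E : Tm S .tgt (Δ ++ Γ) .real}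
      {M : Tm S .src (Δ ++ Γ) .real} {F : Tm S .tgt (.real :: Γ) .real} :
      Dens Υ E M F →
      Dens Υ E (div (.real 1) M)
        (mul (.letE (div (.real 1) v₀) F.wk₁) (div (.real 1) (mul v₀ v₀)))
  | exp {Γ Δ : Ctx} {Υ : PCtx S Γ Δ} {E : Tm S .tgt (Δ ++ Γ) .real}
      {M : Tm S .src (Δ ++ Γ) .real} {F : Tm S .tgt (.real :: Γ) .real} :
      Dens Υ E M F →
      Dens Υ E (.op .exp M)
        (ifLt (.real 0) v₀ (mul (.letE (.op .log v₀) F.wk₁) (div (.real 1) v₀)) (.real 0))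
  /-- Negative arguments of the logarithm have density zero. -/
  | log {Γ Δ : Ctx} {Υ : PCtx S Γ Δ} {E : Tm S .tgt (Δ ++ Γ) .real}
      {M : Tm S .src (Δ ++ Γ) .real} {F : Tm S .tgt (.real :: Γ) .real} :
      Dens Υ E M F →
      (¬ ∃ (σ : Env Γ) (r c : ℝ), r < 0 ∧ c ≠ 0 ∧ (letE (.real r) F).val σ = c) →
      Dens Υ E (.op .log M)
        (mul (.letE (.op .exp v₀) F.wk₁) (.op .exp v₀))
  | scale {Γ Δ : Ctx} {Υ : PCtx S Γ Δ} {E : Tm S .tgt (Δ ++ Γ) .real} {c : ℝ}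
      {M : Tm S .src (Δ ++ Γ) .real} {F : Tm S .tgt (.real :: Γ) .real} :
      c ≠ 0 → Dens Υ E M F →
      Dens Υ E (mul (.real c) M)
        (mul (.letE (div v₀ (.real c)) F.wk₁) (div (.real 1) (.op .abs (.real c))))
  /-- `N'` is `N σ_Υ`, as an expression over the parameters. -/
  | plusDet {Γ Δ : Ctx} {Υ : PCtx S Γ Δ} {E : Tm S .tgt (Δ ++ Γ) .real}
      {M : Tm S .src (Δ ++ Γ) .real} {N : Tm S .pure (Δ ++ Γ) .real} {N' : Tm S .tgt Γ .real}
      {F : Tm S .tgt (.real :: Γ) .real} :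
      Υ.IsConst N.embed → N'.rename (fun _ => Var.inR Υ.rands) = N.embed.subst Υ.consts →
      Dens Υ E M F →
      Dens Υ E (add M N.embed) (.letE (sub v₀ N'.wk) F.wk₁)
  | plusRnd {Γ Δ : Ctx} {Υ : PCtx S Γ Δ} {E : Tm S .tgt (Δ ++ Γ) .real}
      {M N : Tm S .src (Δ ++ Γ) .real} {F : Tm S .tgt (.prod .real .real :: Γ) .real} :
      ¬ Υ.IsConst N → Dens Υ E (.pair M N) F →
      Dens Υ E (add M N) (.integral rfl [.real] (.letE (.pair v₀ (sub v₁ v₀)) F.wk₁.wk₁))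

end DensityCompiler

open DensityCompiler

namespace DensityCompiler

variable {S : Signature} {k : Kind}

/-! ## Valuations, renaming and substitution -/

/-! The induction over the derivation carries a statement about open expressions. For all values of
the parameters and every measurable `g ≥ 0`, the stock integral of `F · g` equals the integral, over
the random variables weighted by `E`, of the integral of `g` against the measure denoted by `M`
(`IsDensity`). Testing with functions rather than sets makes the rules compositional. Monadic bind
becomes an iterated integral, and a rule with one premise amounts to finding, for each `g`, the
pulled-back test function `g'` to which the premise is applied (`IsDensity.of_pullback`). What
remains is Tonelli's theorem, one-dimensional changes of variables, and the splitting of integrals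
over sum types.

The weight `E` must be a joint density of the random variables: non-negative and of total mass at
most one (`PCtx.IsSubprob`). A random `let` preserves this because `F₁` is a density of the bound
expression for each value of all variables in scope, so `E · F₁` is the joint density of the
extended list (`PCtx.lintegral_weight_rnd`). A match distributes the mass over its two branches, and
the results add up (`IsDensity.add`).

Two default values could spoil the argument. A stock integral is a Bochner integral and has value
`0` when it diverges. The mass bound makes the inner integrals finite outside a null set of the
outer variable, so this default matters only on a null set (`ofReal_integral_ae_eq`,
`PCtx.lintegral_marg`, `lintegral_ofReal_integral_mul`). Likewise `fromL` returns a default on the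
wrong summand, while its rule ignores all mass there. A match on a pure expression, however, inserts
the definition `x = fromL(M)` together with the factor `isL(M)` in `E`, and later steps only
multiply `E` by further factors; hence `E` vanishes wherever the default is taken. `PCtx.Admissible`
records this. Replacing a variable by its definition may expose `fromL` at the head of the
expression being compiled, but nowhere deeper, so the induction runs over `Tm.IsAlmostSource` rather
than over source expressions.

For the empty context and `E = 1`, the invariant says that the measure denoted by `M` and the
measure with density `F` integrate all test functions alike. They are therefore equal, also on
null-measurable sets. -/

theorem Env.ext_get : {Γ : Ctx} → {σ τ : Env Γ} → (∀ (t : Ty) (x : Var Γ t), σ.get x = τ.get x) → σ = τ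
  | [], _, _, _ => rfl
  | _ :: _, _, _, h => Prod.ext (h _ .zero) (Env.ext_get fun t x => h t (.succ x))

theorem Env.get_inR {Γ : Ctx} {t : Ty} (x : Var Γ t) (σ : Env Γ) :
    (Δ : Ctx) → (η : Env Δ) → (η.append σ).get (Var.inR Δ x) = σ.get x
  | [], _ => rfl
  | _ :: Δ, η => Env.get_inR x σ Δ η.2

theorem Env.get_inL {Γ : Ctx} (σ : Env Γ) : {Δ : Ctx} → {t : Ty} → (x : Var Δ t) → (η : Env Δ) →
    (η.append σ).get (x.inL (Γ := Γ)) = η.get x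
  | _ :: _, _, .zero, _ => rfl
  | _ :: _, _, .succ x, η => Env.get_inL σ x η.2

/-- Pulling a valuation back along a renaming. -/
def Ren.Agrees {Γ Γ' : Ctx} (ρ : Ren Γ Γ') (σ' : Env Γ') (σ : Env Γ) : Prop :=
  ∀ (t : Ty) (x : Var Γ t), σ'.get (ρ t x) = σ.get x

theorem Ren.Agrees.lift {Γ Γ' : Ctx} {ρ : Ren Γ Γ'} {σ' : Env Γ'} {σ : Env Γ}
    (h : ρ.Agrees σ' σ) {u : Ty} (v : Val u) : (Ren.lift ρ (u := u)).Agrees (v, σ') (v, σ)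
  | _, .zero => rfl
  | _, .succ x => h _ x

theorem Ren.Agrees.liftAll {Γ Γ' : Ctx} {ρ : Ren Γ Γ'} {σ' : Env Γ'} {σ : Env Γ}
    (h : ρ.Agrees σ' σ) : (Δ : Ctx) → (η : Env Δ) →
    (Ren.liftAll ρ Δ).Agrees (η.append σ') (η.append σ)
  | [], _ => h
  | _ :: Δ, η => (Ren.Agrees.liftAll h Δ η.2).lift η.1

theorem Ren.agrees_succ {Γ : Ctx} {u : Ty} (v : Val u) (σ : Env Γ) :
    (Ren.succ (Γ := Γ) (u := u)).Agrees (v, σ) σ := fun _ _ => rfl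

/-- Relating two valuations, instead of computing one from the other, lets the hypothesis pass under
binders by `lift` and `liftAll`; applications then only have to check variables. -/
theorem Tm.val_rename {Γ : Ctx} {t : Ty} (M : Tm S .tgt Γ t) {Γ' : Ctx} {ρ : Ren Γ Γ'}
    {σ' : Env Γ'} {σ : Env Γ} (h : ρ.Agrees σ' σ) : (M.rename ρ).val σ' = M.val σ := by
  induction M generalizing Γ' with
  | var x => exact h _ x
  | unit | int | real => rfl
  | pair M N ihM ihN => simp only [Tm.rename, Tm.val, ihM h, ihN h]
  | fst M ih | snd M ih | inl M ih | inr M ih | op f M ih => simp only [Tm.rename, Tm.val, ih h]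
  | cases M N₁ N₂ ih ih₁ ih₂ =>
    simp only [Tm.rename, Tm.val, ih h]
    congr 1
    · funext v; exact ih₁ (h.lift v)
    · funext v; exact ih₂ (h.lift v)
  | letE M N ihM ihN => simp only [Tm.rename, Tm.val, ihM h]; exact ihN (h.lift _)
  | random hk => cases hk
  | fail hk => cases hk
  | integral hk Δ E ih =>
    simp only [Tm.rename, Tm.val]
    congr 1
    funext η
    exact ih (h.liftAll Δ η)

@[simp] theorem Tm.val_wk {Γ : Ctx} {t u : Ty} (M : Tm S .tgt Γ t) (v : Val u) (σ : Env Γ) :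
    M.wk.val (v, σ) = M.val σ := M.val_rename (Ren.agrees_succ v σ)

@[simp] theorem Tm.val_wk₁ {Γ : Ctx} {s t u : Ty} (M : Tm S .tgt (s :: Γ) t) (v : Val s)
    (w : Val u) (σ : Env Γ) : M.wk₁.val (v, w, σ) = M.val (v, σ) :=
  M.val_rename ((Ren.agrees_succ w σ).lift v)

/-- The valuation `σ` is obtained from `σ'` through the substitution `τ`. -/
def Sub.Agrees {Γ Γ' : Ctx} (τ : Sub S .tgt Γ Γ') (σ' : Env Γ') (σ : Env Γ) : Prop :=
  ∀ (t : Ty) (x : Var Γ t), (τ t x).val σ' = σ.get x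

theorem Sub.Agrees.lift {Γ Γ' : Ctx} {τ : Sub S .tgt Γ Γ'} {σ' : Env Γ'} {σ : Env Γ}
    (h : τ.Agrees σ' σ) {u : Ty} (v : Val u) : (Sub.lift τ (u := u)).Agrees (v, σ') (v, σ)
  | _, .zero => rfl
  | _, .succ x => (Tm.val_wk _ v σ').trans (h _ x)

theorem Sub.Agrees.liftAll {Γ Γ' : Ctx} {τ : Sub S .tgt Γ Γ'} {σ' : Env Γ'} {σ : Env Γ}
    (h : τ.Agrees σ' σ) : (Δ : Ctx) → (η : Env Δ) →
    (Sub.liftAll τ Δ).Agrees (η.append σ') (η.append σ)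
  | [], _ => h
  | _ :: Δ, η => (Sub.Agrees.liftAll h Δ η.2).lift η.1

theorem Tm.val_subst {Γ : Ctx} {t : Ty} (M : Tm S .tgt Γ t) {Γ' : Ctx} {τ : Sub S .tgt Γ Γ'}
    {σ' : Env Γ'} {σ : Env Γ} (h : τ.Agrees σ' σ) : (M.subst τ).val σ' = M.val σ := by
  induction M generalizing Γ' with
  | var x => exact h _ x
  | unit | int | real => rfl
  | pair M N ihM ihN => simp only [Tm.subst, Tm.val, ihM h, ihN h]
  | fst M ih | snd M ih | inl M ih | inr M ih | op f M ih => simp only [Tm.subst, Tm.val, ih h]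
  | cases M N₁ N₂ ih ih₁ ih₂ =>
    simp only [Tm.subst, Tm.val, ih h]
    congr 1
    · funext v; exact ih₁ (h.lift v)
    · funext v; exact ih₂ (h.lift v)
  | letE M N ihM ihN => simp only [Tm.subst, Tm.val, ihM h]; exact ihN (h.lift _)
  | random hk => cases hk
  | fail hk => cases hk
  | integral hk Δ E ih =>
    simp only [Tm.subst, Tm.val]
    congr 1
    funext η
    exact ih (h.liftAll Δ η)

/-! ## Pure expressions -/

theorem Tm.embed_rename {Γ : Ctx} {t : Ty} (P : Tm S .pure Γ t) {Γ' : Ctx} (ρ : Ren Γ Γ') :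
    (P.rename ρ).embed (k := k) = P.embed.rename ρ := by
  induction P generalizing Γ' with
  | random hk => cases hk
  | fail hk => cases hk
  | integral hk => cases hk
  | _ => simp_all [Tm.rename, Tm.embed]

theorem Tm.isSource_rename {Γ : Ctx} {t : Ty} (M : Tm S .src Γ t) {Γ' : Ctx} (ρ : Ren Γ Γ') :
    (M.rename ρ).IsSource ↔ M.IsSource := by
  induction M generalizing Γ' with
  | integral hk => cases hk
  | _ => simp_all [Tm.rename, Tm.IsSource]

theorem Env.measurable_get : {Γ : Ctx} → {t : Ty} → (x : Var Γ t) →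
    Measurable fun σ : Env Γ => σ.get x
  | _ :: _, _, .zero => measurable_fst
  | _ :: _, _, .succ x => (Env.measurable_get x).comp measurable_snd

theorem Env.measurable_append {Γ : Ctx} : (Δ : Ctx) →
    Measurable fun p : Env Δ × Env Γ => p.1.append p.2
  | [] => measurable_snd
  | _ :: Δ => (measurable_fst.comp measurable_fst).prodMk
      ((Env.measurable_append Δ).comp ((measurable_snd.comp measurable_fst).prodMk measurable_snd))

/-! ## Measurability of the primitives -/

/-- Products distribute over sums measurably. Case expressions need this form because a branch
depends jointly on the bound value and on the valuation. -/
theorem measurable_sumElim_uncurry {α β γ δ : Type*} [MeasurableSpace α] [MeasurableSpace β]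
    [MeasurableSpace γ] [MeasurableSpace δ] {f : α × γ → δ} {g : β × γ → δ}
    (hf : Measurable f) (hg : Measurable g) :
    Measurable fun p : (α ⊕ β) × γ => Sum.elim (fun x => f (x, p.2)) (fun y => g (y, p.2)) p.1 := by
  have : (fun p : (α ⊕ β) × γ => Sum.elim (fun x => f (x, p.2)) (fun y => g (y, p.2)) p.1) =
      Sum.elim f g ∘ MeasurableEquiv.sumProdDistrib α β γ := by
    funext ⟨a, c⟩
    cases a <;> rfl
  rw [this]
  exact (hf.sumElim hg).comp (MeasurableEquiv.measurable _)

theorem Val.countable_of_discrete : (t : Ty) → t.Discrete → Countable (Val t)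
  | .int, _ => inferInstanceAs (Countable ℤ)
  | .unit, _ => inferInstanceAs (Countable Unit)
  | .prod t u, h =>
    have := Val.countable_of_discrete t h.1
    have := Val.countable_of_discrete u h.2
    inferInstanceAs (Countable (Val t × Val u))
  | .sum t u, h =>
    have := Val.countable_of_discrete t h.1
    have := Val.countable_of_discrete u h.2
    inferInstanceAs (Countable (Val t ⊕ Val u))

instance measurableSingletonClass_sum {α β : Type*} [MeasurableSpace α] [MeasurableSpace β]
    [MeasurableSingletonClass α] [MeasurableSingletonClass β] : MeasurableSingletonClass (α ⊕ β) where
  measurableSet_singleton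
    | .inl x => by
      rw [← Set.image_singleton, measurableSet_inl_image]
      exact measurableSet_singleton x
    | .inr x => by
      rw [← Set.image_singleton, measurableSet_inr_image]
      exact measurableSet_singleton x

instance Val.measurableSingletonClass : (t : Ty) → MeasurableSingletonClass (Val t)
  | .int => inferInstanceAs (MeasurableSingletonClass ℤ)
  | .real => inferInstanceAs (MeasurableSingletonClass ℝ)
  | .unit => inferInstanceAs (MeasurableSingletonClass Unit)
  | .prod t u =>
    have := Val.measurableSingletonClass t
    have := Val.measurableSingletonClass u
    inferInstanceAs (MeasurableSingletonClass (Val t × Val u))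
  | .sum t u =>
    have := Val.measurableSingletonClass t
    have := Val.measurableSingletonClass u
    inferInstanceAs (MeasurableSingletonClass (Val t ⊕ Val u))

theorem Val.measurable_ofProp {α : Type*} [MeasurableSpace α] {p : α → Prop}
    (hp : MeasurableSet {a | p a}) : Measurable fun a => Val.ofProp (p a) := by
  classical
  unfold Val.ofProp
  exact Measurable.ite hp measurable_const measurable_const

/-- Continuity on the positive half-line suffices after cutting off the rest, and the Beta and Gamma
densities evaluate the Gamma function only at positive arguments. -/
theorem Real.measurable_Gamma_ite :
    Measurable fun x : ℝ => if 0 < x then Real.Gamma x else 0 := by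
  have hc : ContinuousOn (fun x : ℝ => if 0 < x then Real.Gamma x else 0) (Set.Ioi 0) :=
    Real.differentiableOn_Gamma_Ioi.continuousOn.congr fun x hx => if_pos hx
  convert hc.measurable_piecewise (g := fun _ => 0) continuousOn_const measurableSet_Ioi with x
  by_cases hx : 0 < x <;> simp [Set.piecewise, hx]

theorem measurable_betaPDFReal_ite : Measurable fun p : (ℝ × ℝ) × ℝ =>
    if 0 < p.1.1 ∧ 0 < p.1.2 then betaPDFReal p.1.1 p.1.2 p.2 else 0 := by
  -- The range test makes all Gamma arguments positive, so the Gamma function may be exchanged for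
  -- its measurable cutoff.
  have h : (fun p : (ℝ × ℝ) × ℝ =>
      if 0 < p.1.1 ∧ 0 < p.1.2 then betaPDFReal p.1.1 p.1.2 p.2 else 0) =
      fun p => if 0 < p.1.1 ∧ 0 < p.1.2 then (if 0 < p.2 ∧ p.2 < 1 then
        (1 / ((fun x : ℝ => if 0 < x then Real.Gamma x else 0) p.1.1 *
          (fun x : ℝ => if 0 < x then Real.Gamma x else 0) p.1.2 /
          (fun x : ℝ => if 0 < x then Real.Gamma x else 0) (p.1.1 + p.1.2))) *
          p.2 ^ (p.1.1 - 1) * (1 - p.2) ^ (p.1.2 - 1) else 0) else 0 := by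
    funext p
    by_cases hp : 0 < p.1.1 ∧ 0 < p.1.2
    · simp [betaPDFReal, beta, hp, add_pos hp.1 hp.2]
    · simp [hp]
  rw [h]
  have hG := Real.measurable_Gamma_ite
  have h1 : Measurable fun p : (ℝ × ℝ) × ℝ => p.1.1 := by fun_prop
  have h2 : Measurable fun p : (ℝ × ℝ) × ℝ => p.1.2 := by fun_prop
  have h3 : Measurable fun p : (ℝ × ℝ) × ℝ => p.2 := by fun_prop
  refine Measurable.ite ((measurableSet_lt measurable_const h1).inter
    (measurableSet_lt measurable_const h2)) ?_ measurable_const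
  refine Measurable.ite ((measurableSet_lt measurable_const h3).inter
    (measurableSet_lt h3 measurable_const)) ?_ measurable_const
  refine ((measurable_const.div (((hG.comp h1).mul (hG.comp h2)).div
    (hG.comp (h1.add h2)))).mul ?_).mul ?_
  · fun_prop
  · fun_prop

theorem measurable_gammaPDFReal_ite : Measurable fun p : (ℝ × ℝ) × ℝ =>
    if 0 < p.1.1 ∧ 0 < p.1.2 then gammaPDFReal p.1.1 (1 / p.1.2) p.2 else 0 := by
  have h : (fun p : (ℝ × ℝ) × ℝ =>
      if 0 < p.1.1 ∧ 0 < p.1.2 then gammaPDFReal p.1.1 (1 / p.1.2) p.2 else 0) =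
      fun p => if 0 < p.1.1 ∧ 0 < p.1.2 then (if 0 ≤ p.2 then
        (1 / p.1.2) ^ p.1.1 / ((fun x : ℝ => if 0 < x then Real.Gamma x else 0) p.1.1) *
          p.2 ^ (p.1.1 - 1) * Real.exp (-(1 / p.1.2 * p.2)) else 0) else 0 := by
    funext p
    by_cases hp : 0 < p.1.1 ∧ 0 < p.1.2
    · simp [gammaPDFReal, hp]
    · simp [hp]
  rw [h]
  have hG := Real.measurable_Gamma_ite
  have h1 : Measurable fun p : (ℝ × ℝ) × ℝ => p.1.1 := by fun_prop
  have h2 : Measurable fun p : (ℝ × ℝ) × ℝ => p.1.2 := by fun_prop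
  have h3 : Measurable fun p : (ℝ × ℝ) × ℝ => p.2 := by fun_prop
  refine Measurable.ite ((measurableSet_lt measurable_const h1).inter
    (measurableSet_lt measurable_const h2)) ?_ measurable_const
  refine Measurable.ite (measurableSet_le measurable_const h3) ?_ measurable_const
  refine ((Measurable.div ?_ (hG.comp h1)).mul ?_).mul ?_
  · fun_prop
  · fun_prop
  · fun_prop

theorem Dist.measurable_pdf {a t : Ty} (d : Dist S a t) :
    Measurable fun p : Val a × Val t => d.pdf p.1 p.2 := by
  cases d with
  | bernoulli =>
    change Measurable fun p : ℝ × (Unit ⊕ Unit) => if 0 ≤ p.1 ∧ p.1 ≤ 1 then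
      Sum.elim (fun _ => p.1) (fun _ => 1 - p.1) p.2 else 0
    have h1 : Measurable fun p : ℝ × (Unit ⊕ Unit) => p.1 := measurable_fst
    refine Measurable.ite ((measurableSet_le measurable_const h1).inter
      (measurableSet_le h1 measurable_const)) ?_ measurable_const
    exact (measurable_sumElim_uncurry (f := fun q : Unit × ℝ => q.2)
      (g := fun q : Unit × ℝ => 1 - q.2) measurable_snd (by fun_prop)).comp measurable_swap
  | poisson =>
    -- The second coordinate is countable, so joint measurability reduces to measurability in the
    -- rate for each fixed integer.
    refine measurable_from_prod_countable_left (β := ℤ) (α := ℝ) fun n => ?_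
    change Measurable fun r : ℝ => if 0 ≤ r ∧ 0 ≤ n then
      Real.exp (-r) * r ^ n.toNat / (n.toNat.factorial : ℝ) else 0
    refine Measurable.ite ((measurableSet_le measurable_const measurable_id).inter
      (.const _)) ?_ measurable_const
    fun_prop
  | gaussian =>
    change Measurable fun p : (ℝ × ℝ) × ℝ =>
      if 0 < p.1.2 then gaussianPDFReal p.1.1 (p.1.2 ^ 2).toNNReal p.2 else 0
    refine Measurable.ite (measurableSet_lt measurable_const (by fun_prop)) ?_ measurable_const
    exact measurable_uncurry_gaussianPDFReal.comp (by fun_prop : Measurable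
      fun p : (ℝ × ℝ) × ℝ => (p.1.1, (p.1.2 ^ 2).toNNReal, p.2))
  | beta => exact measurable_betaPDFReal_ite
  | gamma => exact measurable_gammaPDFReal_ite
  | ext d => exact S.measurable_pdf d

theorem Dist.pdf_nonneg {a t : Ty} (d : Dist S a t) (v : Val a) (x : Val t) : 0 ≤ d.pdf v x := by
  cases d with
  | bernoulli =>
    simp only [Dist.pdf]
    split_ifs with h
    · rcases x with x | x
      · exact h.1
      · exact sub_nonneg.2 h.2
    · exact le_rfl
  | poisson =>
    simp only [Dist.pdf]
    split_ifs with h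
    · have := h.1
      positivity
    · exact le_rfl
  | gaussian =>
    simp only [Dist.pdf]
    split_ifs with h
    · exact gaussianPDFReal_nonneg _ _ _
    · exact le_rfl
  | beta =>
    simp only [Dist.pdf]
    split_ifs with h
    · by_cases hx : 0 < x ∧ x < 1
      · exact (betaPDFReal_pos hx.1 hx.2 h.1 h.2).le
      · simp [betaPDFReal, hx]
    · exact le_rfl
  | gamma =>
    simp only [Dist.pdf]
    split_ifs with h
    · exact gammaPDFReal_nonneg h.1 (one_div_pos.2 h.2) x
    · exact le_rfl
  | ext d => exact S.pdf_nonneg d v x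

theorem Op.measurable_eval {t u : Ty} (f : Op S t u) : Measurable f.eval := by
  cases f with
  | realAdd => exact measurable_fst.add (measurable_snd (α := ℝ) (β := ℝ))
  | realSub => exact measurable_fst.sub (measurable_snd (α := ℝ) (β := ℝ))
  | realMul => exact measurable_fst.mul (measurable_snd (α := ℝ) (β := ℝ))
  | realDiv => exact measurable_fst.div (measurable_snd (α := ℝ) (β := ℝ))
  | exp => exact Real.measurable_exp
  | log => exact Measurable.ite measurableSet_Ioi Real.measurable_log measurable_const
  | abs => exact measurable_norm (α := ℝ)
  | realLt => exact Val.measurable_ofProp (measurableSet_lt measurable_fst (measurable_snd (α := ℝ) (β := ℝ)))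
  | intAdd | intSub | intMul => exact measurable_of_countable (α := ℤ × ℤ) _
  | intLt => exact measurable_of_countable (α := ℤ × ℤ) _
  | not => exact measurable_of_countable (α := Unit ⊕ Unit) _
  | and | or => exact measurable_of_countable (α := (Unit ⊕ Unit) × (Unit ⊕ Unit)) _
  | eq t h | iverson t h =>
    have := Val.countable_of_discrete t h
    exact measurable_of_countable (α := Val t × Val t) _
  | ext o => exact S.measurable_eval o
  | isL t u | isR t u => exact measurable_const.sumElim measurable_const
  | fromL t u => exact measurable_id.sumElim measurable_const
  | fromR t u => exact measurable_const.sumElim measurable_id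
  | pdf d => exact d.measurable_pdf

/-! ## Stock measures -/

theorem measurableEmbedding_inl {α β : Type*} [MeasurableSpace α] [MeasurableSpace β] :
    MeasurableEmbedding (Sum.inl : α → α ⊕ β) :=
  ⟨Sum.inl_injective, measurable_inl, fun _ h => measurableSet_inl_image.2 h⟩

theorem measurableEmbedding_inr {α β : Type*} [MeasurableSpace α] [MeasurableSpace β] :
    MeasurableEmbedding (Sum.inr : β → α ⊕ β) :=
  ⟨Sum.inr_injective, measurable_inr, fun _ h => measurableSet_inr_image.2 h⟩

/-- No measurability of `f` is needed, because both injections are measurable embeddings. -/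
theorem lintegral_stock_sum (t u : Ty) (f : Val t ⊕ Val u → ENNReal) :
    ∫⁻ z, f z ∂stock (.sum t u) =
      (∫⁻ x, f (.inl x) ∂stock t) + ∫⁻ y, f (.inr y) ∂stock u := by
  change ∫⁻ z, f z ∂((stock t).map Sum.inl + (stock u).map Sum.inr) = _
  rw [lintegral_add_measure, measurableEmbedding_inl.lintegral_map,
    measurableEmbedding_inr.lintegral_map]

instance stock.sigmaFinite : (t : Ty) → SigmaFinite (stock t)
  | .int => inferInstanceAs (SigmaFinite (Measure.count : Measure ℤ))
  | .real => inferInstanceAs (SigmaFinite (volume : Measure ℝ))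
  | .unit => inferInstanceAs (SigmaFinite (Measure.count : Measure Unit))
  | .prod t u =>
    have := stock.sigmaFinite t
    have := stock.sigmaFinite u
    inferInstanceAs (SigmaFinite ((stock t).prod (stock u)))
  | .sum t u =>
    have := stock.sigmaFinite t
    have := stock.sigmaFinite u
    have := (measurableEmbedding_inl (α := Val t) (β := Val u)).sigmaFinite_map (μ := stock t)
    have := (measurableEmbedding_inr (α := Val t) (β := Val u)).sigmaFinite_map (μ := stock u)
    inferInstanceAs (SigmaFinite ((stock t).map Sum.inl + (stock u).map Sum.inr))

instance stockEnv.sigmaFinite : (Δ : Ctx) → SigmaFinite (stockEnv Δ)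
  | [] => inferInstanceAs (SigmaFinite (Measure.dirac () : Measure Unit))
  | t :: Δ =>
    have := stockEnv.sigmaFinite Δ
    inferInstanceAs (SigmaFinite ((stock t).prod (stockEnv Δ)))

/-- This is why an Iverson bracket is the density of a point mass. -/
theorem stock_singleton : (t : Ty) → t.Discrete → (v : Val t) → stock t {v} = 1
  | .int, _, v => Measure.count_singleton (α := ℤ) v
  | .unit, _, v => Measure.count_singleton (α := Unit) v
  | .prod t u, h, (v, w) => by
    change ((stock t).prod (stock u)) {(v, w)} = 1
    rw [← Set.singleton_prod_singleton, Measure.prod_prod, stock_singleton t h.1 v,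
      stock_singleton u h.2 w, one_mul]
  | .sum t u, h, v => by
    change ((stock t).map Sum.inl + (stock u).map Sum.inr : Measure (Val t ⊕ Val u)) {v} = 1
    rw [Measure.add_apply, measurableEmbedding_inl.map_apply, measurableEmbedding_inr.map_apply]
    rcases v with v | v
    · have h₁ : (Sum.inl : Val t → Val t ⊕ Val u) ⁻¹' {Sum.inl v} = {v} := by ext; simp
      have h₂ : (Sum.inr : Val u → Val t ⊕ Val u) ⁻¹' {Sum.inl v} = ∅ := by ext; simp
      rw [h₁, h₂, stock_singleton t h.1 v, measure_empty, add_zero]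
    · have h₁ : (Sum.inl : Val t → Val t ⊕ Val u) ⁻¹' {Sum.inr v} = ∅ := by ext; simp
      have h₂ : (Sum.inr : Val u → Val t ⊕ Val u) ⁻¹' {Sum.inr v} = {v} := by ext; simp
      rw [h₁, h₂, stock_singleton u h.2 v, measure_empty, zero_add]

theorem stock_eq_count {t : Ty} (h : t.Discrete) : stock t = Measure.count := by
  have := Val.countable_of_discrete t h
  refine Measure.ext_of_singleton fun v => ?_
  rw [stock_singleton t h v, Measure.count_singleton]

theorem Dist.law_eq {a t : Ty} (d : Dist S a t) (v : Val a) :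
    d.law v = (stock t).withDensity fun x => ENNReal.ofReal (d.pdf v x) := by
  cases d with
  | bernoulli =>
    have hd : Ty.bool.Discrete := ⟨trivial, trivial⟩
    rw [stock_eq_count hd]
    refine Measure.ext_of_singleton (α := Unit ⊕ Unit) fun x => ?_
    rw [withDensity_apply _ (measurableSet_singleton x), Measure.restrict_singleton]
    simp only [Dist.law, Dist.pdf]
    split_ifs with h <;> rcases x with x | x <;> simp
  | poisson =>
    rw [stock_eq_count (t := .int) trivial]
    refine Measure.ext_of_singleton (α := ℤ) fun n => ?_
    rw [withDensity_apply _ (measurableSet_singleton n), Measure.restrict_singleton]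
    simp only [Dist.law, Dist.pdf]
    by_cases h : 0 ≤ (v : ℝ)
    · rw [if_pos h, Measure.map_apply .of_discrete (measurableSet_singleton n)]
      by_cases hn : 0 ≤ n
      · lift n to ℕ using hn
        have : (fun n : ℕ => (n : ℤ)) ⁻¹' {(n : ℤ)} = {n} := by ext; simp
        rw [this, poissonMeasure_singleton]
        simp [h]
      · have : (fun n : ℕ => (n : ℤ)) ⁻¹' {n} = ∅ := by
          ext m
          simp only [Set.mem_preimage, Set.mem_singleton_iff, Set.mem_empty_iff_false, iff_false]
          omega
        rw [this]
        simp [hn]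
    · simp [h]
  | gaussian =>
    simp only [Dist.law, Dist.pdf]
    split_ifs with h
    -- A positive standard deviation excludes the degenerate Gaussian, which is a point mass without
    -- density.
    · rw [gaussianReal_of_var_ne_zero _ (by simpa using h.ne')]
      rfl
    · simp
  | beta =>
    simp only [Dist.law, Dist.pdf]
    split_ifs with h
    · rfl
    · simp
  | gamma =>
    simp only [Dist.law, Dist.pdf]
    split_ifs with h
    · rfl
    · simp
  | ext d => exact S.law_eq d v

theorem Dist.law_univ_le_one {a t : Ty} (d : Dist S a t) (v : Val a) : d.law v Set.univ ≤ 1 := by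
  cases d with
  | bernoulli =>
    simp only [Dist.law]
    split_ifs with h
    · simp only [Measure.add_apply, Measure.smul_apply, measure_univ, smul_eq_mul, mul_one]
      rw [← ENNReal.ofReal_add h.1 (sub_nonneg.2 h.2)]
      simp
    · simp
  | poisson =>
    simp only [Dist.law]
    split_ifs with h
    · exact (measure_univ (μ := (poissonMeasure (v : ℝ).toNNReal).map (fun n : ℕ => (n : ℤ)))).le
    · simp
  | gaussian =>
    simp only [Dist.law]
    split_ifs with h
    · exact (measure_univ (μ := gaussianReal _ _)).le
    · simp
  | beta =>
    simp only [Dist.law]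
    split_ifs with h
    · exact (isProbabilityMeasureBeta h.1 h.2).measure_univ.le
    · simp
  | gamma =>
    simp only [Dist.law]
    split_ifs with h
    · exact (isProbabilityMeasure_gammaMeasure h.1 (one_div_pos.2 h.2)).measure_univ.le
    · simp
  | ext d => exact S.law_univ_le_one d v

theorem Dist.measurable_law {a t : Ty} (d : Dist S a t) : Measurable d.law := by
  refine Measure.measurable_of_measurable_coe _ fun s hs => ?_
  simp only [d.law_eq, withDensity_apply _ hs]
  exact (d.measurable_pdf.ennreal_ofReal).lintegral_prod_right'

theorem Dist.lintegral_law {a t : Ty} (d : Dist S a t) (v : Val a) {g : Val t → ENNReal}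
    (hg : Measurable g) :
    ∫⁻ z, g z ∂d.law v = ∫⁻ z, ENNReal.ofReal (d.pdf v z) * g z ∂stock t := by
  rw [d.law_eq, lintegral_withDensity_eq_lintegral_mul _ _ hg]
  · rfl
  · exact (d.measurable_pdf.comp measurable_prodMk_left).ennreal_ofReal

/-! ## Measurability of the semantics -/

theorem Tm.measurable_val {Γ : Ctx} {t : Ty} (M : Tm S .tgt Γ t) : Measurable M.val := by
  induction M with
  | var x => exact Env.measurable_get x
  | unit | int | real => exact measurable_const
  | pair M N ihM ihN => exact ihM.prodMk ihN
  | fst M ih => exact measurable_fst.comp ih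
  | snd M ih => exact measurable_snd.comp ih
  | inl M ih => exact measurable_inl.comp ih
  | inr M ih => exact measurable_inr.comp ih
  | op f M ih => exact f.measurable_eval.comp ih
  | cases M N₁ N₂ ih ih₁ ih₂ =>
    exact (measurable_sumElim_uncurry ih₁ ih₂).comp (ih.prodMk measurable_id)
  | letE M N ihM ihN => exact ihN.comp (ihM.prodMk measurable_id)
  | random hk => cases hk
  | fail hk => cases hk
  | integral hk Δ E ih =>
    have h : Measurable fun p : _ × Env Δ => (E.val (p.2.append p.1) : ℝ) :=
      ih.comp ((Env.measurable_append Δ).comp measurable_swap)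
    -- A parametrised Bochner integral is measurable without any integrability assumption, the
    -- default `0` included.
    exact h.stronglyMeasurable.integral_prod_right.measurable

/-- The mass bound turns `κ` into a finite kernel, for which integrals of jointly measurable
functions depend measurably on the parameter. -/
theorem measurable_bind_of_le_one {α β γ : Type*} [MeasurableSpace α] [MeasurableSpace β]
    [MeasurableSpace γ] {κ : α → Measure β} (hκ : Measurable κ) (h : ∀ a, κ a Set.univ ≤ 1)
    {η : β → α → Measure γ} (hη : Measurable fun p : β × α => η p.1 p.2) :
    Measurable fun a => (κ a).bind fun b => η b a := by
  refine Measure.measurable_of_measurable_coe _ fun s hs => ?_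
  have hb : ∀ a, Measurable fun b => η b a := fun a => hη.comp (measurable_id.prodMk measurable_const)
  simp only [Measure.bind_apply hs (hb _).aemeasurable]
  let K : Kernel α β := ⟨κ, hκ⟩
  have : IsFiniteKernel K := ⟨1, by simp, h⟩
  exact Measurable.lintegral_kernel_prod_right (κ := K) (f := fun a b => η b a s)
    (((Measure.measurable_coe hs).comp hη).comp measurable_swap)

theorem bind_univ_le_one {β γ : Type*} [MeasurableSpace β] [MeasurableSpace γ] {μ : Measure β}
    (hμ : μ Set.univ ≤ 1) {η : β → Measure γ} (hη : Measurable η) (h : ∀ b, η b Set.univ ≤ 1) :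
    μ.bind η Set.univ ≤ 1 := by
  rw [Measure.bind_apply .univ hη.aemeasurable]
  calc ∫⁻ b, η b Set.univ ∂μ ≤ ∫⁻ _, 1 ∂μ := lintegral_mono h
    _ ≤ 1 := by simpa using hμ

theorem bind_dirac_measurable_and_le_one {α β γ : Type*} [MeasurableSpace α] [MeasurableSpace β]
    [MeasurableSpace γ] {κ : α → Measure β} (hκ : Measurable κ ∧ ∀ a, κ a Set.univ ≤ 1)
    {f : β → γ} (hf : Measurable f) :
    Measurable (fun a => (κ a).bind fun b => Measure.dirac (f b)) ∧
      ∀ a, (κ a).bind (fun b => Measure.dirac (f b)) Set.univ ≤ 1 :=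
  ⟨measurable_bind_of_le_one hκ.1 hκ.2
      (Measure.measurable_dirac.comp (hf.comp measurable_fst)),
    fun a => bind_univ_le_one (hκ.2 a) (Measure.measurable_dirac.comp hf) fun _ => by simp⟩

theorem bind_measurable_and_le_one {α β γ : Type*} [MeasurableSpace α] [MeasurableSpace β]
    [MeasurableSpace γ] {κ : α → Measure β} (hκ : Measurable κ ∧ ∀ a, κ a Set.univ ≤ 1)
    {η : β → α → Measure γ} (hη : Measurable fun p : β × α => η p.1 p.2)
    (h : ∀ b a, η b a Set.univ ≤ 1) :
    Measurable (fun a => (κ a).bind fun b => η b a) ∧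
      ∀ a, (κ a).bind (fun b => η b a) Set.univ ≤ 1 :=
  ⟨measurable_bind_of_le_one hκ.1 hκ.2 hη,
    fun a => bind_univ_le_one (hκ.2 a) (hη.comp (measurable_id.prodMk measurable_const))
      fun b => h b a⟩

theorem bind_pair_measurable_and_le_one {α β γ : Type*} [MeasurableSpace α] [MeasurableSpace β]
    [MeasurableSpace γ] {κ : α → Measure β} (hκ : Measurable κ ∧ ∀ a, κ a Set.univ ≤ 1)
    {η : α → Measure γ} (hη : Measurable η ∧ ∀ a, η a Set.univ ≤ 1) :
    Measurable (fun a => (κ a).bind fun z => (η a).bind fun w => Measure.dirac (z, w)) ∧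
      ∀ a, (κ a).bind (fun z => (η a).bind fun w => Measure.dirac (z, w)) Set.univ ≤ 1 := by
  refine bind_measurable_and_le_one hκ (η := fun z a => (η a).bind fun w => Measure.dirac (z, w))
    ?_ fun z a => ?_
  · exact measurable_bind_of_le_one (κ := fun p : β × α => η p.2)
      (η := fun w p => Measure.dirac (p.1, w)) (hη.1.comp measurable_snd)
      (fun p => hη.2 p.2) (Measure.measurable_dirac.comp (by fun_prop))
  · exact bind_univ_le_one (hη.2 a) (Measure.measurable_dirac.comp measurable_prodMk_left)
      fun w => by simp

/-- The two claims are proved together: measurability of a bind relies on the mass bound for its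
first argument, and the mass bound relies on measurability of the continuation. -/
theorem Tm.measurable_meas_and_le_one {Γ : Ctx} {t : Ty} (M : Tm S .src Γ t) :
    Measurable (fun σ => M.meas σ) ∧ ∀ σ, M.meas σ Set.univ ≤ 1 := by
  induction M with
  | var x => exact ⟨Measure.measurable_dirac.comp (Env.measurable_get x), fun σ => by simp [Tm.meas]⟩
  | unit | int | real => exact ⟨measurable_const, fun σ => by simp [Tm.meas]⟩
  | pair M N ihM ihN =>
    simp only [Tm.meas]
    exact bind_pair_measurable_and_le_one ihM ihN
  | fst M ih =>
    simp only [Tm.meas]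
    exact bind_dirac_measurable_and_le_one ih measurable_fst
  | snd M ih =>
    simp only [Tm.meas]
    exact bind_dirac_measurable_and_le_one ih measurable_snd
  | inl M ih =>
    simp only [Tm.meas]
    exact bind_dirac_measurable_and_le_one ih measurable_inl
  | inr M ih =>
    simp only [Tm.meas]
    exact bind_dirac_measurable_and_le_one ih measurable_inr
  | op f M ih =>
    simp only [Tm.meas]
    exact bind_dirac_measurable_and_le_one ih f.measurable_eval
  | cases M N₁ N₂ ih ih₁ ih₂ =>
    simp only [Tm.meas]
    refine bind_measurable_and_le_one ih (measurable_sumElim_uncurry ih₁.1 ih₂.1) ?_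
    rintro (x | y) σ
    · exact ih₁.2 (x, σ)
    · exact ih₂.2 (y, σ)
  | letE M N ihM ihN =>
    simp only [Tm.meas]
    exact bind_measurable_and_le_one ihM ihN.1 fun z σ => ihN.2 (z, σ)
  | random hk d M ih =>
    simp only [Tm.meas]
    exact bind_measurable_and_le_one ih (d.measurable_law.comp measurable_fst)
      fun v _ => d.law_univ_le_one v
  | fail hk => exact ⟨measurable_const, fun σ => by simp [Tm.meas]⟩
  | integral hk => cases hk

theorem Tm.measurable_meas {Γ : Ctx} {t : Ty} (M : Tm S .src Γ t) : Measurable M.meas := M.measurable_meas_and_le_one.1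

theorem Tm.measurable_meas_cons {Γ : Ctx} {t u : Ty} (N : Tm S .src (u :: Γ) t) (σ : Env Γ) :
    Measurable fun z => N.meas (z, σ) := N.measurable_meas.comp measurable_prodMk_right

/-- Expressions denote sub-probability measures. -/
theorem Tm.meas_univ_le_one {Γ : Ctx} {t : Ty} (M : Tm S .src Γ t) (σ : Env Γ) :
    M.meas σ Set.univ ≤ 1 := M.measurable_meas_and_le_one.2 σ

instance Tm.isFiniteMeasure_meas {Γ : Ctx} {t : Ty} (M : Tm S .src Γ t) (σ : Env Γ) :
    IsFiniteMeasure (M.meas σ) := ⟨(M.meas_univ_le_one σ).trans_lt ENNReal.one_lt_top⟩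

theorem Tm.measurable_lintegral_meas {Γ : Ctx} {t : Ty} (M : Tm S .src Γ t) {g : Val t → ENNReal}
    (hg : Measurable g) : Measurable fun σ => ∫⁻ z, g z ∂M.meas σ :=
  (Measure.measurable_lintegral hg).comp M.measurable_meas

/-! ### Integrals of test functions against the monadic semantics -/

section Integrals

variable {Γ : Ctx} {t u : Ty} (σ : Env Γ)

theorem Tm.lintegral_meas_bind_dirac (M : Tm S .src Γ t) {f : Val t → Val u} (hf : Measurable f)
    {g : Val u → ENNReal} (hg : Measurable g) :
    ∫⁻ w, g w ∂(M.meas σ).bind (fun z => Measure.dirac (f z)) = ∫⁻ z, g (f z) ∂M.meas σ := by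
  have h : Measurable fun z => Measure.dirac (f z) := Measure.measurable_dirac.comp hf
  rw [Measure.lintegral_bind h.aemeasurable hg.aemeasurable]
  simp only [lintegral_dirac' _ hg]

theorem Tm.lintegral_meas_pair (M : Tm S .src Γ t) (N : Tm S .src Γ u) {g : Val t × Val u → ENNReal}
    (hg : Measurable g) :
    ∫⁻ w, g w ∂(Tm.pair M N).meas σ = ∫⁻ z, ∫⁻ w, g (z, w) ∂N.meas σ ∂M.meas σ := by
  have hd : ∀ z : Val t, Measurable fun w : Val u => Measure.dirac (z, w) := fun z =>
    Measure.measurable_dirac.comp measurable_prodMk_left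
  have h : Measurable fun z : Val t => (N.meas σ).bind fun w => Measure.dirac (z, w) :=
    measurable_bind_of_le_one (κ := fun _ : Val t => N.meas σ)
      (η := fun w z => Measure.dirac (z, w)) measurable_const
      (fun _ => N.meas_univ_le_one σ) (Measure.measurable_dirac.comp (by fun_prop))
  change ∫⁻ w, g w ∂(M.meas σ).bind _ = _
  rw [Measure.lintegral_bind h.aemeasurable hg.aemeasurable]
  refine lintegral_congr fun z => ?_
  rw [Measure.lintegral_bind (hd z).aemeasurable hg.aemeasurable]
  simp only [lintegral_dirac' _ hg]

theorem Tm.lintegral_meas_letE (M : Tm S .src Γ t) (N : Tm S .src (t :: Γ) u) {g : Val u → ENNReal}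
    (hg : Measurable g) :
    ∫⁻ w, g w ∂(Tm.letE M N).meas σ = ∫⁻ z, ∫⁻ w, g w ∂N.meas (z, σ) ∂M.meas σ :=
  Measure.lintegral_bind (N.measurable_meas_cons σ).aemeasurable hg.aemeasurable

theorem Tm.lintegral_meas_random {hk : Kind.src = .src} (d : Dist S t u) (M : Tm S .src Γ t)
    {g : Val u → ENNReal} (hg : Measurable g) :
    ∫⁻ w, g w ∂(Tm.random hk d M).meas σ =
      ∫⁻ z, ∫⁻ w, ENNReal.ofReal (d.pdf z w) * g w ∂stock u ∂M.meas σ := by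
  change ∫⁻ w, g w ∂(M.meas σ).bind _ = _
  rw [Measure.lintegral_bind d.measurable_law.aemeasurable hg.aemeasurable]
  exact lintegral_congr fun z => d.lintegral_law z hg

theorem Tm.measurable_meas_cases {v : Ty} (N₁ : Tm S .src (t :: Γ) v)
    (N₂ : Tm S .src (u :: Γ) v) : Measurable fun z : Val t ⊕ Val u =>
      Sum.elim (fun x => N₁.meas (x, σ)) (fun y => N₂.meas (y, σ)) z :=
  (N₁.measurable_meas_cons σ).sumElim (N₂.measurable_meas_cons σ)

theorem Tm.lintegral_meas_cases {v : Ty} (M : Tm S .src Γ (.sum t u)) (N₁ : Tm S .src (t :: Γ) v)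
    (N₂ : Tm S .src (u :: Γ) v) {g : Val v → ENNReal} (hg : Measurable g) :
    ∫⁻ w, g w ∂(Tm.cases M N₁ N₂).meas σ =
      ∫⁻ z, Sum.elim (fun x => ∫⁻ w, g w ∂N₁.meas (x, σ)) (fun y => ∫⁻ w, g w ∂N₂.meas (y, σ)) z
        ∂M.meas σ := by
  change ∫⁻ w, g w ∂(M.meas σ).bind _ = _
  rw [Measure.lintegral_bind (Tm.measurable_meas_cases σ N₁ N₂).aemeasurable hg.aemeasurable]
  refine lintegral_congr fun z => ?_
  cases z <;> rfl

end Integrals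

/-- Without `random` and `fail`, each bind starts from a point mass and collapses by the left unit
law; pairs are compared through their integrals. -/
theorem Tm.meas_embed {Γ : Ctx} {t : Ty} (P : Tm S .pure Γ t) (σ : Env Γ) :
    P.embed.meas σ = Measure.dirac (P.embed.val σ) := by
  induction P with
  | var | unit | int | real => rfl
  | @pair Γ t u M N ihM ihN =>
    refine Measure.ext_of_lintegral _ fun g hg => ?_
    have := Tm.lintegral_meas_pair σ (M.embed) (N.embed) hg
    rw [Tm.embed, this, ihM, ihN, lintegral_dirac', lintegral_dirac', lintegral_dirac' _ hg]
    · rfl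
    · exact hg.comp measurable_prodMk_left
    · have : (fun z => ∫⁻ w, g (z, w) ∂Measure.dirac (N.embed.val σ)) =
          fun z => g (z, N.embed.val σ) :=
        funext fun z => lintegral_dirac' _ (hg.comp measurable_prodMk_left)
      rw [this]
      exact hg.comp measurable_prodMk_right
  | fst M ih =>
    simp only [Tm.embed, Tm.meas, ih]
    exact Measure.dirac_bind (Measure.measurable_dirac.comp measurable_fst) _
  | snd M ih =>
    simp only [Tm.embed, Tm.meas, ih]
    exact Measure.dirac_bind (Measure.measurable_dirac.comp measurable_snd) _
  | inl M ih =>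
    simp only [Tm.embed, Tm.meas, ih]
    exact Measure.dirac_bind (Measure.measurable_dirac.comp measurable_inl) _
  | inr M ih =>
    simp only [Tm.embed, Tm.meas, ih]
    exact Measure.dirac_bind (Measure.measurable_dirac.comp measurable_inr) _
  | op f M ih =>
    simp only [Tm.embed, Tm.meas, ih]
    exact Measure.dirac_bind (Measure.measurable_dirac.comp f.measurable_eval) _
  | cases M N₁ N₂ ih ih₁ ih₂ =>
    simp only [Tm.embed, Tm.meas, ih, Tm.val]
    refine (Measure.dirac_bind (Tm.measurable_meas_cases σ N₁.embed N₂.embed) _).trans ?_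
    cases M.embed.val σ with
    | inl x => exact ih₁ _
    | inr y => exact ih₂ _
  | letE M N ihM ihN =>
    simp only [Tm.embed, Tm.meas, ihM, Tm.val]
    exact (Measure.dirac_bind (N.embed.measurable_meas_cons σ) _).trans (ihN _)
  | random hk => cases hk
  | fail hk => cases hk
  | integral hk => cases hk

theorem Tm.lintegral_meas_embed {Γ : Ctx} {t : Ty} (P : Tm S .pure Γ t) (σ : Env Γ)
    {g : Val t → ENNReal} (hg : Measurable g) : ∫⁻ z, g z ∂P.embed.meas σ = g (P.embed.val σ) := by
  rw [P.meas_embed, lintegral_dirac' _ hg]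

/-! ## Probability contexts -/

/-- The valuation of all variables that is determined by the random variables and parameters. -/
noncomputable def PCtx.env {Γ : Ctx} : {Δ : Ctx} → (Υ : PCtx S Γ Δ) → Env (Υ.rands ++ Γ) → Env (Δ ++ Γ)
  | _, .empty => fun σ => σ
  | _, .rnd Υ _ => fun σ => (σ.1, Υ.env σ.2)
  | _, .det Υ P => fun σ => (P.embed.val (Υ.env σ), Υ.env σ)

theorem PCtx.measurable_env {Γ : Ctx} : {Δ : Ctx} → (Υ : PCtx S Γ Δ) → Measurable Υ.env
  | _, .empty => measurable_id
  | _, .rnd Υ _ => measurable_fst.prodMk (Υ.measurable_env.comp measurable_snd)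
  | _, .det Υ P => (P.embed.measurable_val.comp Υ.measurable_env).prodMk Υ.measurable_env

/-- `PCtx.env` does semantically what the substitution `σ_Υ` does syntactically. Through this link
`σ_Υ` disappears from all later computations. -/
theorem PCtx.agrees_consts {Γ : Ctx} : {Δ : Ctx} → (Υ : PCtx S Γ Δ) → (σ : Env (Υ.rands ++ Γ)) →
    Υ.consts.Agrees σ (Υ.env σ)
  | _, .empty, _ => fun _ _ => rfl
  | _, .rnd Υ _, σ => (Υ.agrees_consts σ.2).lift σ.1
  | _, .det Υ P, σ => fun _ x => match x with
    | .zero => P.embed.val_subst (Υ.agrees_consts σ)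
    | .succ x => Υ.agrees_consts σ _ x

theorem PCtx.agrees_incl {Γ : Ctx} : {Δ : Ctx} → (Υ : PCtx S Γ Δ) → (σ : Env (Υ.rands ++ Γ)) →
    Υ.incl.Agrees (Υ.env σ) σ
  | _, .empty, _ => fun _ _ => rfl
  | _, .rnd Υ _, σ => (Υ.agrees_incl σ.2).lift σ.1
  | _, .det Υ _, σ => fun _ x => Υ.agrees_incl σ _ x

theorem PCtx.Defines.get_env {Γ Δ : Ctx} {Υ : PCtx S Γ Δ} {t : Ty} {x : Var (Δ ++ Γ) t}
    {P : Tm S .pure (Δ ++ Γ) t} (h : Υ.Defines x P) (σ : Env (Υ.rands ++ Γ)) :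
    (Υ.env σ).get x = P.embed.val (Υ.env σ) := by
  induction h with
  | here => 
    rw [Tm.wk, Tm.embed_rename]
    exact (Tm.val_wk _ _ _).symm
  | rnd h ih =>
    rw [Tm.wk, Tm.embed_rename]
    exact (ih σ.2).trans (Tm.val_wk _ _ _).symm
  | det h ih =>
    rw [Tm.wk, Tm.embed_rename]
    exact (ih σ).trans (Tm.val_wk _ _ _).symm

/-- The semantic content of constancy: the value does not depend on the random variables `ρ`. -/
theorem PCtx.val_of_rename_inR_eq {Γ Δ : Ctx} (Υ : PCtx S Γ Δ) {t : Ty} {P : Tm S .pure (Δ ++ Γ) t}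
    {P' : Tm S .tgt Γ t} (h : P'.rename (fun _ => Var.inR Υ.rands) = P.embed.subst Υ.consts)
    (ρ : Env Υ.rands) (γ : Env Γ) : P.embed.val (Υ.env (ρ.append γ)) = P'.val γ := by
  rw [← Tm.val_subst _ (Υ.agrees_consts (ρ.append γ)), ← h]
  exact P'.val_rename fun _ x => Env.get_inR x γ _ ρ

/-! ## Marginal densities -/

/-- A valuation put together from its two parts. -/
def Split.merge : {R X Y : Ctx} → Split R X Y → Env X → Env Y → Env R
  | _, _, _, .nil => fun _ _ => ()
  | _, _, _, .left _ s => fun η θ => (η.1, s.merge η.2 θ)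
  | _, _, _, .right _ s => fun η θ => (θ.1, s.merge η θ.2)

theorem Split.measurable_merge : {R X Y : Ctx} → (s : Split R X Y) →
    Measurable fun p : Env X × Env Y => s.merge p.1 p.2
  | _, _, _, .nil => measurable_const
  | _, _, _, .left _ s => (measurable_fst.comp measurable_fst).prodMk
      (s.measurable_merge.comp ((measurable_snd.comp measurable_fst).prodMk measurable_snd))
  | _, _, _, .right _ s => (measurable_fst.comp measurable_snd).prodMk
      (s.measurable_merge.comp (measurable_fst.prodMk (measurable_snd.comp measurable_snd)))

theorem Split.agrees_incl {Γ : Ctx} (γ : Env Γ) : {R X Y : Ctx} → (s : Split R X Y) →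
    (η : Env X) → (θ : Env Y) →
    (s.incl Γ).Agrees ((s.merge η θ).append γ) (η.append γ)
  | _, _, _, .nil, _, _ => fun _ _ => rfl
  | _, _, _, .left _ s, η, θ => (s.agrees_incl γ η.2 θ).lift η.1
  | _, _, _, .right _ s, η, θ => fun _ x => s.agrees_incl γ η θ.2 _ x

theorem Split.agrees_reorder {Γ : Ctx} (γ : Env Γ) : {R X Y : Ctx} → (s : Split R X Y) →
    (η : Env X) → (θ : Env Y) →
    (s.reorder Γ).Agrees (θ.append (η.append γ)) ((s.merge η θ).append γ)
  | _, _, _, .nil, _, _ => fun _ _ => rfl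
  | _, _, Y, .left _ s, η, θ => fun _ x => match x with
    | .zero => Env.get_inR _ _ Y θ
    | .succ x => ((Ren.agrees_succ η.1 (η.2.append γ)).liftAll Y θ _ _).trans
        (s.agrees_reorder γ η.2 θ _ x)
  | _, _, _, .right _ s, η, θ => (s.agrees_reorder γ η θ.2).lift θ.1

theorem lintegral_stockEnv_cons (t : Ty) (Δ : Ctx) {f : Val t × Env Δ → ENNReal}
    (hf : Measurable f) :
    ∫⁻ ρ, f ρ ∂stockEnv (t :: Δ) = ∫⁻ v, ∫⁻ η, f (v, η) ∂stockEnv Δ ∂stock t :=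
  lintegral_prod _ hf.aemeasurable

theorem lintegral_stockEnv_nil (f : Unit → ENNReal) : ∫⁻ ρ, f ρ ∂stockEnv [] = f () :=
  lintegral_dirac () f

theorem lintegral_stockEnv_singleton (t : Ty) {f : Val t × Unit → ENNReal} (hf : Measurable f) :
    ∫⁻ ρ, f ρ ∂stockEnv [t] = ∫⁻ v, f (v, ()) ∂stock t := by
  rw [lintegral_stockEnv_cons t [] hf]
  exact lintegral_congr fun v => lintegral_stockEnv_nil fun η => f (v, η)

/-- Tonelli for a subset of the variables and its complement. -/
theorem Split.lintegral_stockEnv : {R X Y : Ctx} → (s : Split R X Y) → {f : Env R → ENNReal} →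
    Measurable f →
    ∫⁻ ρ, f ρ ∂stockEnv R = ∫⁻ η, ∫⁻ θ, f (s.merge η θ) ∂stockEnv Y ∂stockEnv X
  | _, _, _, .nil, f, _ => by
    rw [lintegral_stockEnv_nil, lintegral_stockEnv_nil, lintegral_stockEnv_nil]
  | _, _, _, .left (R := R) (X := X) (Y := Y) t s, f, hf => by
    have hm : Measurable fun η => ∫⁻ θ, f ((Split.left t s).merge η θ) ∂stockEnv Y :=
      (hf.comp (Split.left t s).measurable_merge).lintegral_prod_right'
    rw [lintegral_stockEnv_cons t R hf, lintegral_stockEnv_cons t X hm]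
    exact lintegral_congr fun v => s.lintegral_stockEnv (hf.comp measurable_prodMk_left)
  | _, _, _, .right (R := R) (X := X) (Y := Y) t s, f, hf => by
    have hm := hf.comp (Split.right t s).measurable_merge
    rw [lintegral_stockEnv_cons t R hf]
    trans ∫⁻ v, ∫⁻ η, ∫⁻ θ, f (v, s.merge η θ) ∂stockEnv Y ∂stockEnv X ∂stock t
    · exact lintegral_congr fun v => s.lintegral_stockEnv (hf.comp measurable_prodMk_left)
    · have h3 : Measurable fun p : (Val t × Env X) × Env Y => f (p.1.1, s.merge p.1.2 p.2) :=
        hf.comp ((measurable_fst.comp measurable_fst).prodMk (s.measurable_merge.comp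
          ((measurable_snd.comp measurable_fst).prodMk measurable_snd)))
      -- The first variable is to be integrated out, so its integral moves past the integral over
      -- the retained variables.
      rw [lintegral_lintegral_swap h3.lintegral_prod_right'.aemeasurable]
      exact lintegral_congr fun η =>
        (lintegral_stockEnv_cons t Y (hm.comp measurable_prodMk_left)).symm

theorem PCtx.marg_val {Γ Δ X Y : Ctx} (Υ : PCtx S Γ Δ) (s : Split Υ.rands X Y)
    (E : Tm S .tgt (Δ ++ Γ) .real) (η : Env X) (γ : Env Γ) :
    (Υ.marg s E).val (η.append γ) =
      ∫ θ, (E.val (Υ.env ((s.merge η θ).append γ)) : ℝ) ∂stockEnv Y := by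
  simp only [PCtx.marg, Tm.val]
  refine integral_congr_ae (ae_of_all _ fun θ => ?_)
  change Tm.val _ _ = _
  rw [Tm.val_rename _ (s.agrees_reorder γ η θ), Tm.val_subst _ (Υ.agrees_consts _)]

/-- A finite iterated integral has almost everywhere finite inner integrals. At such points the
section is integrable and both integrals agree; elsewhere the Bochner integral takes its default
`0`, but only on a null set. -/
theorem ofReal_integral_ae_eq {α β : Type*} [MeasurableSpace α] [MeasurableSpace β] {μ : Measure α}
    {ν : Measure β} [SFinite ν] {f : α × β → ℝ} (hf : Measurable f)
    (h0 : ∀ p, 0 ≤ f p) (h : ∫⁻ x, ∫⁻ y, ENNReal.ofReal (f (x, y)) ∂ν ∂μ ≠ ⊤) :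
    ∀ᵐ x ∂μ, ENNReal.ofReal (∫ y, f (x, y) ∂ν) = ∫⁻ y, ENNReal.ofReal (f (x, y)) ∂ν := by
  filter_upwards [ae_lt_top hf.ennreal_ofReal.lintegral_prod_right' h] with x hx
  refine ofReal_integral_eq_lintegral_ofReal ⟨?_, ?_⟩ (ae_of_all _ fun y => h0 _)
  · exact (hf.comp measurable_prodMk_left).aestronglyMeasurable
  · rw [hasFiniteIntegral_iff_ofReal (ae_of_all _ fun y => h0 _)]
    exact hx

theorem Env.measurable_append_right {Γ : Ctx} (Δ : Ctx) (γ : Env Γ) :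
    Measurable fun ρ : Env Δ => ρ.append γ :=
  (Env.measurable_append Δ).comp measurable_prodMk_right

/-- The weight that `E` gives to a valuation of the random variables. -/
noncomputable def PCtx.weight {Γ Δ : Ctx} (Υ : PCtx S Γ Δ) (E : Tm S .tgt (Δ ++ Γ) .real)
    (γ : Env Γ) (ρ : Env Υ.rands) : ENNReal :=
  ENNReal.ofReal (E.val (Υ.env (ρ.append γ)))

theorem PCtx.measurable_env_append {Γ Δ : Ctx} (Υ : PCtx S Γ Δ) (γ : Env Γ) :
    Measurable fun ρ : Env Υ.rands => Υ.env (ρ.append γ) :=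
  Υ.measurable_env.comp (Env.measurable_append_right _ γ)

theorem PCtx.measurable_weight {Γ Δ : Ctx} (Υ : PCtx S Γ Δ) (E : Tm S .tgt (Δ ++ Γ) .real)
    (γ : Env Γ) : Measurable (Υ.weight E γ) :=
  (E.measurable_val.comp (Υ.measurable_env_append γ)).ennreal_ofReal

/-- A factor depending only on the variables in `X` can be pulled out of the integral over the
complement, which leaves the marginal density. The mass bound ensures that the marginal is a proper
integral almost everywhere. -/
theorem PCtx.lintegral_marg {Γ Δ X Y : Ctx} (Υ : PCtx S Γ Δ) (s : Split Υ.rands X Y)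
    {E : Tm S .tgt (Δ ++ Γ) .real} (hE : ∀ σ, (0 : ℝ) ≤ E.val σ) (γ : Env Γ)
    (h : ∫⁻ ρ, Υ.weight E γ ρ ∂stockEnv Υ.rands ≤ 1) {f : Env Υ.rands → ENNReal}
    {g : Env X → ENNReal} (hf : Measurable f) (hfg : ∀ η θ, f (s.merge η θ) = g η) :
    ∫⁻ η, ENNReal.ofReal ((Υ.marg s E).val (η.append γ)) * g η ∂stockEnv X =
      ∫⁻ ρ, Υ.weight E γ ρ * f ρ ∂stockEnv Υ.rands := by
  have hm : Measurable fun p : Env X × Env Y =>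
      (E.val (Υ.env ((s.merge p.1 p.2).append γ)) : ℝ) :=
    E.measurable_val.comp ((Υ.measurable_env_append γ).comp s.measurable_merge)
  rw [s.lintegral_stockEnv (Υ.measurable_weight E γ)] at h
  have hae := ofReal_integral_ae_eq hm (fun p => hE _) (h.trans_lt ENNReal.one_lt_top).ne
  have hw : Measurable fun ρ => Υ.weight E γ ρ * f ρ := (Υ.measurable_weight E γ).mul hf
  rw [s.lintegral_stockEnv hw]
  refine lintegral_congr_ae (hae.mono fun η hη => ?_)
  simp only [hfg, Υ.marg_val s E η γ]
  rw [hη]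
  exact (lintegral_mul_const _ (hm.comp measurable_prodMk_left).ennreal_ofReal).symm

/-! ## Permutations of variables -/

/-- The valuation with the given values. -/
def Env.ofGet : {Γ : Ctx} → ((t : Ty) → Var Γ t → Val t) → Env Γ
  | [], _ => ()
  | t :: _, p => (p t .zero, Env.ofGet fun u x => p u (.succ x))

@[simp] theorem Env.get_ofGet : {Γ : Ctx} → (p : (t : Ty) → Var Γ t → Val t) → {t : Ty} →
    (x : Var Γ t) → (Env.ofGet p).get x = p t x
  | _ :: _, _, _, .zero => rfl
  | _ :: _, p, _, .succ x => Env.get_ofGet (fun u x => p u (.succ x)) x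

theorem Env.measurable_ofGet {α : Type*} [MeasurableSpace α] : {Γ : Ctx} →
    {p : α → (t : Ty) → Var Γ t → Val t} → (∀ t x, Measurable fun a => p a t x) →
    Measurable fun a => Env.ofGet (p a)
  | [], _, _ => measurable_const
  | t :: _, _, h => (h t .zero).prodMk (Env.measurable_ofGet fun u x => h u (.succ x))

/-- The variables of a type environment. -/
abbrev AnyVar (Γ : Ctx) : Type := Σ t, Var Γ t

def AnyVar.consEquiv (t : Ty) (Γ : Ctx) : AnyVar (t :: Γ) ≃ Option (AnyVar Γ) where
  toFun
    | ⟨_, .zero⟩ => none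
    | ⟨u, .succ x⟩ => some ⟨u, x⟩
  invFun
    | none => ⟨t, .zero⟩
    | some x => ⟨x.1, .succ x.2⟩
  left_inv
    | ⟨_, .zero⟩ => rfl
    | ⟨_, .succ _⟩ => rfl
  right_inv
    | none => rfl
    | some _ => rfl

instance AnyVar.isEmpty_nil : IsEmpty (AnyVar []) := ⟨fun x => nomatch x.2⟩

noncomputable instance AnyVar.fintype : (Γ : Ctx) → Fintype (AnyVar Γ)
  | [] => Fintype.ofIsEmpty
  | t :: Γ =>
    have := AnyVar.fintype Γ
    Fintype.ofEquiv _ (AnyVar.consEquiv t Γ).symm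

/-- The right-hand side is a product over a finite index type and so no longer depends on the order
of the variables. -/
theorem stockEnv_box : (Γ : Ctx) → (A : (i : AnyVar Γ) → Set (Val i.1)) →
    stockEnv Γ {σ | ∀ i : AnyVar Γ, σ.get i.2 ∈ A i} = ∏ i : AnyVar Γ, stock i.1 (A i)
  | [], A => by
    have : {σ : Env [] | ∀ i : AnyVar [], σ.get i.2 ∈ A i} = Set.univ :=
      Set.eq_univ_of_forall fun σ i => isEmptyElim i
    rw [this, Finset.univ_eq_empty, Finset.prod_empty]
    exact measure_univ (μ := Measure.dirac ())
  | t :: Γ, A => by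
    have h : {σ : Env (t :: Γ) | ∀ i : AnyVar (t :: Γ), σ.get i.2 ∈ A i} =
        A ⟨t, .zero⟩ ×ˢ {σ : Env Γ | ∀ i : AnyVar Γ, σ.get i.2 ∈ A ⟨i.1, .succ i.2⟩} := by
      ext ⟨v, σ⟩
      constructor
      · exact fun h => ⟨h ⟨t, .zero⟩, fun i => h ⟨i.1, .succ i.2⟩⟩
      · rintro ⟨h₁, h₂⟩ ⟨u, x⟩
        cases x with
        | zero => exact h₁
        | succ x => exact h₂ ⟨u, x⟩
    rw [h]
    change ((stock t).prod (stockEnv Γ)) _ = _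
    rw [Measure.prod_prod, stockEnv_box Γ fun i => A ⟨i.1, .succ i.2⟩,
      ← Equiv.prod_comp (AnyVar.consEquiv t Γ).symm, Fintype.prod_option]
    rfl

/-- A valuation of the variables of `Z` as a valuation of the variables of `X`, along a bijection. -/
def Env.reindex {X Z : Ctx} (e : (v : Ty) → Var X v ≃ Var Z v) (ζ : Env Z) : Env X :=
  Env.ofGet fun v x => ζ.get (e v x)

theorem Env.reindex_symm_reindex {X Z : Ctx} (e : (v : Ty) → Var X v ≃ Var Z v) (ζ : Env Z) :
    Env.reindex (fun v => (e v).symm) (Env.reindex e ζ) = ζ :=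
  Env.ext_get fun t x => by simp [Env.reindex]

theorem Env.measurable_reindex {X Z : Ctx} (e : (v : Ty) → Var X v ≃ Var Z v) :
    Measurable (Env.reindex e) :=
  Env.measurable_ofGet fun _ _ => Env.measurable_get _

/-- Both measures agree on boxes, which determine a product of σ-finite measures. -/
theorem stockEnv_map_get {X Z : Ctx} (e : (v : Ty) → Var X v ≃ Var Z v) :
    (stockEnv Z).map (fun ζ (i : AnyVar X) => ζ.get (e i.1 i.2)) =
      Measure.pi fun i : AnyVar X => stock i.1 := by
  have hm : Measurable fun (ζ : Env Z) (i : AnyVar X) => ζ.get (e i.1 i.2) :=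
    measurable_pi_lambda _ fun i => Env.measurable_get _
  refine (Measure.pi_eq fun A hA => ?_).symm
  rw [Measure.map_apply hm (MeasurableSet.univ_pi hA)]
  have h : (fun (ζ : Env Z) (i : AnyVar X) => ζ.get (e i.1 i.2)) ⁻¹' Set.univ.pi A =
      {ζ | ∀ j : AnyVar Z, ζ.get j.2 ∈ A ⟨j.1, (e j.1).symm j.2⟩} := by
    ext ζ
    simp only [Set.mem_preimage, Set.mem_pi, Set.mem_univ, true_implies, Set.mem_ofPred_eq]
    constructor
    · intro h j
      have := h ⟨j.1, (e j.1).symm j.2⟩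
      simpa using this
    · intro h i
      have := h ⟨i.1, e i.1 i.2⟩
      rwa [Equiv.symm_apply_apply] at this
  rw [h, stockEnv_box]
  exact Equiv.prod_comp (Equiv.sigmaCongrRight fun v => (e v).symm) fun i : AnyVar X => stock i.1 (A i)

/-- Both sides equal an integral over the order-free product measure indexed by the variables of
`X`. The tuple rule needs this, since a tuple may list its variables in any order whereas `Split`
keeps that of the context. -/
theorem lintegral_stockEnv_reindex {X Z : Ctx} (e : (v : Ty) → Var X v ≃ Var Z v)
    {f : Env X → ENNReal} (hf : Measurable f) :
    ∫⁻ η, f η ∂stockEnv X = ∫⁻ ζ, f (Env.reindex e ζ) ∂stockEnv Z := by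
  have hofGet : Measurable fun p : (i : AnyVar X) → Val i.1 =>
      f (Env.ofGet fun t x => p ⟨t, x⟩) :=
    hf.comp (Env.measurable_ofGet fun t x => measurable_pi_apply (⟨t, x⟩ : AnyVar X))
  have h {Z : Ctx} (e : (v : Ty) → Var X v ≃ Var Z v) :
      ∫⁻ ζ, f (Env.reindex e ζ) ∂stockEnv Z =
        ∫⁻ p, f (Env.ofGet fun t x => p ⟨t, x⟩) ∂Measure.pi fun i : AnyVar X => stock i.1 := by
    rw [← stockEnv_map_get e, lintegral_map hofGet
      (measurable_pi_lambda _ fun i => Env.measurable_get _)]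
    rfl
  rw [h e, ← h fun v => Equiv.refl _]
  refine lintegral_congr fun η => congrArg f (Env.ext_get fun t x => ?_)
  simp [Env.reindex]

/-! ## Tuples -/

def Env.toTuple : (t : Ty) → (ts : List Ty) → Env (t :: ts) → Val (tupTy t ts)
  | _, [], ζ => ζ.1
  | _, u :: us, ζ => (ζ.1, Env.toTuple u us ζ.2)

def Env.ofTuple : (t : Ty) → (ts : List Ty) → Val (tupTy t ts) → Env (t :: ts)
  | _, [], z => (z, ())
  | _, u :: us, z => (z.1, Env.ofTuple u us z.2)

theorem Env.toTuple_ofTuple : (t : Ty) → (ts : List Ty) → (z : Val (tupTy t ts)) →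
    Env.toTuple t ts (Env.ofTuple t ts z) = z
  | _, [], _ => rfl
  | _, u :: us, z => Prod.ext rfl (Env.toTuple_ofTuple u us z.2)

theorem Env.measurable_toTuple : (t : Ty) → (ts : List Ty) → Measurable (Env.toTuple t ts)
  | _, [] => measurable_fst
  | _, u :: us => measurable_fst.prodMk ((Env.measurable_toTuple u us).comp measurable_snd)

theorem Env.measurable_ofTuple : (t : Ty) → (ts : List Ty) → Measurable (Env.ofTuple t ts)
  | _, [] => measurable_id.prodMk measurable_const
  | _, u :: us => measurable_fst.prodMk ((Env.measurable_ofTuple u us).comp measurable_snd)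

theorem lintegral_stock_prod (t u : Ty) {f : Val t × Val u → ENNReal} (hf : Measurable f) :
    ∫⁻ z, f z ∂stock (.prod t u) = ∫⁻ x, ∫⁻ y, f (x, y) ∂stock u ∂stock t :=
  lintegral_prod _ hf.aemeasurable

theorem lintegral_stock_tupTy : (t : Ty) → (ts : List Ty) → {f : Env (t :: ts) → ENNReal} →
    Measurable f →
    ∫⁻ z, f (Env.ofTuple t ts z) ∂stock (tupTy t ts) = ∫⁻ ζ, f ζ ∂stockEnv (t :: ts)
  | t, [], _, hf => (lintegral_stockEnv_singleton t hf).symm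
  | t, u :: us, f, hf => by
    rw [lintegral_stockEnv_cons t (u :: us) hf]
    have hm : Measurable fun z : Val t × Val (tupTy u us) => f (z.1, Env.ofTuple u us z.2) :=
      hf.comp (measurable_fst.prodMk ((Env.measurable_ofTuple u us).comp measurable_snd))
    refine (lintegral_stock_prod t (tupTy u us) hm).trans (lintegral_congr fun x => ?_)
    exact lintegral_stock_tupTy u us (hf.comp measurable_prodMk_left)

theorem embed_tuple {Γ : Ctx} : (t : Ty) → (ts : List Ty) → (ξ : Ren (t :: ts) Γ) →
    (tuple (S := S) t ts ξ).embed = tuple (k := k) t ts ξ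
  | _, [], _ => rfl
  | _, u :: us, ξ => congrArg (Tm.pair _) (embed_tuple u us fun _ x => ξ _ (.succ x))

theorem val_tuple {Γ : Ctx} (σ : Env Γ) : (t : Ty) → (ts : List Ty) → (ξ : Ren (t :: ts) Γ) →
    (tuple (S := S) t ts ξ).val σ = Env.toTuple t ts (Env.ofGet fun _ x => σ.get (ξ _ x))
  | _, [], _ => rfl
  | _, u :: us, ξ => congrArg (Prod.mk _) (val_tuple σ u us fun _ x => ξ _ (.succ x))

/-- The valuation extended by the values of the variables `ts`. -/
def Env.bind : (ts : List Ty) → {Γ : Ctx} → Env ts → Env Γ → Env (bindAll ts Γ)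
  | [], _, _, σ => σ
  | _ :: ts, _, η, σ => Env.bind ts η.2 (η.1, σ)

theorem Env.get_bindOld : (ts : List Ty) → {Γ : Ctx} → (η : Env ts) → (σ : Env Γ) → {u : Ty} →
    (x : Var Γ u) → (Env.bind ts η σ).get (x.bindOld ts) = σ.get x
  | [], _, _, _, _, _ => rfl
  | t :: ts, Γ, η, σ, _, x => Env.get_bindOld ts (Γ := t :: Γ) η.2 (η.1, σ) x.succ

theorem Env.get_bindNew : (ts : List Ty) → {Γ : Ctx} → (η : Env ts) → (σ : Env Γ) → {u : Ty} →
    (x : Var ts u) → (Env.bind ts η σ).get (x.bindNew (Γ := Γ)) = η.get x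
  | t :: ts, Γ, η, σ, _, .zero => Env.get_bindOld ts (Γ := t :: Γ) η.2 (η.1, σ) .zero
  | t :: ts, Γ, η, σ, _, .succ x => Env.get_bindNew ts (Γ := t :: Γ) η.2 (η.1, σ) x

theorem Ren.Agrees.liftBind : (ts : List Ty) → {Γ Γ' : Ctx} → {ρ : Ren Γ Γ'} → {σ' : Env Γ'} →
    {σ : Env Γ} → ρ.Agrees σ' σ → (η : Env ts) →
    (Ren.liftBind ρ ts).Agrees (Env.bind ts η σ') (Env.bind ts η σ)
  | [], _, _, _, _, _, h, _ => h
  | _ :: ts, _, _, _, _, _, h, η => Ren.Agrees.liftBind ts (h.lift η.1) η.2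

theorem Ren.Agrees.join {Γ Θ : Ctx} {σ' : Env Θ} {γ : Env Γ} : {X : Ctx} → {f : Ren X Θ} →
    {g : Ren Γ Θ} → {η : Env X} → f.Agrees σ' η → g.Agrees σ' γ →
    (Ren.join f g).Agrees σ' (η.append γ)
  | [], _, _, _, _, hg => hg
  | _ :: X, f, _, η, hf, hg => fun _ x => match x with
    | .zero => hf _ .zero
    | .succ x => Ren.Agrees.join (X := X) (f := fun _ y => f _ (.succ y)) (η := η.2)
        (fun _ y => hf _ (.succ y)) hg _ x

theorem val_letTuple {u : Ty} : (t : Ty) → (ts : List Ty) → {Γ : Ctx} →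
    (V : Tm S .tgt Γ (tupTy t ts)) → (N : Tm S .tgt (bindAll (t :: ts) Γ) u) → (σ : Env Γ) →
    (letTuple t ts V N).val σ = N.val (Env.bind (t :: ts) (Env.ofTuple t ts (V.val σ)) σ)
  | _, [], _, _, _, _ => rfl
  | t, v :: vs, Γ, V, N, σ => by
    have ih := val_letTuple v vs (Γ := tupTy v vs :: t :: Γ) (.var .zero)
      (Tm.rename N (Ren.liftBind (Γ := t :: Γ) Ren.succ (v :: vs)))
      ((V.val σ).2, (V.val σ).1, σ)
    have hV : V.wk.val ((V.val σ).1, σ) = V.val σ := Tm.val_wk V _ σ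
    -- The second projection is taken of the weakened `V`, so only its value has to be exchanged
    -- before the recursive call applies.
    have h : (letTuple t (v :: vs) V N).val σ =
        (letTuple v vs (Γ := tupTy v vs :: t :: Γ) (.var .zero)
          (Tm.rename N (Ren.liftBind (Γ := t :: Γ) Ren.succ (v :: vs)))).val
          ((V.val σ).2, (V.val σ).1, σ) :=
      congrArg (fun w : Val (.prod t (tupTy v vs)) =>
        (letTuple v vs (Γ := tupTy v vs :: t :: Γ) (.var .zero)
          (Tm.rename N (Ren.liftBind (Γ := t :: Γ) Ren.succ (v :: vs)))).val
          (w.2, (V.val σ).1, σ)) hV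
    exact (h.trans ih).trans
      (Tm.val_rename N (Ren.Agrees.liftBind (v :: vs) (Ren.agrees_succ _ _) _))

/-! ## Admissible contexts -/

/-- The argument lies in the summand that `fromL` or `fromR` selects. -/
def Op.Guard {t u : Ty} : Op S t u → Val t → Prop
  | .fromL _ _, v => ∃ x, v = Sum.inl x
  | .fromR _ _, v => ∃ y, v = Sum.inr y
  | _, _ => True

theorem Op.guard_of_not_internal {t u : Ty} {f : Op S t u} (h : ¬ f.Internal) (v : Val t) :
    f.Guard v := by
  cases f with
  | fromL => exact absurd trivial h
  | fromR => exact absurd trivial h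
  | _ => trivial

/-- Selecting a summand by `fromL` or `fromR` at the head of the expression is legitimate. -/
def Tm.Guarded {Γ : Ctx} {t : Ty} (P : Tm S .pure Γ t) (σ : Env Γ) : Prop :=
  match P with
  | .op f M => f.Guard (M.embed.val σ)
  | _ => True

/-- A source expression, or an operation applied to a source expression. -/
def Tm.IsAlmostSource {Γ : Ctx} {t : Ty} (M : Tm S .src Γ t) : Prop :=
  match M with
  | .op _ M => M.IsSource
  | M => M.IsSource

theorem Tm.IsSource.isAlmostSource {Γ : Ctx} {t : Ty} {M : Tm S .src Γ t} (h : M.IsSource) :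
    M.IsAlmostSource := by
  cases M with
  | op f M => exact h.2
  | _ => exact h

theorem Tm.guarded_rename {Γ Γ' : Ctx} {t : Ty} (P : Tm S .pure Γ t) {ρ : Ren Γ Γ'} {σ' : Env Γ'}
    {σ : Env Γ} (h : ρ.Agrees σ' σ) (hP : P.Guarded σ) : (P.rename ρ).Guarded σ' := by
  cases P with
  | op f M => simpa only [Tm.rename, Tm.Guarded, Tm.embed_rename, Tm.val_rename _ h] using hP
  | random hk => cases hk
  | fail hk => cases hk
  | integral hk => cases hk
  | _ => trivial

/-- Only `fromL` and `fromR` have a nontrivial guard, and source expressions contain neither. -/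
theorem Tm.guarded_of_isSource {Γ : Ctx} {t : Ty} (P : Tm S .pure Γ t)
    (hP : (P.embed (k := .src)).IsSource) (σ : Env Γ) : P.Guarded σ := by
  cases P with
  | op f M => exact Op.guard_of_not_internal hP.1 _
  | random hk => cases hk
  | fail hk => cases hk
  | integral hk => cases hk
  | _ => trivial

theorem Tm.isAlmostSource_rename {Γ Γ' : Ctx} {t : Ty} (M : Tm S .src Γ t) (ρ : Ren Γ Γ') :
    (M.rename ρ).IsAlmostSource ↔ M.IsAlmostSource := by
  cases M with
  | op f M => exact M.isSource_rename ρ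
  | integral hk => cases hk
  | _ => exact Tm.isSource_rename _ ρ

/-- All definitions in `Υ` stem from source expressions or from matches, whose guards are part of
the factor `E`. -/
def PCtx.Admissible {Γ Δ : Ctx} (Υ : PCtx S Γ Δ) (E : Tm S .tgt (Δ ++ Γ) .real) : Prop :=
  ∀ (t : Ty) (x : Var (Δ ++ Γ) t) (P : Tm S .pure (Δ ++ Γ) t), Υ.Defines x P →
    (P.embed (k := .src)).IsAlmostSource ∧
      ∀ σ, (E.val (Υ.env σ) : ℝ) ≠ 0 → P.Guarded (Υ.env σ)

theorem PCtx.admissible_empty {Γ : Ctx} (E : Tm S .tgt Γ .real) :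
    PCtx.Admissible (Γ := Γ) (Δ := []) .empty E := fun _ _ _ h => nomatch h

/-- Guards are required only on the support of the factor, so they survive when the new factor has
smaller support. -/
theorem PCtx.Admissible.rnd {Γ Δ : Ctx} {Υ : PCtx S Γ Δ} {E : Tm S .tgt (Δ ++ Γ) .real}
    (h : Υ.Admissible E) {u : Ty} {E' : Tm S .tgt (u :: (Δ ++ Γ)) .real}
    (hE : ∀ v σ, (E'.val (v, σ) : ℝ) ≠ 0 → (E.val σ : ℝ) ≠ 0) :
    PCtx.Admissible (Δ := u :: Δ) (Υ.rnd u) E' := by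
  intro t x P hx
  cases hx with
  | rnd hx =>
    obtain ⟨h₁, h₂⟩ := h _ _ _ hx
    refine ⟨?_, fun σ hσ => Tm.guarded_rename _ (Ren.agrees_succ _ _) (h₂ σ.2 (hE _ _ hσ))⟩
    rw [Tm.wk, Tm.embed_rename]
    exact (Tm.isAlmostSource_rename _ _).2 h₁

theorem PCtx.Admissible.det {Γ Δ : Ctx} {Υ : PCtx S Γ Δ} {E : Tm S .tgt (Δ ++ Γ) .real}
    (h : Υ.Admissible E) {u : Ty} {Q : Tm S .pure (Δ ++ Γ) u}
    {E' : Tm S .tgt (u :: (Δ ++ Γ)) .real} (hQ : (Q.embed (k := .src)).IsAlmostSource)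
    (hE : ∀ v σ, (E'.val (v, σ) : ℝ) ≠ 0 → (E.val σ : ℝ) ≠ 0 ∧ Q.Guarded σ) :
    PCtx.Admissible (Δ := u :: Δ) (Υ.det Q) E' := by
  intro t x P hx
  cases hx with
  | here =>
    refine ⟨?_, fun σ hσ => Tm.guarded_rename _ (Ren.agrees_succ _ _) (hE _ _ hσ).2⟩
    rw [Tm.wk, Tm.embed_rename]
    exact (Tm.isAlmostSource_rename _ _).2 hQ
  | det hx =>
    obtain ⟨h₁, h₂⟩ := h _ _ _ hx
    refine ⟨?_, fun σ hσ => Tm.guarded_rename _ (Ren.agrees_succ _ _) (h₂ σ (hE _ _ hσ).1)⟩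
    rw [Tm.wk, Tm.embed_rename]
    exact (Tm.isAlmostSource_rename _ _).2 h₁

/-! ## Soundness of the rules -/

/-- `E` is the density of a family of sub-probability distributions of the random variables. -/
structure PCtx.IsSubprob {Γ Δ : Ctx} (Υ : PCtx S Γ Δ) (E : Tm S .tgt (Δ ++ Γ) .real) : Prop where
  nonneg : ∀ σ, (0 : ℝ) ≤ E.val σ
  le_one : ∀ γ, ∫⁻ ρ, Υ.weight E γ ρ ∂stockEnv Υ.rands ≤ 1

/-- `F` is a density of the distribution of `M`, where the random variables of `Υ` are distributed
with density `E`. -/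
structure IsDensity {Γ Δ : Ctx} (Υ : PCtx S Γ Δ) (E : Tm S .tgt (Δ ++ Γ) .real) {t : Ty}
    (M : Tm S .src (Δ ++ Γ) t) (F : Tm S .tgt (t :: Γ) .real) : Prop where
  nonneg : ∀ σ, (0 : ℝ) ≤ F.val σ
  lintegral_eq : ∀ (γ : Env Γ) (g : Val t → ENNReal), Measurable g →
    ∫⁻ z, ENNReal.ofReal (F.val (z, γ)) * g z ∂stock t =
      ∫⁻ ρ, Υ.weight E γ ρ * ∫⁻ z, g z ∂M.meas (Υ.env (ρ.append γ)) ∂stockEnv Υ.rands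

theorem Tm.measurable_ofReal_val {Γ : Ctx} {t : Ty} (F : Tm S .tgt (t :: Γ) .real) (γ : Env Γ) :
    Measurable fun z => ENNReal.ofReal (F.val (z, γ)) :=
  (F.measurable_val.comp measurable_prodMk_right).ennreal_ofReal

/-! ### Variables, constants, failure, and draws with a constant argument -/

section Rules

variable {Γ Δ : Ctx} {Υ : PCtx S Γ Δ} {E : Tm S .tgt (Δ ++ Γ) .real} {t u : Ty}

/-- The invariant for the test function `1`. It supplies the finiteness needed whenever `F` is
integrated again, and the mass bound when `F` is multiplied into a factor. -/
theorem IsDensity.lintegral_le_one {M : Tm S .src (Δ ++ Γ) t} {F : Tm S .tgt (t :: Γ) .real}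
    (h : IsDensity Υ E M F) (hE : Υ.IsSubprob E) (γ : Env Γ) :
    ∫⁻ z, ENNReal.ofReal (F.val (z, γ)) ∂stock t ≤ 1 := by
  have := h.lintegral_eq γ (fun _ => 1) measurable_const
  simp only [mul_one, lintegral_one] at this
  rw [this]
  refine le_trans (lintegral_mono fun ρ => ?_) (hE.le_one γ)
  exact (mul_le_mul_right (M.meas_univ_le_one _) _).trans (mul_one _).le

/-- A rule with one premise is sound if it transforms test functions appropriately. -/
theorem IsDensity.of_pullback {M : Tm S .src (Δ ++ Γ) t} {F : Tm S .tgt (t :: Γ) .real}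
    (h : IsDensity Υ E M F) {N : Tm S .src (Δ ++ Γ) u} {F' : Tm S .tgt (u :: Γ) .real}
    (h0 : ∀ σ, (0 : ℝ) ≤ F'.val σ)
    (H : ∀ (γ : Env Γ) (g : Val u → ENNReal), Measurable g → ∃ g' : Val t → ENNReal, Measurable g' ∧
      ∫⁻ z, ENNReal.ofReal (F'.val (z, γ)) * g z ∂stock u =
        ∫⁻ w, ENNReal.ofReal (F.val (w, γ)) * g' w ∂stock t ∧
      ∀ ρ : Env Υ.rands, Υ.weight E γ ρ ≠ 0 → ∫⁻ z, g z ∂N.meas (Υ.env (ρ.append γ)) =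
        ∫⁻ w, g' w ∂M.meas (Υ.env (ρ.append γ))) :
    IsDensity Υ E N F' := by
  refine ⟨h0, fun γ g hg => ?_⟩
  obtain ⟨g', hg', h₁, h₂⟩ := H γ g hg
  rw [h₁, h.lintegral_eq γ g' hg']
  refine lintegral_congr fun ρ => ?_
  -- Valuations of weight zero contribute nothing to either side; this is what allows the `fromL`
  -- and `fromR` rules to assume their guards.
  by_cases hρ : Υ.weight E γ ρ = 0
  · rw [hρ, zero_mul, zero_mul]
  · rw [h₂ ρ hρ]

theorem Tm.lintegral_meas_op (f : Op S t u) (M : Tm S .src Γ t) (σ : Env Γ) {g : Val u → ENNReal}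
    (hg : Measurable g) : ∫⁻ z, g z ∂(Tm.op f M).meas σ = ∫⁻ w, g (f.eval w) ∂M.meas σ :=
  Tm.lintegral_meas_bind_dirac σ M f.measurable_eval hg

theorem IsDensity.varDet {x : Var (Δ ++ Γ) t} {P : Tm S .pure (Δ ++ Γ) t}
    {F : Tm S .tgt (t :: Γ) .real} (hx : Υ.Defines x P) (h : IsDensity Υ E P.embed F) :
    IsDensity Υ E (.var x) F := by
  refine h.of_pullback h.nonneg fun γ g hg => ⟨g, hg, rfl, fun ρ _ => ?_⟩
  rw [P.meas_embed, ← hx.get_env]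
  rfl

theorem IsDensity.varRnd (hE : Υ.IsSubprob E) {Y : Ctx} (s : Split Υ.rands [t] Y) :
    IsDensity Υ E (.var (Υ.incl t (s.incl Γ t (.zero (Γ := Γ))))) (Υ.marg s E) := by
  refine ⟨fun σ => ?_, fun γ g hg => ?_⟩
  · exact integral_nonneg fun θ => (hE.nonneg _).trans_eq
      ((Tm.val_rename _ (s.agrees_reorder σ.2 (σ.1, ()) θ)).trans
        (Tm.val_subst _ (Υ.agrees_consts _))).symm
  · have hget : ∀ ρ : Env Υ.rands, (Υ.env (ρ.append γ)).get
        (Υ.incl t (s.incl Γ t (.zero (Γ := Γ)))) =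
        (ρ.append γ).get (s.incl Γ t (.zero (Γ := Γ))) := fun ρ => Υ.agrees_incl _ _ _
    have hm : Measurable fun ρ : Env Υ.rands =>
        g ((ρ.append γ).get (s.incl Γ t (.zero (Γ := Γ)))) :=
      hg.comp ((Env.measurable_get _).comp (Env.measurable_append_right _ γ))
    have key := Υ.lintegral_marg s hE.nonneg γ (hE.le_one γ) hm (g := fun η => g η.1)
      fun η θ => congrArg g (s.agrees_incl γ η θ t .zero)
    have hm' : Measurable fun η : Env [t] =>
        ENNReal.ofReal ((Υ.marg s E).val (η.append γ)) * g η.1 :=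
      (((Υ.marg s E).measurable_val.comp (Env.measurable_append_right [t] γ)).ennreal_ofReal).mul
        (hg.comp measurable_fst)
    rw [lintegral_stockEnv_singleton t hm'] at key
    refine key.trans (lintegral_congr fun ρ => ?_)
    rw [← hget]
    exact congrArg _ (lintegral_dirac' _ hg).symm

theorem PCtx.marg_nonneg (hE : Υ.IsSubprob E) {X Y : Ctx} (s : Split Υ.rands X Y) (η : Env X)
    (γ : Env Γ) : (0 : ℝ) ≤ (Υ.marg s E).val (η.append γ) := by
  rw [Υ.marg_val]
  exact integral_nonneg fun θ => hE.nonneg _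

theorem PCtx.ofReal_marg_none (hE : Υ.IsSubprob E) (γ : Env Γ) :
    ENNReal.ofReal ((Υ.marg (Split.none Υ.rands) E).val γ) =
      ∫⁻ ρ, Υ.weight E γ ρ ∂stockEnv Υ.rands := by
  have := Υ.lintegral_marg (Split.none Υ.rands) hE.nonneg γ (hE.le_one γ)
    (f := fun _ => 1) (g := fun _ => 1) measurable_const fun _ _ => rfl
  rw [lintegral_stockEnv_nil] at this
  simp only [mul_one] at this
  exact this

/-- If the result has a density independent of the random variables, these contribute only their
total mass, which is the marginal over the empty set. -/
theorem PCtx.lintegral_marg_none_mul (hE : Υ.IsSubprob E) (γ : Env Γ) {p : Val t → ℝ}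
    (hp : Measurable p) {g : Val t → ENNReal} (hg : Measurable g) :
    ∫⁻ z, ENNReal.ofReal ((Υ.marg (Split.none Υ.rands) E).val γ * p z : ℝ) * g z ∂stock t =
      ∫⁻ ρ, Υ.weight E γ ρ * ∫⁻ z, ENNReal.ofReal (p z) * g z ∂stock t ∂stockEnv Υ.rands := by
  have h0 : (0 : ℝ) ≤ (Υ.marg (Split.none Υ.rands) E).val γ := PCtx.marg_nonneg hE _ () γ
  have hm : Measurable fun z => ENNReal.ofReal (p z) * g z := hp.ennreal_ofReal.mul hg
  have h : ∀ z, ENNReal.ofReal ((Υ.marg (Split.none Υ.rands) E).val γ * p z : ℝ) * g z =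
      ENNReal.ofReal ((Υ.marg (Split.none Υ.rands) E).val γ) * (ENNReal.ofReal (p z) * g z) := by
    intro z
    rw [← mul_assoc]
    exact congrArg (· * g z) (ENNReal.ofReal_mul h0)
  rw [lintegral_congr h, lintegral_const_mul _ hm, lintegral_mul_const _ (Υ.measurable_weight E γ),
    PCtx.ofReal_marg_none hE γ]

theorem lintegral_stock_iverson (ht : t.Discrete) (V : Val t) (g : Val t → ENNReal) :
    ∫⁻ z, ENNReal.ofReal ((Op.iverson (S := S) t ht).eval (z, V)) * g z ∂stock t = g V := by
  have h : (fun z => ENNReal.ofReal ((Op.iverson (S := S) t ht).eval (z, V)) * g z) =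
      Set.indicator {V} fun _ => g V := by
    classical
    funext z
    by_cases hz : z = V
    · simp [Op.eval, hz]
    · simp [Op.eval, hz]
  rw [h, lintegral_indicator (measurableSet_singleton V), setLIntegral_const,
    stock_singleton t ht, mul_one]

theorem Tm.val_mul {Γ : Ctx} (E F : Tm S .tgt Γ .real) (σ : Env Γ) :
    (Tm.mul E F).val σ = (E.val σ * F.val σ : ℝ) := rfl

theorem Op.iverson_nonneg (ht : t.Discrete) (p : Val t × Val t) :
    (0 : ℝ) ≤ (Op.iverson (S := S) t ht).eval p := by
  simp only [Op.eval]
  split_ifs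
  · exact zero_le_one
  · exact le_rfl

theorem embed_quote {Γ : Ctx} : (t : Ty) → (v : Val t) →
    (quote (S := S) (Γ := Γ) t v).embed = quote (k := k) t v
  | .int, _ => rfl
  | .real, _ => rfl
  | .unit, _ => rfl
  | .prod t u, v => congrArg₂ Tm.pair (embed_quote t v.1) (embed_quote u v.2)
  | .sum t _, .inl x => congrArg Tm.inl (embed_quote t x)
  | .sum _ u, .inr y => congrArg Tm.inr (embed_quote u y)

theorem val_quote {Γ : Ctx} (σ : Env Γ) : (t : Ty) → (v : Val t) →
    (quote (S := S) t v).val σ = v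
  | .int, _ => rfl
  | .real, _ => rfl
  | .unit, _ => rfl
  | .prod t u, v => Prod.ext (val_quote σ t v.1) (val_quote σ u v.2)
  | .sum t _, .inl x => congrArg Sum.inl (val_quote σ t x)
  | .sum _ u, .inr y => congrArg Sum.inr (val_quote σ u y)

theorem IsDensity.constant (hE : Υ.IsSubprob E) (V : Val t) (ht : t.Discrete) :
    IsDensity Υ E (quote t V)
      (Tm.mul (Tm.wk (Γ := Γ) (Υ.marg (Split.none Υ.rands) E))
        (Tm.iverson ht Tm.v₀ (quote t V))) := by
  have hval : ∀ z γ, (Tm.mul (Tm.wk (Γ := Γ) (Υ.marg (Split.none Υ.rands) E))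
      (Tm.iverson ht Tm.v₀ (quote t V))).val (z, γ) =
      ((Υ.marg (Split.none Υ.rands) E).val γ * (Op.iverson (S := S) t ht).eval (z, V) : ℝ) := by
    intro z γ
    rw [Tm.val_mul]
    refine congrArg₂ (fun a b : ℝ => a * b) (Tm.val_wk (Γ := Γ) _ z γ) ?_
    exact congrArg (fun w => (Op.iverson (S := S) t ht).eval (z, w)) (val_quote _ t V)
  refine ⟨fun σ => ?_, fun γ g hg => ?_⟩
  · rw [hval σ.1 σ.2]
    exact mul_nonneg (PCtx.marg_nonneg hE _ () σ.2) (Op.iverson_nonneg ht _)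
  · simp only [hval]
    refine (PCtx.lintegral_marg_none_mul hE γ
      ((Op.iverson (S := S) t ht).measurable_eval.comp measurable_prodMk_right) hg).trans ?_
    refine lintegral_congr fun ρ => congrArg _ ?_
    rw [← embed_quote, Tm.lintegral_meas_embed _ _ hg, embed_quote, val_quote]
    exact lintegral_stock_iverson ht V g

theorem IsDensity.fail : IsDensity Υ E (.fail (t := t) rfl) (.real 0) := by
  refine ⟨fun σ => le_rfl, fun γ g hg => ?_⟩
  simp [Tm.val, Tm.meas]

theorem IsDensity.randomConst (hE : Υ.IsSubprob E) {a : Ty} {d : Dist S a t}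
    {M : Tm S .pure (Δ ++ Γ) a} {M' : Tm S .tgt Γ a}
    (hM : M'.rename (fun _ => Var.inR Υ.rands) = M.embed.subst Υ.consts) :
    IsDensity Υ E (.random rfl d M.embed)
      (Tm.mul (Tm.wk (Γ := Γ) (Υ.marg (Split.none Υ.rands) E)) (Tm.pdf d M'.wk Tm.v₀)) := by
  have hval : ∀ z γ, (Tm.mul (Tm.wk (Γ := Γ) (Υ.marg (Split.none Υ.rands) E))
      (Tm.pdf d M'.wk Tm.v₀)).val (z, γ) =
      ((Υ.marg (Split.none Υ.rands) E).val γ * d.pdf (M'.val γ) z : ℝ) := by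
    intro z γ
    rw [Tm.val_mul]
    exact congrArg₂ (fun a b : ℝ => a * b) (Tm.val_wk (Γ := Γ) _ z γ)
      (congrArg (fun w => d.pdf w z) (Tm.val_wk M' z γ))
  refine ⟨fun σ => ?_, fun γ g hg => ?_⟩
  · rw [hval σ.1 σ.2]
    exact mul_nonneg (PCtx.marg_nonneg hE _ () σ.2) (d.pdf_nonneg _ _)
  · simp only [hval]
    refine (PCtx.lintegral_marg_none_mul hE γ (d.measurable_pdf.comp measurable_prodMk_left)
      hg).trans ?_
    refine lintegral_congr fun ρ => congrArg _ ?_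
    have hm : Measurable fun v => ∫⁻ z, ENNReal.ofReal (d.pdf v z) * g z ∂stock t :=
      (d.measurable_pdf.ennreal_ofReal.mul (hg.comp measurable_snd)).lintegral_prod_right'
    rw [Tm.lintegral_meas_random _ d _ hg, Tm.lintegral_meas_embed _ _ hm,
      Υ.val_of_rename_inR_eq hM ρ γ]
    rfl

end Rules

/-- The mass bound on `G` alone justifies passing to the lower integral; `g` is constant in the
inner variable and may be arbitrary, even infinite. -/
theorem lintegral_ofReal_integral_mul {α β : Type*} [MeasurableSpace α] [MeasurableSpace β]
    {μ : Measure α} {ν : Measure β} [SFinite ν] {G : α × β → ℝ} (hG : Measurable G)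
    (h0 : ∀ p, 0 ≤ G p) (h : ∫⁻ x, ∫⁻ y, ENNReal.ofReal (G (x, y)) ∂ν ∂μ ≤ 1) (g : α → ENNReal) :
    ∫⁻ x, ENNReal.ofReal (∫ y, G (x, y) ∂ν) * g x ∂μ =
      ∫⁻ x, ∫⁻ y, ENNReal.ofReal (G (x, y)) * g x ∂ν ∂μ := by
  have hae := ofReal_integral_ae_eq (μ := μ) (ν := ν) hG h0 (h.trans_lt ENNReal.one_lt_top).ne
  refine lintegral_congr_ae (hae.mono fun x hx => ?_)
  simp only [hx]
  exact (lintegral_mul_const _ (hG.comp measurable_prodMk_left).ennreal_ofReal).symm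

theorem Tm.val_integral_singleton {Γ : Ctx} {u : Ty} (G : Tm S .tgt (u :: Γ) .real) (σ : Env Γ) :
    (Tm.integral (Γ := Γ) rfl [u] G).val σ = ∫ w, (G.val (w, σ) : ℝ) ∂stock u := by
  have hm : Measurable fun η : Val u × Unit => (G.val (η.1, σ) : ℝ) :=
    G.measurable_val.comp (measurable_fst.prodMk measurable_const)
  change ∫ η : Val u × Unit, (G.val (η.1, σ) : ℝ) ∂((stock u).prod (Measure.dirac ())) = _
  rw [Measure.prod_dirac, integral_map measurable_prodMk_right.aemeasurable hm.aestronglyMeasurable]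

theorem Tm.val_wk₁_wk₁ {Γ : Ctx} {s t u v : Ty} (M : Tm S .tgt (s :: Γ) t) (x : Val s)
    (y : Val u) (z : Val v) (σ : Env Γ) : M.wk₁.wk₁.val (x, y, z, σ) = M.val (x, σ) :=
  (Tm.val_wk₁ M.wk₁ x y (z, σ)).trans (Tm.val_wk₁ M x z σ)

/-! ### Draws with a random argument, projections, sums of two random reals, injections and
selections -/

section Rules

variable {Γ Δ : Ctx} {Υ : PCtx S Γ Δ} {E : Tm S .tgt (Δ ++ Γ) .real} {t u : Ty}

/-- A rule whose conclusion is a stock integral over one variable is sound if it transforms test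
functions appropriately. -/
theorem IsDensity.of_pullback_integral {M : Tm S .src (Δ ++ Γ) t} {F : Tm S .tgt (t :: Γ) .real}
    (h : IsDensity Υ E M F) (hE : Υ.IsSubprob E) {s : Ty} {N : Tm S .src (Δ ++ Γ) u}
    {G : Tm S .tgt (s :: u :: Γ) .real} (h0 : ∀ w z γ, (0 : ℝ) ≤ G.val (w, z, γ))
    (H : ∀ (γ : Env Γ) (g : Val u → ENNReal), Measurable g → ∃ g' : Val t → ENNReal, Measurable g' ∧
      ∫⁻ z, ∫⁻ w, ENNReal.ofReal (G.val (w, z, γ)) * g z ∂stock s ∂stock u =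
        ∫⁻ w, ENNReal.ofReal (F.val (w, γ)) * g' w ∂stock t ∧
      ((∀ z, g z ≤ 1) → ∀ w, g' w ≤ 1) ∧
      ∀ ρ : Env Υ.rands, Υ.weight E γ ρ ≠ 0 → ∫⁻ z, g z ∂N.meas (Υ.env (ρ.append γ)) =
        ∫⁻ w, g' w ∂M.meas (Υ.env (ρ.append γ))) :
    IsDensity Υ E N (.integral (Γ := u :: Γ) rfl [s] G) := by
  refine h.of_pullback (fun σ => integral_nonneg fun η => h0 _ _ _) fun γ g hg => ?_
  obtain ⟨g', hg', h₁, -, h₂⟩ := H γ g hg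
  refine ⟨g', hg', ?_, h₂⟩
  rw [← h₁]
  simp only [Tm.val_integral_singleton]
  refine lintegral_ofReal_integral_mul (G := fun p : Val u × Val s => (G.val (p.2, p.1, γ) : ℝ))
    (G.measurable_val.comp (by fun_prop)) (fun p => h0 _ _ _) ?_ g
  -- The pullback of `1` is at most `1`, so the double integral of `G` inherits the mass bound of
  -- `F`; this licenses the Bochner integral in the conclusion.
  obtain ⟨g₁, hg₁, e₁, e₂, -⟩ := H γ (fun _ => 1) measurable_const
  simp only [mul_one] at e₁
  rw [e₁]
  refine le_trans (lintegral_mono fun w => ?_) (h.lintegral_le_one hE γ)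
  exact (mul_le_mul_right (e₂ (fun _ => le_rfl) w) _).trans (mul_one _).le

theorem IsDensity.randomRnd (hE : Υ.IsSubprob E) {a : Ty} {d : Dist S a t}
    {M : Tm S .src (Δ ++ Γ) a} {F : Tm S .tgt (a :: Γ) .real} (h : IsDensity Υ E M F) :
    IsDensity Υ E (.random rfl d M)
      (.integral rfl [a] (Tm.mul F.wk₁ (Tm.pdf d Tm.v₀ Tm.v₁))) := by
  have hval : ∀ w z γ, (Tm.mul (F.wk₁ (u := t)) (Tm.pdf d Tm.v₀ Tm.v₁)).val (w, z, γ) =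
      (F.val (w, γ) * d.pdf w z : ℝ) := fun w z γ =>
    congrArg (fun b : ℝ => b * d.pdf w z) (Tm.val_wk₁ F w z γ)
  refine h.of_pullback_integral hE (fun w z γ => ?_) fun γ g hg => ?_
  · rw [hval]
    exact mul_nonneg (h.nonneg _) (d.pdf_nonneg _ _)
  · have hm : Measurable fun v => ∫⁻ z, ENNReal.ofReal (d.pdf v z) * g z ∂stock t :=
      (d.measurable_pdf.ennreal_ofReal.mul (hg.comp measurable_snd)).lintegral_prod_right'
    -- The pulled-back test function sends `v` to the mean of `g` under the distribution with
    -- argument `v`.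
    refine ⟨_, hm, ?_, fun hg1 v => ?_, fun ρ _ => Tm.lintegral_meas_random _ d M hg⟩
    · simp only [hval]
      have hm2 : Measurable fun p : Val t × Val a =>
          ENNReal.ofReal (F.val (p.2, γ) * d.pdf p.2 p.1) * g p.1 :=
        (((F.measurable_val.comp (measurable_snd.prodMk measurable_const)).mul
          (d.measurable_pdf.comp measurable_swap)).ennreal_ofReal).mul (hg.comp measurable_fst)
      rw [lintegral_lintegral_swap hm2.aemeasurable]
      refine lintegral_congr fun w => ?_
      have hm3 : Measurable fun z => ENNReal.ofReal (d.pdf w z) * g z :=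
        (d.measurable_pdf.comp measurable_prodMk_left).ennreal_ofReal.mul hg
      rw [← lintegral_const_mul _ hm3]
      refine lintegral_congr fun z => ?_
      rw [ENNReal.ofReal_mul (h.nonneg _), mul_assoc]
    · rw [← d.lintegral_law v hg]
      exact (lintegral_mono hg1).trans (by simpa using d.law_univ_le_one v)

theorem IsDensity.fst (hE : Υ.IsSubprob E) {M : Tm S .src (Δ ++ Γ) (.prod t u)}
    {F : Tm S .tgt (.prod t u :: Γ) .real} (h : IsDensity Υ E M F) :
    IsDensity Υ E (.fst M) (.integral rfl [u] (.letE (.pair Tm.v₁ Tm.v₀) F.wk₁.wk₁)) := by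
  have hval : ∀ w z γ, (Tm.letE (.pair Tm.v₁ Tm.v₀) (F.wk₁ (u := t)).wk₁).val (w, z, γ) =
      F.val ((z, w), γ) := fun w z γ =>
    Tm.val_wk₁_wk₁ F (z, w) w z γ
  refine h.of_pullback_integral hE (fun w z γ => (h.nonneg _).trans_eq (hval w z γ).symm)
    fun γ g hg => ⟨fun p => g p.1, hg.comp measurable_fst, ?_, fun hg1 w => hg1 w.1,
      fun ρ _ => Tm.lintegral_meas_bind_dirac _ M measurable_fst hg⟩
  simp only [hval]
  exact (lintegral_stock_prod t u ((F.measurable_ofReal_val γ).mul (hg.comp measurable_fst))).symm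

theorem IsDensity.snd (hE : Υ.IsSubprob E) {M : Tm S .src (Δ ++ Γ) (.prod t u)}
    {F : Tm S .tgt (.prod t u :: Γ) .real} (h : IsDensity Υ E M F) :
    IsDensity Υ E (.snd M) (.integral rfl [t] (.letE (.pair Tm.v₀ Tm.v₁) F.wk₁.wk₁)) := by
  have hval : ∀ w z γ, (Tm.letE (.pair Tm.v₀ Tm.v₁) (F.wk₁ (u := u)).wk₁).val (w, z, γ) =
      F.val ((w, z), γ) := fun w z γ =>
    Tm.val_wk₁_wk₁ F (w, z) w z γ
  refine h.of_pullback_integral hE (fun w z γ => (h.nonneg _).trans_eq (hval w z γ).symm)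
    fun γ g hg => ⟨fun p => g p.2, hg.comp measurable_snd, ?_, fun hg1 w => hg1 w.2,
      fun ρ _ => Tm.lintegral_meas_bind_dirac _ M measurable_snd hg⟩
  simp only [hval]
  have hm : Measurable fun p : Val t × Val u => ENNReal.ofReal (F.val (p, γ)) * g p.2 :=
    (F.measurable_ofReal_val γ).mul (hg.comp measurable_snd)
  exact (lintegral_lintegral_swap (f := fun (y : Val u) (x : Val t) =>
    ENNReal.ofReal (F.val ((x, y), γ)) * g y) (hm.comp measurable_swap).aemeasurable).trans
    (lintegral_stock_prod t u hm).symm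

/-- The joint density of the two summands is integrated along the lines of constant sum; for fixed
`w`, translation invariance replaces `z - w` by a free variable. -/
theorem IsDensity.plusRnd (hE : Υ.IsSubprob E) {M N : Tm S .src (Δ ++ Γ) .real}
    {F : Tm S .tgt (.prod .real .real :: Γ) .real} (h : IsDensity Υ E (.pair M N) F) :
    IsDensity Υ E (Tm.add M N)
      (.integral rfl [.real] (.letE (.pair Tm.v₀ (Tm.sub Tm.v₁ Tm.v₀)) F.wk₁.wk₁)) := by
  have hval : ∀ (w z : ℝ) (γ : Env Γ),
      (Tm.letE (.pair Tm.v₀ (Tm.sub Tm.v₁ Tm.v₀)) (F.wk₁ (u := .real)).wk₁).val (w, z, γ) =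
      F.val ((w, z - w), γ) := fun w z γ =>
    Tm.val_wk₁_wk₁ (u := .real) (v := .real) F (w, z - w) w z γ
  refine h.of_pullback_integral hE (fun w z γ => (h.nonneg _).trans_eq (hval w z γ).symm)
    fun γ g hg => ⟨fun p : ℝ × ℝ => g (p.1 + p.2 : ℝ), hg.comp measurable_add, ?_,
      fun hg1 w => hg1 _, fun ρ _ => Tm.lintegral_meas_op .realAdd _ _ hg⟩
  have hm : Measurable fun p : ℝ × ℝ => ENNReal.ofReal (F.val (p, γ)) * g (p.1 + p.2 : ℝ) :=
    (F.measurable_ofReal_val γ).mul (hg.comp measurable_add)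
  have hm2 : Measurable fun p : ℝ × ℝ => ENNReal.ofReal (F.val ((p.2, p.1 - p.2), γ)) * g p.1 :=
    ((F.measurable_ofReal_val γ).comp (by fun_prop)).mul (hg.comp measurable_fst)
  trans ∫⁻ z : ℝ, ∫⁻ w : ℝ, ENNReal.ofReal (F.val ((w, z - w), γ)) * g z
  · exact lintegral_congr fun z => lintegral_congr fun w =>
      congrArg (fun r : ℝ => ENNReal.ofReal r * g z) (hval w z γ)
  rw [lintegral_lintegral_swap hm2.aemeasurable]
  refine Eq.trans (lintegral_congr fun w => ?_) (lintegral_stock_prod .real .real hm).symm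
  have := lintegral_sub_right_eq_self (μ := (volume : Measure ℝ))
    (fun y => ENNReal.ofReal (F.val ((w, y), γ)) * g (w + y : ℝ)) w
  refine Eq.trans (lintegral_congr fun z => ?_) this
  rw [add_sub_cancel]

theorem IsDensity.inl {M : Tm S .src (Δ ++ Γ) t} {F : Tm S .tgt (t :: Γ) .real}
    (h : IsDensity Υ E M F) :
    IsDensity Υ E (.inl (u := u) M) (.cases Tm.v₀ F.wk₁ (.real 0)) := by
  have hval : ∀ (z : Val t ⊕ Val u) γ,
      (Tm.cases (Tm.v₀ (t := .sum t u)) F.wk₁ (.real 0)).val (z, γ) =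
      Sum.elim (fun x => (F.val (x, γ) : ℝ)) (fun _ => 0) z := by
    rintro (x | y) γ
    · exact Tm.val_wk₁ F x _ γ
    · rfl
  refine h.of_pullback (fun σ => ?_) fun γ g hg => ⟨fun x => g (.inl x), hg.comp measurable_inl, ?_,
    fun ρ _ => Tm.lintegral_meas_bind_dirac _ M measurable_inl hg⟩
  · obtain ⟨x | y, γ⟩ := σ
    · exact (h.nonneg _).trans_eq (hval (.inl x) γ).symm
    · exact le_rfl
  · simp only [hval]
    refine (lintegral_stock_sum t u _).trans ?_
    simp

theorem IsDensity.inr {M : Tm S .src (Δ ++ Γ) u} {F : Tm S .tgt (u :: Γ) .real}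
    (h : IsDensity Υ E M F) :
    IsDensity Υ E (.inr (t := t) M) (.cases Tm.v₀ (.real 0) F.wk₁) := by
  have hval : ∀ (z : Val t ⊕ Val u) γ,
      (Tm.cases (Tm.v₀ (t := .sum t u)) (.real 0) F.wk₁).val (z, γ) =
      Sum.elim (fun _ => 0) (fun y => (F.val (y, γ) : ℝ)) z := by
    rintro (x | y) γ
    · rfl
    · exact Tm.val_wk₁ F y _ γ
  refine h.of_pullback (fun σ => ?_) fun γ g hg => ⟨fun x => g (.inr x), hg.comp measurable_inr, ?_,
    fun ρ _ => Tm.lintegral_meas_bind_dirac _ M measurable_inr hg⟩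
  · obtain ⟨x | y, γ⟩ := σ
    · exact le_rfl
    · exact (h.nonneg _).trans_eq (hval (.inr y) γ).symm
  · simp only [hval]
    refine (lintegral_stock_sum t u _).trans ?_
    simp

theorem PCtx.val_ne_zero_of_weight_ne_zero {γ : Env Γ} {ρ : Env Υ.rands} (h : Υ.weight E γ ρ ≠ 0) :
    (E.val (Υ.env (ρ.append γ)) : ℝ) ≠ 0 := fun h0 => h (by rw [PCtx.weight, h0, ENNReal.ofReal_zero])

/-- The pulled-back test function is `0` on the right summand, whereas `g ∘ fromL` takes the value
of `g` at the default there. Admissibility shows that the argument is a left injection wherever `E`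
is nonzero, so the difference is invisible. -/
theorem IsDensity.fromL (hA : Υ.Admissible E) {x : Var (Δ ++ Γ) t}
    {M : Tm S .pure (Δ ++ Γ) (.sum t u)} {F : Tm S .tgt (.sum t u :: Γ) .real}
    (hx : Υ.Defines x (.op (.fromL t u) M)) (h : IsDensity Υ E M.embed F) :
    IsDensity Υ E (.op (.fromL t u) M.embed) (.letE (.inl Tm.v₀) F.wk₁) := by
  have hval : ∀ z γ, (Tm.letE (.inl Tm.v₀) F.wk₁).val (z, γ) = F.val (Sum.inl z, γ) :=
    fun z γ => Tm.val_wk₁ F (Sum.inl z) z γ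
  refine h.of_pullback (fun σ => (h.nonneg _).trans_eq (hval σ.1 σ.2).symm) fun γ g hg =>
    ⟨Sum.elim g fun _ => 0, hg.sumElim measurable_const, ?_, fun ρ hρ => ?_⟩
  · simp only [hval]
    refine Eq.trans ?_ (lintegral_stock_sum t u _).symm
    simp
  · obtain ⟨v, hv⟩ := (hA _ _ _ hx).2 _ (PCtx.val_ne_zero_of_weight_ne_zero hρ)
    have hm : Measurable fun w => g ((Op.fromL (S := S) t u).eval w) :=
      hg.comp (Op.measurable_eval (.fromL t u))
    rw [Tm.lintegral_meas_op _ _ _ hg, Tm.lintegral_meas_embed _ _ hm,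
      Tm.lintegral_meas_embed _ _ (hg.sumElim measurable_const), hv]
    rfl

theorem IsDensity.fromR (hA : Υ.Admissible E) {x : Var (Δ ++ Γ) u}
    {M : Tm S .pure (Δ ++ Γ) (.sum t u)} {F : Tm S .tgt (.sum t u :: Γ) .real}
    (hx : Υ.Defines x (.op (.fromR t u) M)) (h : IsDensity Υ E M.embed F) :
    IsDensity Υ E (.op (.fromR t u) M.embed) (.letE (.inr Tm.v₀) F.wk₁) := by
  have hval : ∀ z γ, (Tm.letE (.inr Tm.v₀) F.wk₁).val (z, γ) = F.val (Sum.inr z, γ) :=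
    fun z γ => Tm.val_wk₁ F (Sum.inr z) z γ
  refine h.of_pullback (fun σ => (h.nonneg _).trans_eq (hval σ.1 σ.2).symm) fun γ g hg =>
    ⟨Sum.elim (fun _ => 0) g, measurable_const.sumElim hg, ?_, fun ρ hρ => ?_⟩
  · simp only [hval]
    refine Eq.trans ?_ (lintegral_stock_sum t u _).symm
    simp
  · obtain ⟨v, hv⟩ := (hA _ _ _ hx).2 _ (PCtx.val_ne_zero_of_weight_ne_zero hρ)
    have hm : Measurable fun w => g ((Op.fromR (S := S) t u).eval w) :=
      hg.comp (Op.measurable_eval (.fromR t u))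
    rw [Tm.lintegral_meas_op _ _ _ hg, Tm.lintegral_meas_embed _ _ hm,
      Tm.lintegral_meas_embed _ _ (measurable_const.sumElim hg), hv]
    rfl

end Rules

/-! ## Changes of variables -/

section ChangeOfVariables

variable {f : ℝ → ℝ} (g : ℝ → ENNReal)

theorem lintegral_density_inverse :
    ∫⁻ z, ENNReal.ofReal (f (1 / z) * (1 / (z * z))) * g z =
      ∫⁻ w, ENNReal.ofReal (f w) * g (1 / w) := by
  have himage : (fun z : ℝ => 1 / z) '' {0}ᶜ = {0}ᶜ := by
    ext w
    simp only [Set.mem_image, Set.mem_compl_iff, Set.mem_singleton_iff]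
    constructor
    · rintro ⟨z, hz, rfl⟩
      exact one_div_ne_zero hz
    · exact fun hw => ⟨1 / w, one_div_ne_zero hw, one_div_one_div w⟩
  have key := lintegral_image_eq_lintegral_abs_deriv_mul (s := ({0}ᶜ : Set ℝ))
    (f := fun z => 1 / z) (f' := fun z => -(z ^ 2)⁻¹) (measurableSet_singleton 0).compl
    (fun z hz => by simpa only [one_div] using (hasDerivAt_inv hz).hasDerivWithinAt)
    (fun x _ y _ h => by simpa using h) (fun w => ENNReal.ofReal (f w) * g (1 / w))
  -- Reciprocals are injective and differentiable away from `0`, and the excluded point is null.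
  rw [himage, restrict_compl_singleton] at key
  rw [key]
  refine lintegral_congr fun z => ?_
  rw [abs_neg, abs_of_nonneg (by positivity : 0 ≤ (z ^ 2)⁻¹), one_div_one_div, ← mul_assoc,
    ← ENNReal.ofReal_mul (by positivity), mul_comm (f _), one_div (z * z), pow_two]

/-- Substitution `w = log z`, a bijection from the positive reals onto all reals. -/
theorem lintegral_density_exp :
    ∫⁻ z, ENNReal.ofReal (if 0 < z then f (Real.log z) * (1 / z) else 0) * g z =
      ∫⁻ w, ENNReal.ofReal (f w) * g (Real.exp w) := by
  have himage : Real.log '' Set.Ioi 0 = Set.univ :=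
    Set.eq_univ_of_forall fun w => ⟨Real.exp w, Real.exp_pos w, Real.log_exp w⟩
  have key := lintegral_image_eq_lintegral_abs_deriv_mul (s := Set.Ioi (0 : ℝ))
    (f := Real.log) (f' := fun z => z⁻¹) measurableSet_Ioi
    (fun z hz => (Real.hasDerivAt_log (ne_of_gt hz)).hasDerivWithinAt)
    Real.log_injOn_pos (fun w => ENNReal.ofReal (f w) * g (Real.exp w))
  rw [himage, setLIntegral_univ, ← lintegral_indicator measurableSet_Ioi] at key
  rw [key]
  refine lintegral_congr fun z => ?_
  by_cases hz : 0 < z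
  · rw [Set.indicator_of_mem (Set.mem_Ioi.2 hz), if_pos hz, abs_of_pos (inv_pos.2 hz),
      Real.exp_log hz, ← mul_assoc, ← ENNReal.ofReal_mul (inv_pos.2 hz).le, mul_comm (f _), one_div]
  · rw [Set.indicator_of_notMem (by simpa using hz), if_neg hz, ENNReal.ofReal_zero, zero_mul]

/-- Mass on the negative reals would be sent to an atom at `0`, the default value of the logarithm,
and could have no density; hence `h0`. -/
theorem lintegral_density_log (h0 : ∀ w < 0, f w = 0) :
    ∫⁻ z, ENNReal.ofReal (f (Real.exp z) * Real.exp z) * g z =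
      ∫⁻ w, ENNReal.ofReal (f w) * g (if 0 < w then Real.log w else 0) := by
  have himage : Real.exp '' Set.univ = Set.Ioi 0 := by rw [Set.image_univ, Real.range_exp]
  have key := lintegral_image_eq_lintegral_abs_deriv_mul (s := Set.univ)
    (f := Real.exp) (f' := Real.exp) MeasurableSet.univ
    (fun z _ => (Real.hasDerivAt_exp z).hasDerivWithinAt)
    Real.exp_injective.injOn
    (fun w => ENNReal.ofReal (f w) * g (if 0 < w then Real.log w else 0))
  -- Adding the null point `0` to the range leaves just the negative reals outside, exactly where
  -- `h0` applies.
  rw [himage, setLIntegral_univ, setLIntegral_congr Ioi_ae_eq_Ici,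
    ← lintegral_indicator measurableSet_Ici] at key
  have hind : (Set.Ici (0 : ℝ)).indicator
      (fun w => ENNReal.ofReal (f w) * g (if 0 < w then Real.log w else 0)) =
      fun w => ENNReal.ofReal (f w) * g (if 0 < w then Real.log w else 0) := by
    funext w
    by_cases hw : 0 ≤ w
    · exact Set.indicator_of_mem hw _
    · rw [Set.indicator_of_notMem (Set.mem_Ici.not.2 hw), h0 w (not_le.1 hw), ENNReal.ofReal_zero, zero_mul]
  rw [hind] at key
  rw [key]
  refine lintegral_congr fun z => ?_
  rw [if_pos (Real.exp_pos z), Real.log_exp, Real.abs_exp, ← mul_assoc,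
    ← ENNReal.ofReal_mul (Real.exp_pos z).le, mul_comm (f _)]

theorem lintegral_density_scale {c : ℝ} (hc : c ≠ 0) :
    ∫⁻ z, ENNReal.ofReal (f (z / c) * (1 / |c|)) * g z =
      ∫⁻ w, ENNReal.ofReal (f w) * g (c * w) := by
  have himage : (fun z : ℝ => z / c) '' Set.univ = Set.univ :=
    Set.eq_univ_of_forall fun w => ⟨w * c, trivial, mul_div_cancel_right₀ w hc⟩
  have key := lintegral_image_eq_lintegral_abs_deriv_mul (s := Set.univ)
    (f := fun z => z / c) (f' := fun _ => 1 / c) MeasurableSet.univ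
    (fun z _ => ((hasDerivAt_id z).div_const c).hasDerivWithinAt)
    (fun x _ y _ h => (div_left_inj' hc).1 h) (fun w => ENNReal.ofReal (f w) * g (c * w))
  rw [himage, setLIntegral_univ, setLIntegral_univ] at key
  rw [key]
  refine lintegral_congr fun z => ?_
  rw [mul_div_cancel₀ z hc, ← mul_assoc, ← ENNReal.ofReal_mul (abs_nonneg _), abs_div, abs_one,
    mul_comm (f _)]

theorem lintegral_density_shift (c : ℝ) :
    ∫⁻ z, ENNReal.ofReal (f (z - c)) * g z = ∫⁻ w, ENNReal.ofReal (f w) * g (w + c) := by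
  rw [← lintegral_sub_right_eq_self (fun w => ENNReal.ofReal (f w) * g (w + c)) c]
  simp only [sub_add_cancel]

end ChangeOfVariables

/-! ### Rules for real arithmetic -/

section Rules

variable {Γ Δ : Ctx} {Υ : PCtx S Γ Δ} {E : Tm S .tgt (Δ ++ Γ) .real}

theorem Tm.lintegral_meas_op_pair_left {Γ : Ctx} {s t u : Ty} (f : Op S (.prod s t) u)
    (P : Tm S .pure Γ s) (M : Tm S .src Γ t) (σ : Env Γ) {g : Val u → ENNReal} (hg : Measurable g) :
    ∫⁻ z, g z ∂(Tm.op f (.pair P.embed M)).meas σ =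
      ∫⁻ w, g (f.eval (P.embed.val σ, w)) ∂M.meas σ := by
  have h : Measurable fun p : Val s × Val t => g (f.eval p) := hg.comp f.measurable_eval
  have h' : Measurable fun v => ∫⁻ w, g (f.eval (v, w)) ∂M.meas σ := h.lintegral_prod_right'
  rw [Tm.lintegral_meas_op f _ σ hg, Tm.lintegral_meas_pair σ _ _ h, P.lintegral_meas_embed σ h']

theorem Tm.lintegral_meas_op_pair_right {Γ : Ctx} {s t u : Ty} (f : Op S (.prod s t) u)
    (M : Tm S .src Γ s) (P : Tm S .pure Γ t) (σ : Env Γ) {g : Val u → ENNReal} (hg : Measurable g) :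
    ∫⁻ z, g z ∂(Tm.op f (.pair M P.embed)).meas σ =
      ∫⁻ w, g (f.eval (w, P.embed.val σ)) ∂M.meas σ := by
  have h : Measurable fun p : Val s × Val t => g (f.eval p) := hg.comp f.measurable_eval
  rw [Tm.lintegral_meas_op f _ σ hg, Tm.lintegral_meas_pair σ _ _ h]
  exact lintegral_congr fun w => P.lintegral_meas_embed σ (h.comp measurable_prodMk_left)

variable {M : Tm S .src (Δ ++ Γ) .real} {F : Tm S .tgt (.real :: Γ) .real}

theorem IsDensity.inverse (h : IsDensity Υ E M F) :
    IsDensity Υ E (Tm.div (.real 1) M)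
      (Tm.mul (.letE (Tm.div (.real 1) Tm.v₀) F.wk₁) (Tm.div (.real 1) (Tm.mul Tm.v₀ Tm.v₀))) := by
  have hval : ∀ (z : ℝ) (γ : Env Γ), (Tm.mul (.letE (Tm.div (.real 1) Tm.v₀) F.wk₁)
      (Tm.div (.real 1) (Tm.mul Tm.v₀ Tm.v₀))).val (z, γ) =
      (F.val ((1 / z : ℝ), γ) * (1 / (z * z)) : ℝ) := fun z γ =>
    congrArg (fun r : ℝ => r * (1 / (z * z))) (Tm.val_wk₁ (u := .real) F (1 / z : ℝ) z γ)
  refine h.of_pullback (fun σ => ?_) fun γ g hg => ⟨fun w : ℝ => g (1 / w : ℝ),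
    hg.comp (measurable_const.div measurable_id : Measurable fun w : ℝ => 1 / w), ?_,
    fun ρ _ => Tm.lintegral_meas_op_pair_left .realDiv (.real 1) M _ hg⟩
  · exact (mul_nonneg (h.nonneg _) (one_div_nonneg.2 (mul_self_nonneg _))).trans_eq
      (hval σ.1 σ.2).symm
  · refine Eq.trans (lintegral_congr fun z => ?_)
      (lintegral_density_inverse (f := fun w => F.val (w, γ)) g)
    rw [hval z γ]

theorem IsDensity.exp (h : IsDensity Υ E M F) :
    IsDensity Υ E (.op .exp M)
      (Tm.ifLt (.real 0) Tm.v₀ (Tm.mul (.letE (.op .log Tm.v₀) F.wk₁) (Tm.div (.real 1) Tm.v₀))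
        (.real 0)) := by
  have hval : ∀ (z : ℝ) (γ : Env Γ), (Tm.ifLt (.real 0) Tm.v₀
      (Tm.mul (.letE (.op .log Tm.v₀) F.wk₁) (Tm.div (.real 1) Tm.v₀)) (.real 0)).val (z, γ) =
      (if 0 < z then F.val (Real.log z, γ) * (1 / z) else 0 : ℝ) := by
    intro z γ
    have h1 : ∀ x : Unit, (Tm.wk (u := .unit) (Tm.mul (.letE (.op .log Tm.v₀) F.wk₁)
        (Tm.div (.real 1) Tm.v₀))).val (x, z, γ) =
        (F.val ((if 0 < z then Real.log z else 0 : ℝ), γ) * (1 / z) : ℝ) := fun x =>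
      (Tm.val_wk (u := .unit) (Tm.mul (.letE (.op .log Tm.v₀) F.wk₁) (Tm.div (.real 1) Tm.v₀)) x
        ((z, γ) : Env (.real :: Γ))).trans (congrArg (fun r : ℝ => r * (1 / z))
        (Tm.val_wk₁ (u := .real) F (if 0 < z then Real.log z else 0 : ℝ) z γ))
    refine Eq.trans (b := Sum.elim (fun x : Unit => (Tm.wk (u := .unit)
      (Tm.mul (.letE (.op .log Tm.v₀) F.wk₁) (Tm.div (.real 1) Tm.v₀))).val (x, z, γ))
      (fun _ : Unit => (0 : ℝ)) (Val.ofProp (0 < z))) rfl ?_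
    by_cases hz : 0 < z
    · rw [Val.ofProp, if_pos hz, if_pos hz]
      refine (h1 ()).trans ?_
      rw [if_pos hz]
    · rw [Val.ofProp, if_neg hz, if_neg hz]
      rfl
  refine h.of_pullback (fun σ => ?_) fun γ g hg => ⟨fun w : ℝ => g (Real.exp w),
    hg.comp Real.measurable_exp, ?_, fun ρ _ => Tm.lintegral_meas_op .exp M _ hg⟩
  · refine le_of_le_of_eq ?_ (hval σ.1 σ.2).symm
    split_ifs with hz
    · exact mul_nonneg (h.nonneg _) (one_div_pos.2 hz).le
    · exact le_rfl
  · refine Eq.trans (lintegral_congr fun z => ?_)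
      (lintegral_density_exp (f := fun w => F.val (w, γ)) g)
    rw [hval z γ]

theorem IsDensity.log (h : IsDensity Υ E M F)
    (h0 : ∀ (σ : Env Γ) (r : ℝ), r < 0 → (F.val (r, σ) : ℝ) = 0) :
    IsDensity Υ E (.op .log M) (Tm.mul (.letE (.op .exp Tm.v₀) F.wk₁) (.op .exp Tm.v₀)) := by
  have hval : ∀ (z : ℝ) (γ : Env Γ),
      (Tm.mul (.letE (.op .exp Tm.v₀) F.wk₁) (.op .exp Tm.v₀)).val (z, γ) =
      (F.val (Real.exp z, γ) * Real.exp z : ℝ) := fun z γ =>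
    congrArg (fun r : ℝ => r * Real.exp z) (Tm.val_wk₁ (u := .real) F (Real.exp z) z γ)
  refine h.of_pullback (fun σ => ?_) fun γ g hg =>
    ⟨fun w : ℝ => g (if 0 < w then Real.log w else 0 : ℝ),
    hg.comp (Op.measurable_eval (S := S) .log), ?_, fun ρ _ => Tm.lintegral_meas_op .log M _ hg⟩
  · exact (mul_nonneg (h.nonneg _) (Real.exp_pos _).le).trans_eq (hval σ.1 σ.2).symm
  · refine Eq.trans (lintegral_congr fun z => ?_)
      (lintegral_density_log (f := fun w => F.val (w, γ)) g fun w hw => h0 γ w hw)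
    rw [hval z γ]

theorem IsDensity.scale (h : IsDensity Υ E M F) {c : ℝ} (hc : c ≠ 0) :
    IsDensity Υ E (Tm.mul (.real c) M)
      (Tm.mul (.letE (Tm.div Tm.v₀ (.real c)) F.wk₁)
        (Tm.div (.real 1) (.op .abs (.real c)))) := by
  have hval : ∀ (z : ℝ) (γ : Env Γ), (Tm.mul (.letE (Tm.div Tm.v₀ (.real c)) F.wk₁)
      (Tm.div (.real 1) (.op .abs (.real c)))).val (z, γ) =
      (F.val ((z / c : ℝ), γ) * (1 / |c|) : ℝ) := fun z γ =>
    congrArg (fun r : ℝ => r * (1 / |c|)) (Tm.val_wk₁ (u := .real) F (z / c : ℝ) z γ)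
  refine h.of_pullback (fun σ => ?_) fun γ g hg => ⟨fun w : ℝ => g (c * w : ℝ),
    hg.comp (measurable_const.mul measurable_id : Measurable fun w : ℝ => c * w), ?_,
    fun ρ _ => Tm.lintegral_meas_op_pair_left .realMul (.real c) M _ hg⟩
  · exact (mul_nonneg (h.nonneg _) (one_div_nonneg.2 (abs_nonneg _))).trans_eq (hval σ.1 σ.2).symm
  · refine Eq.trans (lintegral_congr fun z => ?_)
      (lintegral_density_scale (f := fun w => F.val (w, γ)) g hc)
    rw [hval z γ]

theorem IsDensity.plusDet (h : IsDensity Υ E M F) {N : Tm S .pure (Δ ++ Γ) .real}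
    {N' : Tm S .tgt Γ .real}
    (hN : N'.rename (fun _ => Var.inR Υ.rands) = N.embed.subst Υ.consts) :
    IsDensity Υ E (Tm.add M N.embed) (.letE (Tm.sub Tm.v₀ N'.wk) F.wk₁) := by
  have hval : ∀ (z : ℝ) (γ : Env Γ), (Tm.letE (Tm.sub Tm.v₀ N'.wk) F.wk₁).val (z, γ) =
      F.val ((z - N'.val γ : ℝ), γ) := fun z γ =>
    (Tm.val_wk₁ (u := .real) F (z - N'.wk.val ((z, γ) : Env (.real :: Γ)) : ℝ) z γ).trans
      (congrArg (fun r : ℝ => F.val ((z - r : ℝ), γ)) (Tm.val_wk (u := .real) N' z γ))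
  refine h.of_pullback (fun σ => (h.nonneg _).trans_eq (hval σ.1 σ.2).symm) fun γ g hg =>
    ⟨fun w : ℝ => g (w + N'.val γ : ℝ),
    hg.comp (measurable_id.add measurable_const : Measurable fun w : ℝ => w + N'.val γ), ?_,
    fun ρ _ => ?_⟩
  · refine Eq.trans (lintegral_congr fun z => ?_)
      (lintegral_density_shift (f := fun w => F.val (w, γ)) g (N'.val γ))
    rw [hval z γ]
  · rw [← Υ.val_of_rename_inR_eq hN ρ γ]
    exact Tm.lintegral_meas_op_pair_right .realAdd M N _ hg

end Rules

section Rules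

variable {Γ Δ : Ctx} {Υ : PCtx S Γ Δ} {E : Tm S .tgt (Δ ++ Γ) .real} {t u : Ty}

/-! ### Tuples and discrete operations -/

/-- The tuple type carries the product measure of its listed variables; permuting them into the
order of the context reduces the claim to the defining property of the marginal density. -/
theorem IsDensity.tupleVar (hE : Υ.IsSubprob E) {X Y : Ctx} {us : List Ty}
    (s : Split Υ.rands X Y) (e : (v : Ty) → Var X v ≃ Var (t :: u :: us) v) :
    IsDensity Υ E
      (tuple t (u :: us) fun v x => Υ.incl v (s.incl Γ v (((e v).symm x).inL (Γ := Γ))))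
      (letTuple t (u :: us) Tm.v₀
        ((Υ.marg s E).rename
          (Ren.join (fun v x => (e v x).bindNew)
            (fun _ x => Var.bindOld (t :: u :: us) (.succ x))))) := by
  have hval : ∀ (z : Val (tupTy t (u :: us))) (γ : Env Γ),
      (letTuple t (u :: us) Tm.v₀
        ((Υ.marg s E).rename
          (Ren.join (fun v x => (e v x).bindNew)
            (fun _ x => Var.bindOld (t :: u :: us) (.succ x))))).val (z, γ) =
      (Υ.marg s E).val ((Env.reindex e (Env.ofTuple t (u :: us) z)).append γ) := by
    intro z γ
    rw [val_letTuple]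
    refine Tm.val_rename _ (Ren.Agrees.join (fun v x => ?_) fun v x => ?_)
    · rw [Env.reindex, Env.get_ofGet]
      exact Env.get_bindNew (t :: u :: us) (Γ := tupTy t (u :: us) :: Γ) _ ((z, γ) : Env (tupTy t (u :: us) :: Γ)) (e v x)
    · exact Env.get_bindOld (t :: u :: us) (Γ := tupTy t (u :: us) :: Γ) _ ((z, γ) : Env (tupTy t (u :: us) :: Γ)) (.succ x)
  refine ⟨fun σ => (PCtx.marg_nonneg hE s _ _).trans_eq (hval σ.1 σ.2).symm, fun γ g hg => ?_⟩
  have hmarg : Measurable fun η : Env X => ENNReal.ofReal ((Υ.marg s E).val (η.append γ)) :=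
    ((Υ.marg s E).measurable_val.comp (Env.measurable_append_right X γ)).ennreal_ofReal
  have htup := hg.comp (Env.measurable_toTuple t (u :: us))
  have hmtup : Measurable fun ζ : Env (t :: u :: us) =>
      ENNReal.ofReal ((Υ.marg s E).val ((Env.reindex e ζ).append γ)) *
        g (Env.toTuple t (u :: us) ζ) :=
    (hmarg.comp (Env.measurable_reindex e)).mul htup
  have hmX : Measurable fun η : Env X => ENNReal.ofReal ((Υ.marg s E).val (η.append γ)) *
      g (Env.toTuple t (u :: us) (Env.reindex (fun v => (e v).symm) η)) :=
    hmarg.mul (htup.comp (Env.measurable_reindex _))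
  have h₁ := lintegral_stock_tupTy t (u :: us) hmtup
  have h₂ := lintegral_stockEnv_reindex e hmX
  simp only [Env.reindex_symm_reindex] at h₂
  simp only [Env.toTuple_ofTuple] at h₁
  have h₃ := Υ.lintegral_marg s hE.nonneg γ (hE.le_one γ)
    (f := fun ρ => g (Env.toTuple t (u :: us) (Env.ofGet fun v x =>
      (ρ.append γ).get (s.incl Γ v (((e v).symm x).inL (Γ := Γ))))))
    (g := fun η => g (Env.toTuple t (u :: us) (Env.reindex (fun v => (e v).symm) η)))
    (htup.comp (Env.measurable_ofGet fun v x =>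
      (Env.measurable_get _).comp (Env.measurable_append_right _ γ)))
    (fun η θ => congrArg (fun ζ => g (Env.toTuple t (u :: us) ζ)) (Env.ext_get fun v x => by
      rw [Env.get_ofGet, Env.reindex, Env.get_ofGet, s.agrees_incl γ η θ, Env.get_inL]))
  simp only [hval]
  -- Tuple values are unpacked into valuations, permuted into the order of `X`, and completed by the
  -- variables that were integrated out.
  refine ((h₁.trans h₂.symm).trans h₃).trans (lintegral_congr fun ρ => congrArg _ ?_)
  rw [← embed_tuple, Tm.lintegral_meas_embed _ _ hg, embed_tuple, val_tuple]
  refine congrArg (fun ζ => g (Env.toTuple t (u :: us) ζ)) (Env.ext_get fun v x => ?_)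
  rw [Env.get_ofGet, Env.get_ofGet]
  exact (Υ.agrees_incl _ _ _).symm

/-- Once the variables in `X` are fixed, the result is one definite value, whose density is the
Iverson bracket; averaging with the marginal density over `X` gives the formula. -/
theorem IsDensity.discrete (hE : Υ.IsSubprob E) {X Y : Ctx} {f : Op S t u}
    {M : Tm S .pure (Δ ++ Γ) t} {M' : Tm S .tgt (X ++ Γ) t} (hu : u.Discrete)
    (s : Split Υ.rands X Y) (hM : M'.rename (s.incl Γ) = M.embed.subst Υ.consts) :
    IsDensity Υ E (.op f M.embed)
      (.integral rfl X
        (Tm.mul ((Υ.marg s E).rename (Ren.liftAll (Γ := Γ) Ren.succ X))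
          (Tm.iverson hu (.var (Var.inR X .zero))
            (.op f (M'.rename (Ren.liftAll (Γ := Γ) Ren.succ X)))))) := by
  have hval : ∀ (w : Val u) (γ : Env Γ) (η : Env X),
      (Tm.mul ((Υ.marg s E).rename (Ren.liftAll (Γ := Γ) (Ren.succ (u := u)) X))
          (Tm.iverson hu (.var (Var.inR X .zero))
            (.op f (M'.rename (Ren.liftAll (Γ := Γ) Ren.succ X))))).val
        (η.append ((w, γ) : Env (u :: Γ))) =
      ((Υ.marg s E).val (η.append γ) *
        (Op.iverson (S := S) u hu).eval (w, f.eval (M'.val (η.append γ))) : ℝ) := by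
    intro w γ η
    have hag := (Ren.agrees_succ (u := u) w γ).liftAll X η
    refine congrArg₂ (fun a b : ℝ => a * b) (Tm.val_rename _ hag) ?_
    refine congrArg₂ (fun a b => (Op.iverson (S := S) u hu).eval (a, b)) ?_
      (congrArg f.eval (Tm.val_rename M' hag))
    exact Env.get_inR (Var.zero (Γ := Γ)) ((w, γ) : Env (u :: Γ)) X η
  have hnonneg : ∀ (w : Val u) (γ : Env Γ) (η : Env X), (0 : ℝ) ≤
      (Υ.marg s E).val (η.append γ) *
        (Op.iverson (S := S) u hu).eval (w, f.eval (M'.val (η.append γ))) := fun w γ η =>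
    mul_nonneg (PCtx.marg_nonneg hE s η γ) (Op.iverson_nonneg hu _)
  refine ⟨fun σ => integral_nonneg fun η => (hnonneg σ.1 σ.2 η).trans_eq (hval σ.1 σ.2 η).symm,
    fun γ g hg => ?_⟩
  have hmM : Measurable fun η : Env X => f.eval (M'.val (η.append γ)) :=
    f.measurable_eval.comp (M'.measurable_val.comp (Env.measurable_append_right X γ))
  have hmarg : Measurable fun η : Env X => ((Υ.marg s E).val (η.append γ) : ℝ) :=
    (Υ.marg s E).measurable_val.comp (Env.measurable_append_right X γ)
  have hG : Measurable fun p : Val u × Env X => ((Υ.marg s E).val (p.2.append γ) *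
      (Op.iverson (S := S) u hu).eval (p.1, f.eval (M'.val (p.2.append γ))) : ℝ) :=
    (hmarg.comp measurable_snd).mul ((Op.measurable_eval (Op.iverson (S := S) u hu)).comp
      (measurable_fst.prodMk (hmM.comp measurable_snd)))
  -- Proved for all test functions because it serves twice: for the given `g`, and for `1`, which
  -- bounds the mass and so validates the Bochner integral.
  have key : ∀ g : Val u → ENNReal, Measurable g →
      ∫⁻ w, ∫⁻ η : Env X, ENNReal.ofReal ((Υ.marg s E).val (η.append γ) *
        (Op.iverson (S := S) u hu).eval (w, f.eval (M'.val (η.append γ))) : ℝ) * g w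
        ∂stockEnv X ∂stock u =
      ∫⁻ ρ, Υ.weight E γ ρ * g (f.eval (M.embed.val (Υ.env (ρ.append γ)))) ∂stockEnv Υ.rands := by
    intro g hg
    rw [lintegral_lintegral_swap (hG.ennreal_ofReal.mul (hg.comp measurable_fst)).aemeasurable]
    refine Eq.trans (lintegral_congr fun η => ?_) (Υ.lintegral_marg s hE.nonneg γ (hE.le_one γ)
      (g := fun η => g (f.eval (M'.val (η.append γ))))
      (hg.comp (f.measurable_eval.comp (M.embed.measurable_val.comp (Υ.measurable_env_append γ))))
      fun η θ => ?_)
    · have hm : Measurable fun w => ENNReal.ofReal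
          ((Op.iverson (S := S) u hu).eval (w, f.eval (M'.val (η.append γ)))) * g w :=
        (((Op.measurable_eval (Op.iverson (S := S) u hu)).comp
          measurable_prodMk_right).ennreal_ofReal).mul hg
      refine Eq.trans ?_ (congrArg (ENNReal.ofReal ((Υ.marg s E).val (η.append γ)) * ·)
        (lintegral_stock_iverson (S := S) hu (f.eval (M'.val (η.append γ))) g))
      refine Eq.trans (lintegral_congr fun w => ?_) (lintegral_const_mul _ hm)
      rw [ENNReal.ofReal_mul (PCtx.marg_nonneg hE s η γ), mul_assoc]
    · rw [← Tm.val_subst _ (Υ.agrees_consts ((s.merge η θ).append γ)), ← hM,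
        Tm.val_rename M' (s.agrees_incl γ η θ)]
  refine Eq.trans (lintegral_congr fun w => ?_) ((lintegral_ofReal_integral_mul hG
    (fun p => hnonneg p.1 γ p.2) ?_ g).trans ((key g hg).trans (lintegral_congr fun ρ => ?_)))
  · refine congrArg (fun r : ℝ => ENNReal.ofReal r * g w) ?_
    exact integral_congr_ae (ae_of_all _ fun η => hval w γ η)
  · have h1 := key (fun _ => 1) measurable_const
    simp only [mul_one] at h1
    exact h1.trans_le (hE.le_one γ)
  · have hm : Measurable fun w => g (f.eval w) := hg.comp f.measurable_eval
    rw [Tm.lintegral_meas_op _ _ _ hg, Tm.lintegral_meas_embed _ _ hm]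

/-! ### Let and match -/

theorem PCtx.IsSubprob.det (hE : Υ.IsSubprob E) {Q : Tm S .pure (Δ ++ Γ) t}
    {E' : Tm S .tgt (t :: (Δ ++ Γ)) .real} (h0 : ∀ σ, (0 : ℝ) ≤ E'.val σ)
    (hle : ∀ v σ, (E'.val (v, σ) : ℝ) ≤ E.val σ) :
    PCtx.IsSubprob (Δ := t :: Δ) (Υ.det Q) E' :=
  ⟨h0, fun γ => (lintegral_mono fun _ => ENNReal.ofReal_le_ofReal (hle _ _)).trans (hE.le_one γ)⟩

theorem IsDensity.letDet {M : Tm S .pure (Δ ++ Γ) t} {N : Tm S .src (t :: (Δ ++ Γ)) u}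
    {F : Tm S .tgt (u :: Γ) .real} (h : IsDensity (Δ := t :: Δ) (Υ.det M) E.wk N F) :
    IsDensity Υ E (.letE M.embed N) F := by
  refine ⟨h.nonneg, fun γ g hg => (h.lintegral_eq γ g hg).trans (lintegral_congr fun ρ => ?_)⟩
  have hm : Measurable fun z => ∫⁻ w, g w ∂N.meas (z, Υ.env (ρ.append γ)) :=
    (N.measurable_lintegral_meas hg).comp measurable_prodMk_right
  rw [Tm.lintegral_meas_letE _ _ _ hg, M.lintegral_meas_embed _ hm]
  exact congrArg (fun r : ℝ => ENNReal.ofReal r * _) (Tm.val_wk E _ _)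

/-- Tonelli for a product of a weight on the old variables and a factor `G` for the new one:
integrate the new variable first, with the others fixed. -/
theorem PCtx.lintegral_weight_rnd (Υ : PCtx S Γ Δ) {G : Tm S .tgt (t :: (Δ ++ Γ)) .real}
    (hE : ∀ σ, (0 : ℝ) ≤ E.val σ) (γ : Env Γ) {h : Env (t :: (Δ ++ Γ)) → ENNReal}
    (hh : Measurable h) :
    ∫⁻ ρ, PCtx.weight (Δ := t :: Δ) (Υ.rnd t) (Tm.mul E.wk G) γ ρ *
        h (PCtx.env (Δ := t :: Δ) (Υ.rnd t) (ρ.append γ)) ∂stockEnv (t :: Υ.rands) =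
      ∫⁻ ρ, Υ.weight E γ ρ * ∫⁻ v, ENNReal.ofReal (G.val (v, Υ.env (ρ.append γ))) *
        h (v, Υ.env (ρ.append γ)) ∂stock t ∂stockEnv Υ.rands := by
  have hm : Measurable fun p : Val t × Env Υ.rands =>
      (p.1, Υ.env (p.2.append γ)) :=
    measurable_fst.prodMk ((Υ.measurable_env_append γ).comp measurable_snd)
  have hw : ∀ p : Val t × Env Υ.rands,
      PCtx.weight (Δ := t :: Δ) (Υ.rnd t) (Tm.mul E.wk G) γ p *
        h (PCtx.env (Δ := t :: Δ) (Υ.rnd t) (Env.append (Δ := t :: Υ.rands) p γ)) =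
      Υ.weight E γ p.2 * (ENNReal.ofReal (G.val (p.1, Υ.env (p.2.append γ))) *
        h (p.1, Υ.env (p.2.append γ))) := by
    intro p
    rw [← mul_assoc, PCtx.weight, PCtx.weight, ← ENNReal.ofReal_mul (hE _)]
    refine congrArg (fun r : ℝ => ENNReal.ofReal r * h (p.1, Υ.env (p.2.append γ))) ?_
    exact congrArg (fun r : ℝ => r * G.val (p.1, Υ.env (p.2.append γ))) (Tm.val_wk E _ _)
  have hGh : Measurable fun p : Val t × Env Υ.rands =>
      ENNReal.ofReal (G.val (p.1, Υ.env (p.2.append γ))) * h (p.1, Υ.env (p.2.append γ)) :=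
    (G.measurable_val.comp hm).ennreal_ofReal.mul (hh.comp hm)
  refine (lintegral_congr hw).trans ?_
  refine (lintegral_prod_symm _
    (((Υ.measurable_weight E γ).comp measurable_snd).mul hGh).aemeasurable).trans ?_
  refine lintegral_congr fun ρ => ?_
  have hρ : Measurable fun v =>
      ENNReal.ofReal (G.val (v, Υ.env (ρ.append γ))) * h (v, Υ.env (ρ.append γ)) :=
    hGh.comp measurable_prodMk_right
  exact lintegral_const_mul (Υ.weight E γ ρ) hρ

theorem PCtx.measurable_weight_mul_lintegral (Υ : PCtx S Γ Δ) (E : Tm S .tgt (Δ ++ Γ) .real)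
    (G : Tm S .tgt (t :: (Δ ++ Γ)) .real) (γ : Env Γ) {h : Env (t :: (Δ ++ Γ)) → ENNReal}
    (hh : Measurable h) :
    Measurable fun ρ : Env Υ.rands => Υ.weight E γ ρ *
      ∫⁻ v, ENNReal.ofReal (G.val (v, Υ.env (ρ.append γ))) * h (v, Υ.env (ρ.append γ)) ∂stock t := by
  have hp : Measurable fun p : Env Υ.rands × Val t => (p.2, Υ.env (p.1.append γ)) :=
    measurable_snd.prodMk ((Υ.measurable_env_append γ).comp measurable_fst)
  have hGh : Measurable fun p : Env Υ.rands × Val t =>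
      ENNReal.ofReal (G.val (p.2, Υ.env (p.1.append γ))) * h (p.2, Υ.env (p.1.append γ)) :=
    (G.measurable_val.comp hp).ennreal_ofReal.mul (hh.comp hp)
  exact (Υ.measurable_weight E γ).mul hGh.lintegral_prod_right'

theorem PCtx.IsSubprob.rnd (hE : Υ.IsSubprob E) {G : Tm S .tgt (t :: (Δ ++ Γ)) .real}
    (h0 : ∀ σ, (0 : ℝ) ≤ G.val σ)
    (h1 : ∀ σ, ∫⁻ v, ENNReal.ofReal (G.val (v, σ)) ∂stock t ≤ 1) :
    PCtx.IsSubprob (Δ := t :: Δ) (Υ.rnd t) (Tm.mul E.wk G) := by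
  refine ⟨fun σ => mul_nonneg ((hE.nonneg σ.2).trans_eq (Tm.val_wk E σ.1 σ.2).symm) (h0 σ),
    fun γ => ?_⟩
  have := Υ.lintegral_weight_rnd (G := G) hE.nonneg γ (h := fun _ => 1) measurable_const
  simp only [mul_one] at this
  refine this.trans_le (le_trans (lintegral_mono fun ρ => ?_) (hE.le_one γ))
  exact (mul_le_mul_right (h1 _) _).trans (mul_one _).le

theorem PCtx.isSubprob_empty {Γ : Ctx} :
    PCtx.IsSubprob (S := S) (Γ := Γ) (Δ := []) .empty (.real 1) := by
  refine ⟨fun σ => zero_le_one, fun γ => ?_⟩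
  rw [lintegral_stockEnv_nil]
  simp [PCtx.weight, Tm.val]

/-- With no random variables the outer integral is evaluation at a single point of weight `1`. All
variables being parameters, `F` is a density separately at each valuation. -/
theorem IsDensity.lintegral_eq_meas {Γ : Ctx} {M : Tm S .src Γ t} {F : Tm S .tgt (t :: Γ) .real}
    (h : IsDensity (Γ := Γ) (Δ := []) .empty (.real 1) M F) (σ : Env Γ) {g : Val t → ENNReal}
    (hg : Measurable g) :
    ∫⁻ z, ENNReal.ofReal (F.val (z, σ)) * g z ∂stock t = ∫⁻ z, g z ∂M.meas σ := by
  rw [h.lintegral_eq σ g hg, lintegral_stockEnv_nil]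
  refine Eq.trans (congrArg (· * _) ?_) (one_mul _)
  simp [PCtx.weight, Tm.val]

theorem IsDensity.letRnd (hE : Υ.IsSubprob E) {M : Tm S .src (Δ ++ Γ) t}
    {N : Tm S .src (t :: (Δ ++ Γ)) u} {F₁ : Tm S .tgt (t :: (Δ ++ Γ)) .real}
    {F₂ : Tm S .tgt (u :: Γ) .real}
    (h₁ : IsDensity (Γ := Δ ++ Γ) (Δ := []) .empty (.real 1) M F₁)
    (h₂ : IsDensity (Δ := t :: Δ) (Υ.rnd t) (Tm.mul E.wk F₁) N F₂) :
    IsDensity Υ E (.letE M N) F₂ := by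
  refine ⟨h₂.nonneg, fun γ g hg => (h₂.lintegral_eq γ g hg).trans ?_⟩
  refine (Υ.lintegral_weight_rnd hE.nonneg γ (N.measurable_lintegral_meas hg)).trans ?_
  refine lintegral_congr fun ρ => congrArg _ ?_
  rw [Tm.lintegral_meas_letE _ _ _ hg]
  exact h₁.lintegral_eq_meas _ ((N.measurable_lintegral_meas hg).comp measurable_prodMk_right)

theorem IsDensity.add {v : Ty} {Δ₁ Δ₂ : Ctx} {Υ₁ : PCtx S Γ Δ₁} {Υ₂ : PCtx S Γ Δ₂}
    {E₁ : Tm S .tgt (Δ₁ ++ Γ) .real} {E₂ : Tm S .tgt (Δ₂ ++ Γ) .real} {M : Tm S .src (Δ ++ Γ) v}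
    {N₁ : Tm S .src (Δ₁ ++ Γ) v} {N₂ : Tm S .src (Δ₂ ++ Γ) v} {F₁ F₂ : Tm S .tgt (v :: Γ) .real}
    (h₁ : IsDensity Υ₁ E₁ N₁ F₁) (h₂ : IsDensity Υ₂ E₂ N₂ F₂)
    (H : ∀ (γ : Env Γ) (g : Val v → ENNReal), Measurable g →
      (∫⁻ ρ, Υ₁.weight E₁ γ ρ * ∫⁻ z, g z ∂N₁.meas (Υ₁.env (ρ.append γ)) ∂stockEnv Υ₁.rands) +
        ∫⁻ ρ, Υ₂.weight E₂ γ ρ * ∫⁻ z, g z ∂N₂.meas (Υ₂.env (ρ.append γ)) ∂stockEnv Υ₂.rands =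
      ∫⁻ ρ, Υ.weight E γ ρ * ∫⁻ z, g z ∂M.meas (Υ.env (ρ.append γ)) ∂stockEnv Υ.rands) :
    IsDensity Υ E M (Tm.add F₁ F₂) := by
  refine ⟨fun σ => add_nonneg (h₁.nonneg σ) (h₂.nonneg σ), fun γ g hg => ?_⟩
  have hm : Measurable fun z => ENNReal.ofReal (F₁.val (z, γ)) * g z :=
    (F₁.measurable_ofReal_val γ).mul hg
  rw [← H γ g hg, ← h₁.lintegral_eq γ g hg, ← h₂.lintegral_eq γ g hg, ← lintegral_add_left hm]
  refine lintegral_congr fun z => ?_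
  rw [← add_mul, ← ENNReal.ofReal_add (h₁.nonneg _) (h₂.nonneg _)]
  rfl

/-- The integral against the density `F` of the scrutinee splits into one over each summand, and
each part is the integral attached to one branch. -/
theorem IsDensity.matchRnd (hE : Υ.IsSubprob E) {v : Ty} {M : Tm S .src (Δ ++ Γ) (.sum t u)}
    {N₁ : Tm S .src (t :: (Δ ++ Γ)) v} {N₂ : Tm S .src (u :: (Δ ++ Γ)) v}
    {F : Tm S .tgt (.sum t u :: (Δ ++ Γ)) .real} {F₁ F₂ : Tm S .tgt (v :: Γ) .real}
    (h : IsDensity (Γ := Δ ++ Γ) (Δ := []) .empty (.real 1) M F)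
    (h₁ : IsDensity (Δ := t :: Δ) (Υ.rnd t) (Tm.mul E.wk (.letE (.inl Tm.v₀) F.wk₁)) N₁ F₁)
    (h₂ : IsDensity (Δ := u :: Δ) (Υ.rnd u) (Tm.mul E.wk (.letE (.inr Tm.v₀) F.wk₁)) N₂ F₂) :
    IsDensity Υ E (.cases M N₁ N₂) (Tm.add F₁ F₂) := by
  refine h₁.add h₂ fun γ g hg => ?_
  have e₁ := Υ.lintegral_weight_rnd (G := .letE (.inl Tm.v₀) F.wk₁) hE.nonneg γ
    (N₁.measurable_lintegral_meas hg)
  have e₂ := Υ.lintegral_weight_rnd (G := .letE (.inr Tm.v₀) F.wk₁) hE.nonneg γ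
    (N₂.measurable_lintegral_meas hg)
  refine (congrArg₂ (· + ·) e₁ e₂).trans ?_
  have hm : ∀ σ : Env (Δ ++ Γ), Measurable (Sum.elim (fun x => ∫⁻ w, g w ∂N₁.meas (x, σ))
      (fun y => ∫⁻ w, g w ∂N₂.meas (y, σ))) := fun σ =>
    ((N₁.measurable_lintegral_meas hg).comp measurable_prodMk_right).sumElim
      ((N₂.measurable_lintegral_meas hg).comp measurable_prodMk_right)
  have hmL := Υ.measurable_weight_mul_lintegral E (.letE (.inl Tm.v₀) F.wk₁) γ
    (N₁.measurable_lintegral_meas hg)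
  rw [← lintegral_add_left hmL]
  refine lintegral_congr fun ρ => ?_
  rw [← mul_add, Tm.lintegral_meas_cases _ _ _ _ hg, ← h.lintegral_eq_meas _ (hm _)]
  refine congrArg _ (Eq.trans ?_ (lintegral_stock_sum t u _).symm)
  exact congrArg₂ (· + ·)
    (lintegral_congr fun x => congrArg (fun r : ℝ => ENNReal.ofReal r * _) (Tm.val_wk₁ F _ _ _))
    (lintegral_congr fun x => congrArg (fun r : ℝ => ENNReal.ofReal r * _) (Tm.val_wk₁ F _ _ _))

theorem PCtx.measurable_weight_mul_meas (Υ : PCtx S Γ Δ) (E : Tm S .tgt (Δ ++ Γ) .real)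
    (M : Tm S .src (Δ ++ Γ) t) (γ : Env Γ) {g : Val t → ENNReal} (hg : Measurable g) :
    Measurable fun ρ : Env Υ.rands =>
      Υ.weight E γ ρ * ∫⁻ z, g z ∂M.meas (Υ.env (ρ.append γ)) :=
  (Υ.measurable_weight E γ).mul
    ((M.measurable_lintegral_meas hg).comp (Υ.measurable_env_append γ))

/-- At every valuation exactly one of the indicators `isL`, `isR` is `1`, so the two weights split
that of `E` without overlap. -/
theorem IsDensity.matchDet (hE : Υ.IsSubprob E) {v : Ty} {M : Tm S .pure (Δ ++ Γ) (.sum t u)}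
    {N₁ : Tm S .src (t :: (Δ ++ Γ)) v} {N₂ : Tm S .src (u :: (Δ ++ Γ)) v}
    {F₁ F₂ : Tm S .tgt (v :: Γ) .real}
    (h₁ : IsDensity (Δ := t :: Δ) (Υ.det (.op (.fromL t u) M))
      (Tm.wk (Γ := Δ ++ Γ) (Tm.mul E (.op (.isL t u) M.embed))) N₁ F₁)
    (h₂ : IsDensity (Δ := u :: Δ) (Υ.det (.op (.fromR t u) M))
      (Tm.wk (Γ := Δ ++ Γ) (Tm.mul E (.op (.isR t u) M.embed))) N₂ F₂) :
    IsDensity Υ E (.cases M.embed N₁ N₂) (Tm.add F₁ F₂) := by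
  refine h₁.add h₂ fun γ g hg => ?_
  have hm : ∀ σ : Env (Δ ++ Γ), Measurable (Sum.elim (fun x => ∫⁻ w, g w ∂N₁.meas (x, σ))
      (fun y => ∫⁻ w, g w ∂N₂.meas (y, σ))) := fun σ =>
    ((N₁.measurable_lintegral_meas hg).comp measurable_prodMk_right).sumElim
      ((N₂.measurable_lintegral_meas hg).comp measurable_prodMk_right)
  have hmL := PCtx.measurable_weight_mul_meas (Δ := t :: Δ) (Υ.det (.op (.fromL t u) M))
    (Tm.wk (Γ := Δ ++ Γ) (Tm.mul E (.op (.isL t u) M.embed))) N₁ γ hg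
  refine (lintegral_add_left hmL _).symm.trans (lintegral_congr fun ρ => ?_)
  have hwL : PCtx.weight (Δ := t :: Δ) (Υ.det (.op (.fromL t u) M))
      (Tm.wk (Γ := Δ ++ Γ) (Tm.mul E (.op (.isL t u) M.embed))) γ ρ =
      Υ.weight E γ ρ *
        Sum.elim (fun _ => 1) (fun _ => 0) (M.embed.val (Υ.env (ρ.append γ))) := by
    rw [PCtx.weight, PCtx.weight]
    refine (congrArg (fun r : ℝ => ENNReal.ofReal r) (Tm.val_wk (Γ := Δ ++ Γ) _ _ _)).trans ?_
    refine (ENNReal.ofReal_mul (hE.nonneg _)).trans (congrArg _ ?_)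
    simp only [Tm.val, Op.eval]
    cases M.embed.val (Υ.env (ρ.append γ)) <;> simp
  have hwR : PCtx.weight (Δ := u :: Δ) (Υ.det (.op (.fromR t u) M))
      (Tm.wk (Γ := Δ ++ Γ) (Tm.mul E (.op (.isR t u) M.embed))) γ ρ =
      Υ.weight E γ ρ *
        Sum.elim (fun _ => 0) (fun _ => 1) (M.embed.val (Υ.env (ρ.append γ))) := by
    rw [PCtx.weight, PCtx.weight]
    refine (congrArg (fun r : ℝ => ENNReal.ofReal r) (Tm.val_wk (Γ := Δ ++ Γ) _ _ _)).trans ?_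
    refine (ENNReal.ofReal_mul (hE.nonneg _)).trans (congrArg _ ?_)
    simp only [Tm.val, Op.eval]
    cases M.embed.val (Υ.env (ρ.append γ)) <;> simp
  rw [hwL, hwR, Tm.lintegral_meas_cases _ _ _ _ hg, M.lintegral_meas_embed _ (hm _)]
  simp only [PCtx.env, Tm.embed, Tm.val, Op.eval]
  -- On the surviving branch `fromL` or `fromR` recovers the true component; on the other the
  -- default is multiplied by zero.
  cases M.embed.val (Υ.env (ρ.append γ)) <;> simp

end Rules

/-! ## Soundness -/

/-! ### Preservation of the context invariants by a match on a pure expression -/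

section Branches

variable {Γ Δ : Ctx} {Υ : PCtx S Γ Δ} {E : Tm S .tgt (Δ ++ Γ) .real} {t u : Ty}
  {M : Tm S .pure (Δ ++ Γ) (.sum t u)}

theorem Tm.val_wk_mul_isL (v : Val t) (σ : Env (Δ ++ Γ)) :
    (Tm.wk (Γ := Δ ++ Γ) (Tm.mul E (.op (.isL t u) M.embed))).val (v, σ) =
      (E.val σ *
        Sum.elim (fun _ => 1) (fun _ => 0) (M.embed.val σ) : ℝ) :=
  Tm.val_wk (Γ := Δ ++ Γ) _ v σ

theorem PCtx.IsSubprob.matchL (hE : Υ.IsSubprob E) :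
    PCtx.IsSubprob (Δ := t :: Δ) (Υ.det (.op (.fromL t u) M))
      (Tm.wk (Γ := Δ ++ Γ) (Tm.mul E (.op (.isL t u) M.embed))) := by
  refine hE.det (fun σ => ?_) fun v σ => ?_
  · refine le_of_le_of_eq ?_ (Tm.val_wk_mul_isL (M := M) σ.1 σ.2).symm
    have h0 := hE.nonneg σ.2
    cases M.embed.val σ.2 <;> simp [h0]
  · refine (Tm.val_wk_mul_isL (M := M) v σ).trans_le ?_
    have h0 := hE.nonneg σ
    cases M.embed.val σ <;> simp [h0]

/-- A nonzero product has nonzero `isL`, which is precisely the guard of the new definition; the old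
guards hold because the factor `E` is nonzero too. -/
theorem PCtx.Admissible.matchL (hA : Υ.Admissible E) (hM : (M.embed : Tm S .src _ _).IsSource) :
    PCtx.Admissible (Δ := t :: Δ) (Υ.det (.op (.fromL t u) M))
      (Tm.wk (Γ := Δ ++ Γ) (Tm.mul E (.op (.isL t u) M.embed))) := by
  refine hA.det hM fun v σ h => ?_
  have h' := (Tm.val_wk_mul_isL (M := M) v σ).symm.trans_ne h
  refine ⟨left_ne_zero_of_mul h', ?_⟩
  have h1 := right_ne_zero_of_mul h'
  change ∃ x, M.embed.val σ = Sum.inl x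
  revert h1
  cases M.embed.val σ <;> simp

theorem Tm.val_wk_mul_isR (v : Val u) (σ : Env (Δ ++ Γ)) :
    (Tm.wk (Γ := Δ ++ Γ) (Tm.mul E (.op (.isR t u) M.embed))).val (v, σ) =
      (E.val σ *
        Sum.elim (fun _ => 0) (fun _ => 1) (M.embed.val σ) : ℝ) :=
  Tm.val_wk (Γ := Δ ++ Γ) _ v σ

theorem PCtx.IsSubprob.matchR (hE : Υ.IsSubprob E) :
    PCtx.IsSubprob (Δ := u :: Δ) (Υ.det (.op (.fromR t u) M))
      (Tm.wk (Γ := Δ ++ Γ) (Tm.mul E (.op (.isR t u) M.embed))) := by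
  refine hE.det (fun σ => ?_) fun v σ => ?_
  · refine le_of_le_of_eq ?_ (Tm.val_wk_mul_isR (M := M) σ.1 σ.2).symm
    have h0 := hE.nonneg σ.2
    cases M.embed.val σ.2 <;> simp [h0]
  · refine (Tm.val_wk_mul_isR (M := M) v σ).trans_le ?_
    have h0 := hE.nonneg σ
    cases M.embed.val σ <;> simp [h0]

theorem PCtx.Admissible.matchR (hA : Υ.Admissible E) (hM : (M.embed : Tm S .src _ _).IsSource) :
    PCtx.Admissible (Δ := u :: Δ) (Υ.det (.op (.fromR t u) M))
      (Tm.wk (Γ := Δ ++ Γ) (Tm.mul E (.op (.isR t u) M.embed))) := by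
  refine hA.det hM fun v σ h => ?_
  have h' := (Tm.val_wk_mul_isR (M := M) v σ).symm.trans_ne h
  refine ⟨left_ne_zero_of_mul h', ?_⟩
  have h1 := right_ne_zero_of_mul h'
  change ∃ x, M.embed.val σ = Sum.inr x
  revert h1
  cases M.embed.val σ <;> simp

end Branches

/-- The hypotheses stand to the right of the colon because context, factor and expression all change
along the derivation, and each rule has to re-establish them for its premises. -/
theorem Dens.isDensity {Γ Δ : Ctx} {Υ : PCtx S Γ Δ} {E : Tm S .tgt (Δ ++ Γ) .real} {t : Ty}
    {M : Tm S .src (Δ ++ Γ) t} {F : Tm S .tgt (t :: Γ) .real} (h : Dens Υ E M F) :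
    Υ.IsSubprob E → Υ.Admissible E → M.IsAlmostSource → IsDensity Υ E M F := by
  induction h with
  -- The definition may have a reserved operation at its head; admissibility says that it is still
  -- almost source.
  | varDet hx _ ih => exact fun hE hA _ => (ih hE hA (hA _ _ _ hx).1).varDet hx
  | varRnd s => exact fun hE _ _ => .varRnd hE s
  | constant V ht => exact fun hE _ _ => .constant hE V ht
  | fail => exact fun _ _ _ => .fail
  | randomConst _ hM => exact fun hE _ _ => .randomConst hE hM
  | randomRnd _ _ ih =>
    exact fun hE hA hM => (ih hE hA (Tm.IsSource.isAlmostSource hM)).randomRnd hE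
  | tupleVar s e => exact fun hE _ _ => .tupleVar hE s e
  | fst _ ih => exact fun hE hA hM => (ih hE hA (Tm.IsSource.isAlmostSource hM)).fst hE
  | snd _ ih => exact fun hE hA hM => (ih hE hA (Tm.IsSource.isAlmostSource hM)).snd hE
  | letDet _ ih =>
    intro hE hA hM
    refine (ih (hE.det (fun σ => ?_) fun v σ => ?_) (hA.det (Tm.IsSource.isAlmostSource hM.1)
      fun v σ h => ⟨?_, Tm.guarded_of_isSource _ hM.1 σ⟩)
      (Tm.IsSource.isAlmostSource hM.2)).letDet
    · exact (hE.nonneg σ.2).trans_eq (Tm.val_wk _ σ.1 σ.2).symm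
    · exact (Tm.val_wk _ v σ).le
    · exact (Tm.val_wk _ v σ).symm.trans_ne h
  | letRnd _ _ _ ih₁ ih₂ =>
    intro hE hA hM
    -- The bound expression is compiled in the empty context, all outer variables becoming
    -- parameters, so the context hypotheses hold trivially there.
    have h₁ := ih₁ PCtx.isSubprob_empty (PCtx.admissible_empty _) (Tm.IsSource.isAlmostSource hM.1)
    refine h₁.letRnd hE (ih₂ (hE.rnd h₁.nonneg (h₁.lintegral_le_one PCtx.isSubprob_empty))
      (hA.rnd fun v σ h => ?_) (Tm.IsSource.isAlmostSource hM.2))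
    exact (Tm.val_wk _ v σ).symm.trans_ne (left_ne_zero_of_mul (a := (_ : ℝ)) h)
  | inl _ ih => exact fun hE hA hM => (ih hE hA (Tm.IsSource.isAlmostSource hM)).inl
  | inr _ ih => exact fun hE hA hM => (ih hE hA (Tm.IsSource.isAlmostSource hM)).inr
  | matchDet _ _ ih₁ ih₂ =>
    intro hE hA hM
    exact (ih₁ hE.matchL (hA.matchL hM.1) (Tm.IsSource.isAlmostSource hM.2.1)).matchDet hE
      (ih₂ hE.matchR (hA.matchR hM.1) (Tm.IsSource.isAlmostSource hM.2.2))
  | matchRnd _ _ _ _ ih ih₁ ih₂ =>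
    intro hE hA hM
    have h := ih PCtx.isSubprob_empty (PCtx.admissible_empty _) (Tm.IsSource.isAlmostSource hM.1)
    refine h.matchRnd hE
      (ih₁ (hE.rnd (fun σ => ?_) fun σ => ?_) (hA.rnd fun v σ h => ?_)
        (Tm.IsSource.isAlmostSource hM.2.1))
      (ih₂ (hE.rnd (fun σ => ?_) fun σ => ?_) (hA.rnd fun v σ h => ?_)
        (Tm.IsSource.isAlmostSource hM.2.2))
    · exact (h.nonneg (Sum.inl σ.1, σ.2)).trans_eq (Tm.val_wk₁ _ _ _ _).symm
    -- The left summand carries only part of the total mass of the scrutinee.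
    · refine le_trans ?_ (h.lintegral_le_one PCtx.isSubprob_empty σ)
      refine le_trans ?_ (lintegral_stock_sum _ _ _).ge
      exact le_add_right (lintegral_mono fun x =>
        (congrArg (fun r : ℝ => ENNReal.ofReal r) (Tm.val_wk₁ _ _ _ _)).le)
    · exact (Tm.val_wk _ v σ).symm.trans_ne (left_ne_zero_of_mul (a := (_ : ℝ)) h)
    · exact (h.nonneg (Sum.inr σ.1, σ.2)).trans_eq (Tm.val_wk₁ _ _ _ _).symm
    · refine le_trans ?_ (h.lintegral_le_one PCtx.isSubprob_empty σ)
      refine le_trans ?_ (lintegral_stock_sum _ _ _).ge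
      exact le_add_left (lintegral_mono fun x =>
        (congrArg (fun r : ℝ => ENNReal.ofReal r) (Tm.val_wk₁ _ _ _ _)).le)
    · exact (Tm.val_wk _ v σ).symm.trans_ne (left_ne_zero_of_mul (a := (_ : ℝ)) h)
  | fromL hx _ ih =>
    exact fun hE hA hM => (ih hE hA (Tm.IsSource.isAlmostSource hM)).fromL hA hx
  | fromR hx _ ih =>
    exact fun hE hA hM => (ih hE hA (Tm.IsSource.isAlmostSource hM)).fromR hA hx
  | discrete hu s _ hM _ => exact fun hE _ _ => .discrete hE hu s hM
  | inverse _ ih => exact fun hE hA hM => (ih hE hA (Tm.IsSource.isAlmostSource hM.2)).inverse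
  | exp _ ih => exact fun hE hA hM => (ih hE hA (Tm.IsSource.isAlmostSource hM)).exp
  | log _ h0 ih =>
    refine fun hE hA hM => (ih hE hA (Tm.IsSource.isAlmostSource hM)).log fun σ r hr => ?_
    by_contra hne
    exact h0 ⟨σ, r, _, hr, hne, rfl⟩
  | scale hc _ ih => exact fun hE hA hM => (ih hE hA (Tm.IsSource.isAlmostSource hM.2)).scale hc
  | plusDet _ hN _ ih =>
    exact fun hE hA hM => (ih hE hA (Tm.IsSource.isAlmostSource hM.1)).plusDet hN
  | plusRnd _ _ ih => exact fun hE hA hM => (ih hE hA (Tm.IsSource.isAlmostSource hM)).plusRnd hE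

end DensityCompiler

theorem mainTheorem1 (S : Signature) {t : Ty} (M : Tm S .src [] t) (hM : M.IsSource)
    (F : Tm S .tgt [t] .real) (hF : Dens (Γ := []) (Δ := []) .empty (.real 1) M F) :
    M.meas () Set.univ ≤ 1 ∧
    (Measurable fun z : Val t => F.val (z, ())) ∧
    (∀ z : Val t, 0 ≤ F.val (z, ())) ∧
    ∀ A : Set (Val t), NullMeasurableSet A (stock t) →
      M.meas () A = ∫⁻ z in A, ENNReal.ofReal (F.val (z, ())) ∂(stock t) := by
  have h := hF.isDensity PCtx.isSubprob_empty (PCtx.admissible_empty _) hM.isAlmostSource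
  have hm := F.measurable_ofReal_val ()
  have heq : M.meas () = (stock t).withDensity fun z => ENNReal.ofReal (F.val (z, ())) := by
    refine Measure.ext_of_lintegral _ fun g hg => ?_
    rw [lintegral_withDensity_eq_lintegral_mul _ hm hg]
    exact (h.lintegral_eq_meas () hg).symm
  refine ⟨M.meas_univ_le_one (), F.measurable_val.comp measurable_prodMk_right,
    fun z => h.nonneg (z, ()), fun A hA => ?_⟩
  -- Once the measures are equal, null-measurability of `A` for the stock measure suffices to
  -- evaluate the density, which covers the completed σ-algebra.
  rw [heq, withDensity_apply₀ _ hA]
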